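/- **Setting.** Let $M\ge 1$ and let $N\ge 2M$ be a multiple of $M$. At each time $n=1,\dots,N$ one of two actions is applied; action $\ell$ gives an independent Gaussian income $\xi_n$ with mean $m_\ell$ and variance $1$. Consider all randomized history-dependent strategies $\sigma$ which apply each chosen action $M$ times in a row. For $\theta=(m_1,m_2)=(m+v,m-v)$ the loss is $L_N(\sigma,\theta)=N\max(m_1,m_2)-\mathbb E_{\sigma,\theta}\sum_{n=1}^N\xi_n$. Fix $c>0$ and a symmetric probability density $\varrho$ on $[-c,c]$, and put $\varepsilon=M/N$, $C=cN^{-1/2}$, $\rho(v)=N^{1/2}\varrho(N^{1/2}v)$, so that $w=vN^{1/2}$ has density $\varrho$ and $\theta$ ranges over the close expectations $|m_1-m_2|\le 2cN^{-1/2}$. For $a>0$ let $\nu_a(m,v)=\frac1{2a}\mathbf 1_{\{|m|\le a\}}\rho(v)$, let $R^B_N(\nu_a)=\inf_\sigma\iint L_N(\sigma,(m+v,m-v))\,\nu_a(m,v)\,dm\,dv$, and let $R^B_N(\rho)=\lim_{a\to\infty}R^B_N(\nu_a)$. After $n_\ell$ applications of action $\ell$ with total income $X_\ell$ ($\ell=1,2$,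 $n=n_1+n_2$), put $U=(X_1n_2-X_2n_1)/n$, $u=U/\sqrt N$, $t_\ell=n_\ell/N$, $t=t_1+t_2$. Let $f_D(x)=(2\pi D)^{-1/2}e^{-x^2/(2D)}$. **Theorem 2.** For $u\in\mathbb R$ and positive multiples $t_1,t_2$ of $\varepsilon$ with $t=t_1+t_2\le1$, the following recursive equation has a unique solution (with convergent integrals): $$r_\varepsilon(u,t_1,t_2)=\min_{\ell=1,2}r^{(\ell)}_\varepsilon(u,t_1,t_2),$$ where $r^{(1)}_\varepsilon=r^{(2)}_\varepsilon=0$ if $t_1+t_2=1$ and, if $t_1+t_2<1$, $$r^{(1)}_\varepsilon(u,t_1,t_2)=\varepsilon g^{(1)}(u,t_1,t_2)+\int_{-\infty}^{\infty} r_\varepsilon(u-x,t_1+\varepsilon,t_2)\,f_{\varepsilon t_2^2t^{-1}(t+\varepsilon)^{-1}}(x)\,dx,$$ $$r^{(2)}_\varepsilon(u,t_1,t_2)=\varepsilon g^{(2)}(u,t_1,t_2)+\int_{-\infty}^{\infty} r_\varepsilon(u-x,t_1,t_2+\varepsilon)\,f_{\varepsilon t_1^2t^{-1}(t+\varepsilon)^{-1}}(x)\,dx,$$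 $$g^{(\ell)}(u,t_1,t_2)=\int_0^c 2w\exp\!\big((-1)^\ell 2uw-2w^2t_1t_2t^{-1}\big)\varrho(w)\,dw .$$ The limit $R^B_N(\rho)$ exists, and $$N^{-1/2}R^B_N(\rho)=4\varepsilon\int_0^c w\varrho(w)\,dw+\int_{-\infty}^{\infty} r_\varepsilon(u,\varepsilon,\varepsilon)\,f_{0.5\varepsilon}(u)\,du,$$ where the integrals converge. This risk is attained by applying the actions turn-by-turn at the initial stage $t\le2\varepsilon$ and then always choosing an action with the smaller value of $r^{(\ell)}_\varepsilon(u,t_1,t_2)$ at the current state: such strategies $\sigma$ exist, and, for an arbitrary choice in case of equality, each of them satisfies $\iint L_N(\sigma,(m+v,m-v))\,\nu_a\,dm\,dv\to R^B_N(\rho)$ as $a\to\infty$. Moreover, whenever both actions have been applied and $n<N$, action $\ell$ is currently optimal if and only if $r^{(\ell)}_\varepsilon(u,t_1,t_2)$ is the smaller of the two values (not larger than the other one). Here "currently optimal" means that applying $\ell$ to the next batch, followed by the best continuation, minimizes the expected loss on the remaining $N-n$ steps under the posterior distribution of $(m,v)$ given the history, computed with the prior density $\rho(v)$, $|v|\le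 C$, constant in $m$. -/

import Mathlib

open Real Set Filter Topology MeasureTheory ProbabilityTheory

namespace Bandit

/-! Actions are indexed by `Fin 2`: the index `0` is the first action and `1` is the second one.
The control horizon is `N = K * M`; incomes are processed in `K` batches of size `M`. -/

/-- The Gaussian density `f_D(x | m)` with mean `m` and variance `D`. -/
noncomputable def gaussDensity (D m x : ℝ) : ℝ :=
  gaussianPDFReal m D.toNNReal x

/-- A randomized control strategy which applies each chosen action `M` times. After `k` batches
the history consists of the chosen actions `y` and of all individual incomes `x`; the number
`prob k y x ℓ` is the probability to choose the action `ℓ` for the next batch. -/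
structure Strategy (M : ℕ) where
  prob : (k : ℕ) → (Fin k → Fin 2) → (Fin k → Fin M → ℝ) → Fin 2 → ℝ
  prob_nonneg : ∀ k y x ℓ, 0 ≤ prob k y x ℓ
  prob_sum : ∀ k y x, ∑ ℓ, prob k y x ℓ = 1
  prob_measurable : ∀ k y ℓ, Measurable fun x => prob k y x ℓ

/-- The expected total income over the next `j` batches, when the strategy `σ` is used and the
current history `(y, x)` consists of `k` batches. The single incomes are independent and Gaussian
with variance one and mean `θ ℓ`, where `ℓ` is the chosen action. -/
noncomputable def expectedIncome {M : ℕ} (σ : Strategy M) (θ : Fin 2 → ℝ) :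
    (j k : ℕ) → (Fin k → Fin 2) → (Fin k → Fin M → ℝ) → ℝ
  | 0, _, _, _ => 0
  | j + 1, k, y, x =>
      ∑ ℓ, σ.prob k y x ℓ *
        ∫ z : Fin M → ℝ,
          ((∑ i, z i) +
            expectedIncome σ θ j (k + 1) (Fin.snoc (α := fun _ => Fin 2) y ℓ)
              (Fin.snoc (α := fun _ => Fin M → ℝ) x z))
          ∂(Measure.pi fun _ : Fin M => gaussianReal (θ ℓ) 1)

/-- Expected losses of income over the next `j` batches, given a history of `k` batches. -/
noncomputable def lossToGo {M : ℕ} (σ : Strategy M) (θ : Fin 2 → ℝ)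
    (j k : ℕ) (y : Fin k → Fin 2) (x : Fin k → Fin M → ℝ) : ℝ :=
  (j : ℝ) * M * max (θ 0) (θ 1) - expectedIncome σ θ j k y x

/-- The loss function over the whole horizon of `K` batches. -/
noncomputable def loss {M : ℕ} (K : ℕ) (σ : Strategy M) (θ : Fin 2 → ℝ) : ℝ :=
  lossToGo σ θ K 0 Fin.elim0 Fin.elim0

/-- The parameter `θ = (m + v, m - v)` with coordinates `p = (m, v)`. -/
def param (p : ℝ × ℝ) : Fin 2 → ℝ := ![p.1 + p.2, p.1 - p.2]

/-- The set of parameters `|m₁ - m₂| ≤ 2 C`, i.e. `|v| ≤ C`, in the coordinates `(m, v)`. -/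
def paramSet (C : ℝ) : Set (ℝ × ℝ) := {p | |p.2| ≤ C}

/-- The loss averaged over the prior density `ν` of `(m, v)`. -/
noncomputable def averageLoss {M : ℕ} (K : ℕ) (C : ℝ) (ν : ℝ × ℝ → ℝ) (σ : Strategy M) : ℝ :=
  ∫ p in paramSet C, loss K σ (param p) * ν p

/-- The Bayesian risk for the prior density `ν` of `(m, v)`. -/
noncomputable def bayesRisk (M K : ℕ) (C : ℝ) (ν : ℝ × ℝ → ℝ) : ℝ :=
  ⨅ σ : Strategy M, averageLoss K C ν σ

/-- `ρ` is a symmetric probability density on the interval `[-c, c]`. -/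
structure IsSymmDensity (c : ℝ) (ρ : ℝ → ℝ) : Prop where
  measurable : Measurable ρ
  nonneg : ∀ w, 0 ≤ ρ w
  symm : ∀ w, ρ (-w) = ρ w
  integral_eq_one : ∫ w in (-c)..c, ρ w = 1

/-- The prior density `ν_a(m, v) = κ_a(m) ρ(v)`, with `κ_a` uniform on `[-a, a]`. -/
noncomputable def uniformPrior (a : ℝ) (ρ : ℝ → ℝ) (p : ℝ × ℝ) : ℝ :=
  (Set.Icc (-a) a).indicator (fun _ => 1 / (2 * a)) p.1 * ρ p.2

/-- The limiting (improper) prior density, which is constant with respect to `m`. -/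
def flatPrior (ρ : ℝ → ℝ) (p : ℝ × ℝ) : ℝ := ρ p.2

/-- The density of `v = w / √N`, where `w` has the density `ϱ`. -/
noncomputable def unscale (N : ℕ) (ϱ : ℝ → ℝ) (v : ℝ) : ℝ := √N * ϱ (√N * v)

/-! ### Histories -/

/-- Number of applications `n_ℓ` of the action `ℓ` in a history. -/
def count (M : ℕ) {k : ℕ} (y : Fin k → Fin 2) (ℓ : Fin 2) : ℕ :=
  M * (Finset.univ.filter fun i => y i = ℓ).card

/-- Total income `X_ℓ` for the applications of the action `ℓ` in a history. -/
def income {M k : ℕ} (y : Fin k → Fin 2) (x : Fin k → Fin M → ℝ) (ℓ : Fin 2) : ℝ :=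
  ∑ i ∈ Finset.univ.filter (fun i => y i = ℓ), ∑ j, x i j

/-- The statistic `U = (X₁ n₂ - X₂ n₁) / n`. -/
noncomputable def statU {M k : ℕ} (y : Fin k → Fin 2) (x : Fin k → Fin M → ℝ) : ℝ :=
  (income y x 0 * count M y 1 - income y x 1 * count M y 0) / (count M y 0 + count M y 1)

/-- Both actions have been applied in the history. -/
def BothUsed {k : ℕ} (y : Fin k → Fin 2) : Prop := ∀ ℓ, ∃ i, y i = ℓ

/-- Likelihood of the incomes `x` received for the actions `y`. -/
noncomputable def likelihood {M k : ℕ} (y : Fin k → Fin 2) (x : Fin k → Fin M → ℝ)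
    (θ : Fin 2 → ℝ) : ℝ :=
  ∏ i, ∏ j, gaussDensity 1 (θ (y i)) (x i j)

/-- Posterior density of `(m, v)` on the parameter set, for the prior `ν` and a given history. -/
noncomputable def posterior {M k : ℕ} (C : ℝ) (ν : ℝ × ℝ → ℝ)
    (y : Fin k → Fin 2) (x : Fin k → Fin M → ℝ) (p : ℝ × ℝ) : ℝ :=
  likelihood y x (param p) * ν p / ∫ q in paramSet C, likelihood y x (param q) * ν q

/-- Bayesian risk on the remaining `K - k` batches with respect to the posterior, if the action
`ℓ` is applied to the next batch and the control is arbitrary afterwards. -/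
noncomputable def actionRisk {M k : ℕ} (K : ℕ) (C : ℝ) (ν : ℝ × ℝ → ℝ)
    (y : Fin k → Fin 2) (x : Fin k → Fin M → ℝ) (ℓ : Fin 2) : ℝ :=
  ⨅ σ : {σ : Strategy M // σ.prob k y x ℓ = 1},
    ∫ p in paramSet C, lossToGo σ.1 (param p) (K - k) k y x * posterior C ν y x p

/-- The action `ℓ` is currently optimal, given the history. -/
def IsCurrentlyOptimal {M k : ℕ} (K : ℕ) (C : ℝ) (ν : ℝ × ℝ → ℝ)
    (y : Fin k → Fin 2) (x : Fin k → Fin M → ℝ) (ℓ : Fin 2) : Prop :=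
  ∀ ℓ', actionRisk K C ν y x ℓ ≤ actionRisk K C ν y x ℓ'

/-! ### The invariant recursive equation -/

/-- The functions `g^(ℓ)(u, t₁, t₂)`; the sign is `-1` for the first action (`ℓ = 0`) and `+1`
for the second one (`ℓ = 1`). -/
noncomputable def gFun (c : ℝ) (ϱ : ℝ → ℝ) (ℓ : Fin 2) (u t₁ t₂ : ℝ) : ℝ :=
  ∫ w in (0 : ℝ)..c,
    2 * w * exp ((-1) ^ ((ℓ : ℕ) + 1) * 2 * u * w - 2 * w ^ 2 * t₁ * t₂ / (t₁ + t₂)) * ϱ w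

/-- Admissible values of `(t₁, t₂)`: positive multiples of `ε` with sum at most one. -/
def OnGrid (ε t₁ t₂ : ℝ) : Prop :=
  (∃ k : ℕ, 1 ≤ k ∧ t₁ = k * ε) ∧ (∃ k : ℕ, 1 ≤ k ∧ t₂ = k * ε) ∧ t₁ + t₂ ≤ 1

/-- The functions `r = r_ε` and `rA ℓ = r_ε^(ℓ)` solve the recursive Bellman-type equation (and
all integrals in it converge). -/
structure IsSolution (ε c : ℝ) (ϱ : ℝ → ℝ) (r : ℝ → ℝ → ℝ → ℝ)
    (rA : Fin 2 → ℝ → ℝ → ℝ → ℝ) : Prop where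
  min_eq : ∀ u t₁ t₂, OnGrid ε t₁ t₂ → r u t₁ t₂ = min (rA 0 u t₁ t₂) (rA 1 u t₁ t₂)
  terminal : ∀ ℓ u t₁ t₂, OnGrid ε t₁ t₂ → t₁ + t₂ = 1 → rA ℓ u t₁ t₂ = 0
  integrable_fst : ∀ u t₁ t₂, OnGrid ε t₁ t₂ → t₁ + t₂ < 1 →
    Integrable fun x => r (u - x) (t₁ + ε) t₂ *
      gaussDensity (ε * t₂ ^ 2 / ((t₁ + t₂) * (t₁ + t₂ + ε))) 0 x
  step_fst : ∀ u t₁ t₂, OnGrid ε t₁ t₂ → t₁ + t₂ < 1 →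
    rA 0 u t₁ t₂ = ε * gFun c ϱ 0 u t₁ t₂ +
      ∫ x, r (u - x) (t₁ + ε) t₂ *
        gaussDensity (ε * t₂ ^ 2 / ((t₁ + t₂) * (t₁ + t₂ + ε))) 0 x
  integrable_snd : ∀ u t₁ t₂, OnGrid ε t₁ t₂ → t₁ + t₂ < 1 →
    Integrable fun x => r (u - x) t₁ (t₂ + ε) *
      gaussDensity (ε * t₁ ^ 2 / ((t₁ + t₂) * (t₁ + t₂ + ε))) 0 x
  step_snd : ∀ u t₁ t₂, OnGrid ε t₁ t₂ → t₁ + t₂ < 1 →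
    rA 1 u t₁ t₂ = ε * gFun c ϱ 1 u t₁ t₂ +
      ∫ x, r (u - x) t₁ (t₂ + ε) *
        gaussDensity (ε * t₁ ^ 2 / ((t₁ + t₂) * (t₁ + t₂ + ε))) 0 x

/-- The value of `rA ℓ` at the rescaled state `u = U / √N`, `t_ℓ = n_ℓ / N` of a history. -/
noncomputable def scaledValue {M k : ℕ} (N : ℕ) (rA : Fin 2 → ℝ → ℝ → ℝ → ℝ)
    (y : Fin k → Fin 2) (x : Fin k → Fin M → ℝ) (ℓ : Fin 2) : ℝ :=
  rA ℓ (statU y x / √N) ((count M y 0 : ℝ) / N) ((count M y 1 : ℝ) / N)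

/-- The strategy applies the actions turn-by-turn to the first two batches and afterwards, up to
the horizon, chooses only actions with the smaller value of `rA ℓ` at the current state (the
choice is arbitrary if the values are equal). -/
def FollowsRecursion {M : ℕ} (N : ℕ) (rA : Fin 2 → ℝ → ℝ → ℝ → ℝ) (σ : Strategy M) : Prop :=
  (∀ (y : Fin 1 → Fin 2) (x : Fin 1 → Fin M → ℝ), σ.prob 1 y x (y 0) = 0) ∧
  ∀ (k : ℕ) (y : Fin k → Fin 2) (x : Fin k → Fin M → ℝ), 2 ≤ k → k * M < N → BothUsed y →
    ∀ ℓ ℓ', scaledValue N rA y x ℓ' < scaledValue N rA y x ℓ → σ.prob k y x ℓ = 0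

/-- The normalized Bayesian risk `4 ε ∫₀^c w ϱ(w) dw + ∫ r(u, ε, ε) f_{ε/2}(u) du`. -/
noncomputable def riskFormula (ε c : ℝ) (ϱ : ℝ → ℝ) (r : ℝ → ℝ → ℝ → ℝ) : ℝ :=
  4 * ε * (∫ w in (0 : ℝ)..c, w * ϱ w) + ∫ u, r u ε ε * gaussDensity (0.5 * ε) 0 u

end Bandit

/-!
The proof works with the flat prior, which is Lebesgue measure in `m` times the law of `w` in
`v = w / √N`, and with unnormalized posterior quantities in `ℝ≥0∞`, so that no integrability
questions arise before the very end.

Let `evidence x` be the Lebesgue integral over `m` of the likelihood of the incomes `x` when both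
actions have mean `m`. Shifting `m` by `v (n₁ - n₂) / n` turns the likelihood at `(m + v, m - v)`
into the likelihood at `v = 0` times `exp (2 v U - 2 v² n₁ n₂ / n)` (`lintegral_likelihood`).
Hence, up to the factor `evidence x`, the posterior depends on the history only through
`(u, t₁, t₂)`. Weighted by `evidence`, the next value of `u` is `u` plus an independent centred
Gaussian variable with the variance of the recursive equation (`lintegral_evidence_state`).
Backward induction then shows that `evidence x * √N * value` bounds the posterior losses of every
strategy from below (`value_le_futureLoss`), and that strategies which minimize at each step attain
it (`futureLoss_eq_value`). This gives the criterion for current optimality.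

The function `value` is also defined, with a degenerate Gaussian step, for states at which only one
action has been used; there `u = 0`. At such a state it is optimal to switch at once
(`lintegral_value_le_value_onlyT`): by symmetry of the law of `w` every batch costs the same before
the switch, and a repetition of the first action may be postponed until after the switch, since
its mean loss stays the same and the variances of the steps of `u` do not depend on the order. This
explains the initial stage.

For the uniform prior on `|m| ≤ a`, the losses after the first batch are compared with those for
the flat prior on the event that the first income `z₀` satisfies `|z₀| ≤ a`, which has total mass
exactly `2 a` for the flat prior. The difference is supported where exactly one of `|m| ≤ a` and
`|z₀| ≤ a` holds. That set has mass at most a constant times the first moment of `|z₀ - m|`, and so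
the difference is bounded uniformly in `a` and in the strategy (`edgeError`). Dividing by `2 a`
yields the limits of the average losses and of their infimum.

A solution of the recursive equation coincides with `value` on the grid, by backward induction
(`IsSolution.eq_value`), and `value` itself is a solution because it is bounded.
-/

namespace Bandit

open scoped ENNReal NNReal

/-! ### Gaussian incomes -/

/-- The law of the `M` incomes of a batch, for an action with mean income `m`. -/
noncomputable abbrev batchLaw (M : ℕ) (m : ℝ) : Measure (Fin M → ℝ) :=
  Measure.pi fun _ : Fin M => gaussianReal m 1

theorem gaussDensity_one (m x : ℝ) : gaussDensity 1 m x = gaussianPDFReal m 1 x := by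
  simp [gaussDensity]

theorem gaussDensity_one_pos (m x : ℝ) : 0 < gaussDensity 1 m x := by
  rw [gaussDensity_one]; exact gaussianPDFReal_pos _ _ _ one_ne_zero

theorem measurable_gaussDensity_one :
    Measurable fun q : ℝ × ℝ => gaussDensity 1 q.1 q.2 := by
  simp only [gaussDensity_one]
  exact measurable_uncurry_gaussianPDFReal.comp
    (measurable_fst.prodMk (measurable_const.prodMk measurable_snd))

/-- The joint density of the incomes of a batch. -/
noncomputable def batchDensity {M : ℕ} (m : ℝ) (z : Fin M → ℝ) : ℝ :=
  ∏ i, gaussDensity 1 m (z i)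

theorem batchDensity_pos {M : ℕ} (m : ℝ) (z : Fin M → ℝ) : 0 < batchDensity m z :=
  Finset.prod_pos fun _ _ => gaussDensity_one_pos _ _

theorem measurable_batchDensity {M : ℕ} :
    Measurable fun q : ℝ × (Fin M → ℝ) => batchDensity q.1 q.2 := by
  have h : ∀ i : Fin M, Measurable fun q : ℝ × (Fin M → ℝ) => gaussDensity 1 q.1 (q.2 i) :=
    fun i => by
      have h' : Measurable fun q : ℝ × (Fin M → ℝ) => (q.1, q.2 i) := by fun_prop
      have h'' := measurable_gaussDensity_one.comp h'
      simpa only [Function.comp_def] using h''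
  exact Finset.measurable_fun_prod _ fun i _ => h i

@[fun_prop]
theorem measurable_batchDensity_comp {α : Type*} [MeasurableSpace α] {M : ℕ} {f : α → ℝ}
    {g : α → Fin M → ℝ} (hf : Measurable f) (hg : Measurable g) :
    Measurable fun a => batchDensity (f a) (g a) := by
  have h := measurable_batchDensity.comp (hf.prodMk hg)
  simpa only [Function.comp_def] using h

theorem batchLaw_eq_withDensity (M : ℕ) (m : ℝ) :
    batchLaw M m = volume.withDensity fun z => ENNReal.ofReal (batchDensity m z) := by
  refine Measure.pi_eq fun s hs => ?_
  rw [withDensity_apply _ (MeasurableSet.univ_pi hs), volume_pi, Measure.restrict_pi_pi,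
    ← ofReal_integral_eq_lintegral_ofReal]
  · simp only [batchDensity]
    rw [integral_fintype_prod_eq_prod (fun _ : Fin M => gaussDensity 1 m),
      ENNReal.ofReal_prod_of_nonneg]
    · refine Finset.prod_congr rfl fun i _ => ?_
      rw [gaussianReal_apply_eq_integral _ one_ne_zero]
      exact congrArg ENNReal.ofReal (integral_congr_ae (ae_of_all _ fun x => gaussDensity_one m x))
    · exact fun i _ => integral_nonneg fun x => (gaussDensity_one_pos _ _).le
  · refine Integrable.fintype_prod fun i => ?_
    exact (show Integrable (gaussDensity 1 m) from
      (integrable_gaussianPDFReal m 1).congr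
        (ae_of_all _ fun x => (gaussDensity_one m x).symm)).restrict
  · exact ae_of_all _ fun z => (batchDensity_pos m z).le

theorem lintegral_batchLaw {M : ℕ} (m : ℝ) (f : (Fin M → ℝ) → ℝ≥0∞) :
    ∫⁻ z, f z ∂batchLaw M m = ∫⁻ z, ENNReal.ofReal (batchDensity m z) * f z := by
  rw [batchLaw_eq_withDensity, lintegral_withDensity_eq_lintegral_mul_non_measurable]
  · rfl
  · exact (measurable_batchDensity.comp measurable_prodMk_left).ennreal_ofReal
  · exact ae_of_all _ fun z => ENNReal.ofReal_lt_top

theorem integral_batchLaw {M : ℕ} (m : ℝ) (f : (Fin M → ℝ) → ℝ) :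
    ∫ z, f z ∂batchLaw M m = ∫ z, batchDensity m z * f z := by
  rw [batchLaw_eq_withDensity, integral_withDensity_eq_integral_toReal_smul]
  · refine integral_congr_ae (ae_of_all _ fun z => ?_)
    beta_reduce
    rw [ENNReal.toReal_ofReal (batchDensity_pos m z).le, smul_eq_mul]
  · exact (measurable_batchDensity.comp measurable_prodMk_left).ennreal_ofReal
  · exact ae_of_all _ fun z => ENNReal.ofReal_lt_top

theorem batchLaw_map_sum (M : ℕ) (m : ℝ) :
    (batchLaw M m).map (fun z => ∑ i, z i) = gaussianReal (M * m) M := by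
  refine Measure.ext_of_charFun ?_
  have := charFun_map_sum_pi_eq_prod (fun _ : Fin M => gaussianReal m 1)
  refine this.trans ?_
  ext t
  simp only [Finset.prod_apply, charFun_gaussianReal, Finset.prod_const, Finset.card_univ,
    Fintype.card_fin, ← Complex.exp_nat_mul]
  congr 1
  push_cast
  ring

theorem integrable_sum_batchLaw (M : ℕ) (m : ℝ) :
    Integrable (fun z => ∑ i, z i) (batchLaw M m) := by
  refine integrable_finsetSum _ fun i _ => ?_
  exact integrable_comp_eval (X := fun _ : Fin M => ℝ) (μ := fun _ => gaussianReal m 1)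
    (f := fun x : ℝ => x) (memLp_one_iff_integrable.1 (memLp_id_gaussianReal (μ := m) (v := 1) 1))

theorem integral_sum_batchLaw (M : ℕ) (m : ℝ) :
    ∫ z, ∑ i, z i ∂batchLaw M m = M * m := by
  have h : Measurable fun z : Fin M → ℝ => ∑ i, z i := by fun_prop
  have := integral_map (μ := batchLaw M m) h.aemeasurable
    (f := fun x : ℝ => x) (by fun_prop)
  rw [batchLaw_map_sum, integral_id_gaussianReal] at this
  exact this.symm

/-- A Gaussian mixture of Gaussian laws with affinely varying means is Gaussian. -/
theorem lintegral_gaussianReal_mixture (a b : ℝ) {v v' w : ℝ≥0}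
    (hw : (w : ℝ) = b ^ 2 * v + v') {h : ℝ → ℝ≥0∞} (hh : Measurable h) :
    ∫⁻ m, ∫⁻ x, h x ∂gaussianReal (b * m) v' ∂gaussianReal a v =
      ∫⁻ x, h x ∂gaussianReal (b * a) w := by
  have hw' : w = NNReal.mk (b ^ 2) (sq_nonneg b) * v + v' := NNReal.eq (by simpa using! hw)
  have h1 : ∀ m, ∫⁻ x, h x ∂gaussianReal (b * m) v' = ∫⁻ x, h (b * m + x) ∂gaussianReal 0 v' := by
    intro m
    have := gaussianReal_map_const_add (μ := 0) (v := v') (b * m)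
    rw [zero_add] at this
    rw [← this, lintegral_map hh (by fun_prop)]
  have h2 := gaussianReal_map_const_mul (μ := a) (v := v) b
  have h3 := gaussianReal_conv_gaussianReal (m₁ := b * a) (m₂ := 0)
    (v₁ := NNReal.mk (b ^ 2) (sq_nonneg b) * v) (v₂ := v')
  rw [add_zero] at h3
  simp only [h1]
  rw [hw', ← h3, Measure.lintegral_conv hh, ← h2, lintegral_map _ (by fun_prop)]
  exact Measurable.lintegral_prod_right' (f := fun p : ℝ × ℝ => h (p.1 + p.2)) (by fun_prop)

/-- Gaussian measures with mean zero convolve: the variances add. -/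
theorem lintegral_gaussianReal_add (v v' : ℝ≥0) {h : ℝ → ℝ≥0∞} (hh : Measurable h) :
    ∫⁻ m, ∫⁻ x, h (m + x) ∂gaussianReal 0 v' ∂gaussianReal 0 v =
      ∫⁻ x, h x ∂gaussianReal 0 (v + v') := by
  have h3 := gaussianReal_conv_gaussianReal (m₁ := 0) (m₂ := 0) (v₁ := v) (v₂ := v')
  rw [add_zero] at h3
  rw [← h3, Measure.lintegral_conv hh]

theorem lintegral_exp_gaussianReal (v : ℝ≥0) (t : ℝ) :
    ∫⁻ x, ENNReal.ofReal (exp (t * x)) ∂gaussianReal 0 v = ENNReal.ofReal (exp (v * t ^ 2 / 2)) := by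
  rw [← ofReal_integral_eq_lintegral_ofReal (integrable_exp_mul_gaussianReal t)
    (ae_of_all _ fun x => (exp_pos _).le)]
  have := congrFun (mgf_fun_id_gaussianReal (μ := 0) (v := v)) t
  rw [mgf] at this
  rw [this, zero_mul, zero_add]

/-- As a function of the common mean, the likelihood of a nonempty Gaussian sample is a multiple of
the Gaussian density around the sample mean. -/
theorem exists_prod_gaussDensity_eq {ι : Type*} [Fintype ι] [Nonempty ι] (x : ι → ℝ) :
    ∃ C : ℝ, 0 < C ∧ ∀ m, ∏ i, gaussDensity 1 m (x i) =
      C * gaussianPDFReal ((∑ i, x i) / Fintype.card ι) (Fintype.card ι : ℝ≥0)⁻¹ m := by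
  set n : ℝ := (Fintype.card ι : ℝ) with hn
  have hn0 : 0 < n := by simp [hn, Fintype.card_pos]
  have hnn : ((Fintype.card ι : ℝ≥0) : ℝ) = n := by simp [hn]
  set a := (∑ i, x i) / n with ha
  refine ⟨(√(2 * π))⁻¹ ^ Fintype.card ι * exp (-(∑ i, x i ^ 2 - n * a ^ 2) / 2) *
    √(2 * π * n⁻¹), by positivity, fun m => ?_⟩
  have hne : √(2 * π * n⁻¹) ≠ 0 := by positivity
  have hs : ∑ i, x i = n * a := by rw [ha]; field_simp
  have hsq : ∑ i, (x i - m) ^ 2 = ∑ i, x i ^ 2 - 2 * m * (n * a) + n * m ^ 2 := by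
    rw [← hs, Finset.mul_sum]
    simp only [sub_sq, Finset.sum_add_distrib, Finset.sum_sub_distrib, Finset.sum_const,
      Finset.card_univ, nsmul_eq_mul, ← hn]
    congr 2
    exact Finset.sum_congr rfl fun i _ => by ring
  simp only [gaussDensity_one, gaussianPDFReal, NNReal.coe_one, mul_one, Finset.prod_mul_distrib,
    Finset.prod_const, Finset.card_univ, NNReal.coe_inv, hnn, ← exp_sum]
  rw [← Finset.sum_div, Finset.sum_neg_distrib, hsq]
  rw [show ∀ p q r s t : ℝ, p * q * r * (s * t) = p * (q * t) * (r * s) by intros; ring,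
    mul_inv_cancel₀ hne, mul_one, ← exp_add]
  congr 2
  field_simp
  ring

section

/-! ### Strategies and their expected losses -/

variable {M : ℕ}

theorem measurable_snoc {k : ℕ} :
    Measurable fun q : (Fin k → Fin M → ℝ) × (Fin M → ℝ) =>
      (Fin.snoc (α := fun _ => Fin M → ℝ) q.1 q.2 : Fin (k + 1) → Fin M → ℝ) := by
  refine measurable_pi_iff.2 fun i => ?_
  refine Fin.lastCases ?_ (fun i => ?_) i
  · simpa only [Fin.snoc_last] using measurable_snd
  · simp only [Fin.snoc_castSucc]
    fun_prop

theorem measurable_expectedIncome (σ : Strategy M) (j k : ℕ) (y : Fin k → Fin 2) :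
    Measurable fun q : (Fin 2 → ℝ) × (Fin k → Fin M → ℝ) =>
      expectedIncome σ q.1 j k y q.2 := by
  induction j generalizing k with
  | zero => exact measurable_const
  | succ j ih =>
    simp only [expectedIncome]
    refine Finset.measurable_fun_sum _ fun ℓ _ => ?_
    refine ((σ.prob_measurable k y ℓ).comp measurable_snd).mul ?_
    have h1 : Measurable fun r : ((Fin 2 → ℝ) × (Fin k → Fin M → ℝ)) × (Fin M → ℝ) =>
        (r.1.1, (Fin.snoc (α := fun _ => Fin M → ℝ) r.1.2 r.2 : Fin (k + 1) → Fin M → ℝ)) :=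
      (measurable_fst.comp measurable_fst).prodMk
        (measurable_snoc.comp ((measurable_snd.comp measurable_fst).prodMk measurable_snd))
    have h2 := (ih (k + 1) (Fin.snoc (α := fun _ => Fin 2) y ℓ)).comp h1
    have h3 : Measurable fun r : ((Fin 2 → ℝ) × (Fin k → Fin M → ℝ)) × (Fin M → ℝ) =>
        (r.1.1 ℓ, r.2) := by fun_prop
    have h4 := measurable_batchDensity.comp h3
    have h5 : Measurable fun r : ((Fin 2 → ℝ) × (Fin k → Fin M → ℝ)) × (Fin M → ℝ) =>
        ∑ i, r.2 i := by fun_prop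
    have h6 := (h4.mul (h5.add h2)).stronglyMeasurable.integral_prod_right'
      (ν := (volume : Measure (Fin M → ℝ)))
    convert h6.measurable using 2 with q
    exact integral_batchLaw (q.1 ℓ) _

theorem measurable_lossToGo (σ : Strategy M) (j k : ℕ) (y : Fin k → Fin 2) :
    Measurable fun q : (Fin 2 → ℝ) × (Fin k → Fin M → ℝ) => lossToGo σ q.1 j k y q.2 := by
  have h : Measurable fun q : (Fin 2 → ℝ) × (Fin k → Fin M → ℝ) =>
      (j : ℝ) * M * max (q.1 0) (q.1 1) := by fun_prop
  exact h.sub (measurable_expectedIncome σ j k y)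

theorem measurable_lossToGo_snoc (σ : Strategy M) (θ : Fin 2 → ℝ) (j k : ℕ) (y : Fin k → Fin 2)
    (x : Fin k → Fin M → ℝ) (ℓ : Fin 2) :
    Measurable fun z : Fin M → ℝ =>
      lossToGo σ θ j (k + 1) (Fin.snoc (α := fun _ => Fin 2) y ℓ)
        (Fin.snoc (α := fun _ => Fin M → ℝ) x z) :=
  (measurable_lossToGo σ j (k + 1) _).comp
    (measurable_const.prodMk (measurable_snoc.comp measurable_prodMk_left))

/-- Expected loss of a batch to which the action `ℓ` is applied. -/
noncomputable def batchLoss (M : ℕ) (θ : Fin 2 → ℝ) (ℓ : Fin 2) : ℝ :=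
  M * (max (θ 0) (θ 1) - θ ℓ)

theorem batchLoss_nonneg (θ : Fin 2 → ℝ) (ℓ : Fin 2) : 0 ≤ batchLoss M θ ℓ := by
  refine mul_nonneg (Nat.cast_nonneg _) (sub_nonneg.2 ?_)
  fin_cases ℓ
  exacts [le_max_left _ _, le_max_right _ _]

theorem batchLoss_le (θ : Fin 2 → ℝ) (ℓ : Fin 2) : batchLoss M θ ℓ ≤ M * |θ 0 - θ 1| := by
  refine mul_le_mul_of_nonneg_left ?_ (Nat.cast_nonneg _)
  rw [sub_le_iff_le_add]
  fin_cases ℓ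
  all_goals
    refine max_le ?_ ?_
    all_goals
      have h1 := le_abs_self (θ 0 - θ 1)
      have h2 := neg_abs_le (θ 0 - θ 1)
      simp only [Fin.zero_eta, Fin.mk_one]
      linarith [abs_nonneg (θ 0 - θ 1)]

theorem measurable_batchLoss (ℓ : Fin 2) : Measurable fun θ : Fin 2 → ℝ => batchLoss M θ ℓ := by
  unfold batchLoss; fun_prop

theorem lossToGo_zero (σ : Strategy M) (θ : Fin 2 → ℝ) (k : ℕ) (y : Fin k → Fin 2)
    (x : Fin k → Fin M → ℝ) : lossToGo σ θ 0 k y x = 0 := by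
  simp [lossToGo, expectedIncome]

/-- One step of the recursion for the expected loss, provided that the later losses are
integrable. -/
theorem lossToGo_succ_of_integrable (σ : Strategy M) (θ : Fin 2 → ℝ) (j k : ℕ) (y : Fin k → Fin 2)
    (x : Fin k → Fin M → ℝ)
    (h : ∀ ℓ, Integrable (fun z => lossToGo σ θ j (k + 1) (Fin.snoc (α := fun _ => Fin 2) y ℓ)
      (Fin.snoc (α := fun _ => Fin M → ℝ) x z)) (batchLaw M (θ ℓ))) :
    lossToGo σ θ (j + 1) k y x = ∑ ℓ, σ.prob k y x ℓ * (batchLoss M θ ℓ +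
      ∫ z, lossToGo σ θ j (k + 1) (Fin.snoc (α := fun _ => Fin 2) y ℓ)
        (Fin.snoc (α := fun _ => Fin M → ℝ) x z) ∂batchLaw M (θ ℓ)) := by
  have key : ∀ ℓ, (∫ z : Fin M → ℝ, ((∑ i, z i) +
      expectedIncome σ θ j (k + 1) (Fin.snoc (α := fun _ => Fin 2) y ℓ)
        (Fin.snoc (α := fun _ => Fin M → ℝ) x z)) ∂batchLaw M (θ ℓ)) =
      (j + 1 : ℕ) * M * max (θ 0) (θ 1) - (batchLoss M θ ℓ +
      ∫ z, lossToGo σ θ j (k + 1) (Fin.snoc (α := fun _ => Fin 2) y ℓ)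
        (Fin.snoc (α := fun _ => Fin M → ℝ) x z) ∂batchLaw M (θ ℓ)) := by
    intro ℓ
    have e : ∀ z : Fin M → ℝ, (∑ i, z i) +
        expectedIncome σ θ j (k + 1) (Fin.snoc (α := fun _ => Fin 2) y ℓ)
          (Fin.snoc (α := fun _ => Fin M → ℝ) x z) =
        (∑ i, z i) + (j : ℝ) * M * max (θ 0) (θ 1) -
          lossToGo σ θ j (k + 1) (Fin.snoc (α := fun _ => Fin 2) y ℓ)
            (Fin.snoc (α := fun _ => Fin M → ℝ) x z) := fun z => by
      simp only [lossToGo]; ring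
    have i1 := integrable_sum_batchLaw M (θ ℓ)
    have i2 : Integrable (fun z : Fin M → ℝ => (∑ i, z i) + (j : ℝ) * M * max (θ 0) (θ 1))
        (batchLaw M (θ ℓ)) := i1.add (integrable_const _)
    simp only [e]
    rw [integral_sub i2 (h ℓ), integral_add i1 (integrable_const _),
      integral_sum_batchLaw, integral_const, probReal_univ, one_smul, batchLoss]
    push_cast
    ring
  have hp := σ.prob_sum k y x
  rw [lossToGo, expectedIncome]
  simp only [key]
  simp only [mul_sub, Finset.sum_sub_distrib, ← Finset.sum_mul, hp, one_mul]
  ring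

theorem integrable_batchLaw_of_bounded {f : (Fin M → ℝ) → ℝ} (m : ℝ) {B : ℝ}
    (hf : Measurable f) (h : ∀ z, 0 ≤ f z ∧ f z ≤ B) : Integrable f (batchLaw M m) :=
  Integrable.of_bound hf.aestronglyMeasurable B
    (ae_of_all _ fun z => by rw [Real.norm_of_nonneg (h z).1]; exact (h z).2)

/-- The bounds are proved together with the recursion, which needs the integrability that they
imply for the later losses. -/
theorem lossToGo_mem (σ : Strategy M) (θ : Fin 2 → ℝ) (j k : ℕ) (y : Fin k → Fin 2)
    (x : Fin k → Fin M → ℝ) :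
    0 ≤ lossToGo σ θ j k y x ∧ lossToGo σ θ j k y x ≤ j * (M * |θ 0 - θ 1|) := by
  induction j generalizing k with
  | zero => simp [lossToGo_zero]
  | succ j ih =>
    have hi : ∀ ℓ, Integrable (fun z => lossToGo σ θ j (k + 1)
        (Fin.snoc (α := fun _ => Fin 2) y ℓ) (Fin.snoc (α := fun _ => Fin M → ℝ) x z))
        (batchLaw M (θ ℓ)) := fun ℓ =>
      integrable_batchLaw_of_bounded _ (measurable_lossToGo_snoc σ θ j k y x ℓ)
        fun z => ih (k + 1) _ _
    rw [lossToGo_succ_of_integrable σ θ j k y x hi]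
    constructor
    · exact Finset.sum_nonneg fun ℓ _ => mul_nonneg (σ.prob_nonneg k y x ℓ)
        (add_nonneg (batchLoss_nonneg θ ℓ) (integral_nonneg fun z => (ih (k + 1) _ _).1))
    · calc _ ≤ ∑ ℓ, σ.prob k y x ℓ * (M * |θ 0 - θ 1| + j * (M * |θ 0 - θ 1|)) := by
            refine Finset.sum_le_sum fun ℓ _ => mul_le_mul_of_nonneg_left
              (add_le_add (batchLoss_le θ ℓ) ?_) (σ.prob_nonneg k y x ℓ)
            calc _ ≤ ∫ _, (j * (M * |θ 0 - θ 1|) : ℝ) ∂batchLaw M (θ ℓ) :=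
                  integral_mono (hi ℓ) (integrable_const _) fun z => (ih (k + 1) _ _).2
              _ = _ := by simp
        _ = _ := by
            rw [← Finset.sum_mul, σ.prob_sum]; push_cast; ring

/-- Extended nonnegative version of the expected losses over the next `j` batches. -/
noncomputable def lossE (σ : Strategy M) (θ : Fin 2 → ℝ) (j k : ℕ) (y : Fin k → Fin 2)
    (x : Fin k → Fin M → ℝ) : ℝ≥0∞ :=
  ENNReal.ofReal (lossToGo σ θ j k y x)

theorem lossE_zero (σ : Strategy M) (θ : Fin 2 → ℝ) (k : ℕ) (y : Fin k → Fin 2)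
    (x : Fin k → Fin M → ℝ) : lossE σ θ 0 k y x = 0 := by
  simp [lossE, lossToGo_zero]

theorem lossE_le (σ : Strategy M) (θ : Fin 2 → ℝ) (j k : ℕ) (y : Fin k → Fin 2)
    (x : Fin k → Fin M → ℝ) :
    lossE σ θ j k y x ≤ ENNReal.ofReal (j * (M * |θ 0 - θ 1|)) :=
  ENNReal.ofReal_le_ofReal (lossToGo_mem σ θ j k y x).2

theorem measurable_lossE (σ : Strategy M) (j k : ℕ) (y : Fin k → Fin 2) :
    Measurable fun q : (Fin 2 → ℝ) × (Fin k → Fin M → ℝ) => lossE σ q.1 j k y q.2 :=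
  (measurable_lossToGo σ j k y).ennreal_ofReal

/-- The recursion for the losses with extended nonnegative values, which has no integrability
assumption. -/
theorem lossE_succ (σ : Strategy M) (θ : Fin 2 → ℝ) (j k : ℕ) (y : Fin k → Fin 2)
    (x : Fin k → Fin M → ℝ) :
    lossE σ θ (j + 1) k y x = ∑ ℓ, ENNReal.ofReal (σ.prob k y x ℓ) *
      (ENNReal.ofReal (batchLoss M θ ℓ) +
        ∫⁻ z, ENNReal.ofReal (batchDensity (θ ℓ) z) *
          lossE σ θ j (k + 1) (Fin.snoc (α := fun _ => Fin 2) y ℓ)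
            (Fin.snoc (α := fun _ => Fin M → ℝ) x z)) := by
  have hi : ∀ ℓ, Integrable (fun z => lossToGo σ θ j (k + 1)
      (Fin.snoc (α := fun _ => Fin 2) y ℓ) (Fin.snoc (α := fun _ => Fin M → ℝ) x z))
      (batchLaw M (θ ℓ)) := fun ℓ =>
    integrable_batchLaw_of_bounded _ (measurable_lossToGo_snoc σ θ j k y x ℓ)
      fun z => lossToGo_mem σ θ j (k + 1) _ _
  have hn : ∀ ℓ, 0 ≤ ∫ z, lossToGo σ θ j (k + 1) (Fin.snoc (α := fun _ => Fin 2) y ℓ)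
        (Fin.snoc (α := fun _ => Fin M → ℝ) x z) ∂batchLaw M (θ ℓ) := fun ℓ =>
    integral_nonneg fun z => (lossToGo_mem σ θ j (k + 1) _ _).1
  rw [lossE, lossToGo_succ_of_integrable σ θ j k y x hi, ENNReal.ofReal_sum_of_nonneg
    fun ℓ _ => mul_nonneg (σ.prob_nonneg k y x ℓ) (add_nonneg (batchLoss_nonneg θ ℓ) (hn ℓ))]
  refine Finset.sum_congr rfl fun ℓ _ => ?_
  rw [ENNReal.ofReal_mul (σ.prob_nonneg k y x ℓ),
    ENNReal.ofReal_add (batchLoss_nonneg θ ℓ) (hn ℓ),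
    ofReal_integral_eq_lintegral_ofReal (hi ℓ)
      (ae_of_all _ fun z => (lossToGo_mem σ θ j (k + 1) _ _).1), lintegral_batchLaw]
  rfl

end

section

variable {M k : ℕ}

/-! ### Histories -/

theorem count_snoc (y : Fin k → Fin 2) (ℓ ℓ' : Fin 2) :
    count M (Fin.snoc (α := fun _ => Fin 2) y ℓ : Fin (k + 1) → Fin 2) ℓ' =
      count M y ℓ' + if ℓ' = ℓ then M else 0 := by
  simp only [count, Finset.card_filter, Fin.sum_univ_castSucc, Fin.snoc_castSucc, Fin.snoc_last,
    mul_add, eq_comm (a := ℓ)]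
  split_ifs <;> simp

theorem income_snoc (y : Fin k → Fin 2) (x : Fin k → Fin M → ℝ) (ℓ ℓ' : Fin 2) (z : Fin M → ℝ) :
    income (Fin.snoc (α := fun _ => Fin 2) y ℓ : Fin (k + 1) → Fin 2)
      (Fin.snoc (α := fun _ => Fin M → ℝ) x z) ℓ' =
      income y x ℓ' + if ℓ' = ℓ then ∑ j, z j else 0 := by
  simp only [income, Finset.sum_filter, Fin.sum_univ_castSucc, Fin.snoc_castSucc, Fin.snoc_last,
    eq_comm (a := ℓ)]

theorem count_add_count (M : ℕ) (y : Fin k → Fin 2) :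
    count M y 0 + count M y 1 = M * k := by
  rw [count, count, ← mul_add]
  congr 1
  have := Finset.sum_card_fiberwise_eq_card_filter (Finset.univ : Finset (Fin k)) Finset.univ y
  simpa [Fin.sum_univ_two] using this

theorem count_add_count_pos (hM : 0 < M) (hk : 0 < k) (y : Fin k → Fin 2) :
    (0 : ℝ) < (count M y 0 : ℝ) + count M y 1 := by
  have : (count M y 0 : ℝ) + count M y 1 = (M * k : ℕ) := by
    rw [← count_add_count M y]; push_cast; rfl
  rw [this]
  exact_mod_cast Nat.mul_pos hM hk

theorem income_add_income (y : Fin k → Fin 2) (x : Fin k → Fin M → ℝ) :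
    income y x 0 + income y x 1 = ∑ i, ∑ j, x i j := by
  have := Finset.sum_fiberwise (Finset.univ : Finset (Fin k)) y fun i => ∑ j, x i j
  simpa [Fin.sum_univ_two, income] using this

theorem likelihood_snoc (y : Fin k → Fin 2) (x : Fin k → Fin M → ℝ) (ℓ : Fin 2) (z : Fin M → ℝ)
    (θ : Fin 2 → ℝ) :
    likelihood (Fin.snoc (α := fun _ => Fin 2) y ℓ : Fin (k + 1) → Fin 2)
      (Fin.snoc (α := fun _ => Fin M → ℝ) x z) θ =
      likelihood y x θ * batchDensity (θ ℓ) z := by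
  simp only [likelihood, Fin.prod_univ_castSucc, Fin.snoc_castSucc, Fin.snoc_last, batchDensity]

theorem likelihood_pos (y : Fin k → Fin 2) (x : Fin k → Fin M → ℝ) (θ : Fin 2 → ℝ) :
    0 < likelihood y x θ :=
  Finset.prod_pos fun _ _ => Finset.prod_pos fun _ _ => gaussDensity_one_pos _ _

theorem measurable_likelihood (y : Fin k → Fin 2) :
    Measurable fun q : (Fin 2 → ℝ) × (Fin k → Fin M → ℝ) => likelihood y q.2 q.1 := by
  have h : ∀ i, Measurable fun q : (Fin 2 → ℝ) × (Fin k → Fin M → ℝ) =>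
      batchDensity (q.1 (y i)) (q.2 i) := fun i => by fun_prop
  exact Finset.measurable_fun_prod _ fun i _ => h i

/-! ### Integrating out the common mean -/

/-- The total mass, with respect to Lebesgue measure for the common mean `m`, of the likelihood of
the incomes `x` when both actions have mean `m`. -/
noncomputable def evidence (x : Fin k → Fin M → ℝ) : ℝ≥0∞ :=
  ∫⁻ m, ENNReal.ofReal (∏ i, batchDensity m (x i))

theorem exists_likelihood_eq (hM : 0 < M) (hk : 0 < k) (x : Fin k → Fin M → ℝ) :
    ∃ C : ℝ, 0 < C ∧ evidence x = ENNReal.ofReal C ∧ ∀ m, ∏ i, batchDensity m (x i) =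
      C * gaussianPDFReal ((∑ i, ∑ j, x i j) / (M * k)) (M * k : ℝ≥0)⁻¹ m := by
  have : NeZero M := ⟨hM.ne'⟩
  have : NeZero k := ⟨hk.ne'⟩
  obtain ⟨C, hC, h⟩ := exists_prod_gaussDensity_eq fun q : Fin k × Fin M => x q.1 q.2
  have h' : ∀ m, ∏ i, batchDensity m (x i) =
      C * gaussianPDFReal ((∑ i, ∑ j, x i j) / (M * k)) (M * k : ℝ≥0)⁻¹ m := by
    intro m
    have := h m
    rw [Fintype.prod_prod_type, Fintype.sum_prod_type] at this
    simp only [Fintype.card_prod, Fintype.card_fin, Nat.cast_mul] at this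
    rw [mul_comm (M : ℝ), mul_comm (M : ℝ≥0)]
    exact this
  refine ⟨C, hC, ?_, h'⟩
  have hv : (M * k : ℝ≥0)⁻¹ ≠ 0 := by
    have : (M : ℝ≥0) ≠ 0 := by exact_mod_cast hM.ne'
    have : (k : ℝ≥0) ≠ 0 := by exact_mod_cast hk.ne'
    positivity
  simp only [evidence, h', ENNReal.ofReal_mul hC.le]
  rw [lintegral_const_mul _ (measurable_gaussianPDFReal _ _).ennreal_ofReal,
    lintegral_gaussianPDFReal_eq_one _ hv, mul_one]

theorem evidence_ne_top (hM : 0 < M) (hk : 0 < k) (x : Fin k → Fin M → ℝ) : evidence x ≠ ∞ := by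
  obtain ⟨C, -, h, -⟩ := exists_likelihood_eq hM hk x
  rw [h]; exact ENNReal.ofReal_ne_top

theorem evidence_ne_zero (hM : 0 < M) (hk : 0 < k) (x : Fin k → Fin M → ℝ) : evidence x ≠ 0 := by
  obtain ⟨C, hC, h, -⟩ := exists_likelihood_eq hM hk x
  rw [h]; exact (ENNReal.ofReal_pos.2 hC).ne'

/-- For two equal means and the flat prior, the posterior law of the mean is Gaussian. -/
theorem lintegral_likelihood_mul (hM : 0 < M) (hk : 0 < k) (x : Fin k → Fin M → ℝ)
    (h : ℝ → ℝ≥0∞) :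
    ∫⁻ m, ENNReal.ofReal (∏ i, batchDensity m (x i)) * h m =
      evidence x * ∫⁻ m, h m ∂gaussianReal ((∑ i, ∑ j, x i j) / (M * k)) (M * k : ℝ≥0)⁻¹ := by
  obtain ⟨C, hC, he, hl⟩ := exists_likelihood_eq hM hk x
  have hv : (M * k : ℝ≥0)⁻¹ ≠ 0 := by
    have : (M : ℝ≥0) ≠ 0 := by exact_mod_cast hM.ne'
    have : (k : ℝ≥0) ≠ 0 := by exact_mod_cast hk.ne'
    positivity
  rw [he, gaussianReal_of_var_ne_zero _ hv, lintegral_withDensity_eq_lintegral_mul_non_measurable _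
    (measurable_gaussianPDF _ _) (ae_of_all _ fun _ => gaussianPDF_lt_top),
    ← lintegral_const_mul' _ _ ENNReal.ofReal_ne_top]
  refine lintegral_congr fun m => ?_
  rw [hl, ENNReal.ofReal_mul hC.le, mul_assoc]
  rfl

theorem lintegral_batchLaw_sum (M : ℕ) (m : ℝ) {h : ℝ → ℝ≥0∞} (hh : Measurable h) :
    ∫⁻ z, h (∑ i, z i) ∂batchLaw M m = ∫⁻ s, h s ∂gaussianReal (M * m) M := by
  rw [← batchLaw_map_sum, lintegral_map hh (by fun_prop)]

/-- For two equal means and the flat prior, the predictive law of the total income of the next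
batch is Gaussian. -/
theorem lintegral_evidence_snoc (hM : 0 < M) (hk : 0 < k) (x : Fin k → Fin M → ℝ)
    {h : ℝ → ℝ≥0∞} (hh : Measurable h) {w : ℝ≥0} (hw : (w : ℝ) = M / k + M) :
    ∫⁻ z : Fin M → ℝ, evidence (Fin.snoc (α := fun _ => Fin M → ℝ) x z) * h (∑ i, z i) =
      evidence x * ∫⁻ s, h s ∂gaussianReal (M * ((∑ i, ∑ j, x i j) / (M * k))) w := by
  have hM' : (M : ℝ) ≠ 0 := by exact_mod_cast hM.ne'
  have hk' : (k : ℝ) ≠ 0 := by exact_mod_cast hk.ne'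
  have e : ∀ z : Fin M → ℝ, evidence (Fin.snoc (α := fun _ => Fin M → ℝ) x z) * h (∑ i, z i) =
      ∫⁻ m, ENNReal.ofReal (∏ i, batchDensity m (x i)) *
        (ENNReal.ofReal (batchDensity m z) * h (∑ i, z i)) := by
    intro z
    rw [evidence, ← lintegral_mul_const'']
    · refine lintegral_congr fun m => ?_
      simp only [Fin.prod_univ_castSucc, Fin.snoc_castSucc, Fin.snoc_last]
      rw [ENNReal.ofReal_mul (Finset.prod_nonneg fun i _ => (batchDensity_pos _ _).le), mul_assoc]
    · refine Measurable.aemeasurable (Measurable.ennreal_ofReal ?_)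
      fun_prop
  have m1 : Measurable fun q : (Fin M → ℝ) × ℝ => ENNReal.ofReal (∏ i, batchDensity q.2 (x i)) := by
    fun_prop
  have m2 : Measurable fun q : (Fin M → ℝ) × ℝ => ENNReal.ofReal (batchDensity q.2 q.1) := by
    fun_prop
  have m3 : Measurable fun q : (Fin M → ℝ) × ℝ => h (∑ i, q.1 i) := hh.comp (by fun_prop)
  simp only [e]
  rw [lintegral_lintegral_swap (m1.mul (m2.mul m3)).aemeasurable]
  have e2 : ∀ m, ∫⁻ z : Fin M → ℝ, ENNReal.ofReal (∏ i, batchDensity m (x i)) *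
        (ENNReal.ofReal (batchDensity m z) * h (∑ i, z i)) =
      ENNReal.ofReal (∏ i, batchDensity m (x i)) * ∫⁻ s, h s ∂gaussianReal (M * m) M := by
    intro m
    rw [lintegral_const_mul' _ _ ENNReal.ofReal_ne_top, ← lintegral_batchLaw_sum _ _ hh,
      lintegral_batchLaw]
  simp only [e2]
  rw [lintegral_likelihood_mul hM hk, lintegral_gaussianReal_mixture _ _ _ hh]
  rw [hw]
  push_cast
  field_simp

theorem gaussDensity_one_shift (m δ x : ℝ) :
    gaussDensity 1 (m + δ) x = gaussDensity 1 m x * exp (δ * (x - m) - δ ^ 2 / 2) := by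
  simp only [gaussDensity_one, gaussianPDFReal, mul_assoc, ← exp_add]
  congr 3
  simp only [NNReal.coe_one]
  ring

/-- Shifting the mean of each action by `δ` multiplies the likelihood by an exponential which
depends on the history through the counts and the total incomes only. -/
theorem likelihood_shift (y : Fin k → Fin 2) (x : Fin k → Fin M → ℝ) (m : ℝ) (δ : Fin 2 → ℝ) :
    likelihood y x (fun ℓ => m + δ ℓ) = (∏ i, batchDensity m (x i)) *
      exp (∑ ℓ, (δ ℓ * (income y x ℓ - count M y ℓ * m) - count M y ℓ * δ ℓ ^ 2 / 2)) := by
  simp only [likelihood, batchDensity, gaussDensity_one_shift, Finset.prod_mul_distrib, ← exp_sum]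
  congr 2
  rw [← Finset.sum_fiberwise Finset.univ y]
  refine Finset.sum_congr rfl fun ℓ _ => ?_
  have e : ∀ i ∈ Finset.univ.filter (fun i => y i = ℓ),
      ∑ j, (δ (y i) * (x i j - m) - δ (y i) ^ 2 / 2) =
        δ ℓ * ∑ j, x i j - M * (δ ℓ * m + δ ℓ ^ 2 / 2) := by
    intro i hi
    rw [(Finset.mem_filter.1 hi).2]
    simp only [mul_sub, Finset.sum_sub_distrib, ← Finset.mul_sum, Finset.sum_const,
      Finset.card_univ, Fintype.card_fin, nsmul_eq_mul]
    ring
  rw [Finset.sum_congr rfl e, Finset.sum_sub_distrib, ← Finset.mul_sum, Finset.sum_const,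
    nsmul_eq_mul, income, count]
  push_cast
  ring

/-- Integrating out `m` with respect to the flat prior leaves a function of `v` which depends on the
history, up to the factor `evidence x`, through the counts and `U` only. The shift of `m` by
`v (n₁ - n₂) / n` removes the mixed terms from the exponent. -/
theorem lintegral_likelihood (y : Fin k → Fin 2) (x : Fin k → Fin M → ℝ)
    (hn : (0 : ℝ) < (count M y 0 : ℝ) + count M y 1) (v : ℝ) :
    ∫⁻ m, ENNReal.ofReal (likelihood y x (param (m, v))) = evidence x * ENNReal.ofReal
      (exp (2 * v * statU y x -
        2 * v ^ 2 * (count M y 0 * count M y 1 / ((count M y 0 : ℝ) + count M y 1)))) := by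
  set n₀ : ℝ := (count M y 0 : ℝ)
  set n₁ : ℝ := (count M y 1 : ℝ)
  rw [← lintegral_sub_right_eq_self _ (v * (n₀ - n₁) / (n₀ + n₁)), evidence,
    ← lintegral_mul_const' _ _ ENNReal.ofReal_ne_top]
  refine lintegral_congr fun m => ?_
  have hp : param (m - v * (n₀ - n₁) / (n₀ + n₁), v) = fun ℓ =>
      m + ![2 * v * n₁ / (n₀ + n₁), -(2 * v * n₀ / (n₀ + n₁))] ℓ := by
    ext ℓ
    fin_cases ℓ
    all_goals
      simp [param]
      field_simp
      ring
  rw [hp, likelihood_shift, ENNReal.ofReal_mul (Finset.prod_nonneg fun i _ =>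
    (batchDensity_pos _ _).le)]
  congr 3
  rw [Fin.sum_univ_two, statU]
  simp only [Matrix.cons_val_zero, Matrix.cons_val_one]
  change _ * (_ - n₀ * m) - n₀ * _ ^ 2 / 2 + (_ * (_ - n₁ * m) - n₁ * _ ^ 2 / 2) =
    2 * v * ((_ * n₁ - _ * n₀) / (n₀ + n₁)) - _
  field_simp
  ring

/-! ### The rescaled state of a history -/

/-- The rescaled statistic `u = U / √N` of a history. -/
noncomputable def stateU (N : ℕ) (y : Fin k → Fin 2) (x : Fin k → Fin M → ℝ) : ℝ :=
  statU y x / √N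

/-- The rescaled counts `t_ℓ = n_ℓ / N` of a history. -/
noncomputable def stateT (M N : ℕ) (y : Fin k → Fin 2) (ℓ : Fin 2) : ℝ :=
  (count M y ℓ : ℝ) / N

/-- The counts `t` after the action `ℓ` has been applied to one more batch. -/
def stepT (ε : ℝ) (t : Fin 2 → ℝ) (ℓ : Fin 2) : Fin 2 → ℝ :=
  fun i => t i + if i = ℓ then ε else 0

/-- Variance of the change of `u` if the action `ℓ` is applied to one more batch; it involves the
count of the other action `1 - ℓ`. -/
noncomputable def stepVar (ε : ℝ) (t : Fin 2 → ℝ) (ℓ : Fin 2) : ℝ :=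
  ε * t (1 - ℓ) ^ 2 / ((t 0 + t 1) * (t 0 + t 1 + ε))

theorem stateT_snoc (N : ℕ) (y : Fin k → Fin 2) (ℓ : Fin 2) :
    stateT M N (Fin.snoc (α := fun _ => Fin 2) y ℓ : Fin (k + 1) → Fin 2) =
      stepT ((M : ℝ) / N) (stateT M N y) ℓ := by
  ext i
  simp only [stateT, stepT, count_snoc]
  split_ifs <;> simp [add_div]

theorem stateT_add (N : ℕ) (y : Fin k → Fin 2) :
    stateT M N y 0 + stateT M N y 1 = k * ((M : ℝ) / N) := by
  have : (count M y 0 : ℝ) + count M y 1 = (M * k : ℕ) := by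
    rw [← count_add_count M y]; push_cast; rfl
  rw [stateT, stateT, ← add_div, this]
  push_cast
  ring

theorem stateT_nonneg (N : ℕ) (y : Fin k → Fin 2) (ℓ : Fin 2) : 0 ≤ stateT M N y ℓ := by
  unfold stateT; positivity

theorem stepVar_nonneg {ε : ℝ} (hε : 0 ≤ ε) {t : Fin 2 → ℝ} (ht : ∀ ℓ, 0 ≤ t ℓ) (ℓ : Fin 2) :
    0 ≤ stepVar ε t ℓ := by
  have := ht 0
  have := ht 1
  unfold stepVar
  positivity

/-- An affine function of a Gaussian random variable with the given mean and variance. -/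
theorem lintegral_gaussianReal_affine {a b e d : ℝ} {v : ℝ≥0} {D : ℝ} (hD : D = b ^ 2 * v)
    (he : b * a + e = d) {h : ℝ → ℝ≥0∞} (hh : Measurable h) :
    ∫⁻ s, h (b * s + e) ∂gaussianReal a v = ∫⁻ ξ, h (d + ξ) ∂gaussianReal 0 D.toNNReal := by
  have h1 := gaussianReal_map_const_mul (μ := a) (v := v) b
  have h2 := gaussianReal_map_add_const (μ := b * a) (v := NNReal.mk (b ^ 2) (sq_nonneg b) * v) e
  have h3 := gaussianReal_map_const_add (μ := 0) (v := D.toNNReal) d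
  have hv : D.toNNReal = NNReal.mk (b ^ 2) (sq_nonneg b) * v := by
    apply NNReal.eq
    rw [Real.coe_toNNReal _ (by rw [hD]; positivity), hD]
    rfl
  rw [zero_add] at h3
  rw [← lintegral_map (f := h) (g := fun ξ => d + ξ) hh (by fun_prop), h3, hv, ← he, ← h2, ← h1,
    lintegral_map hh (by fun_prop), lintegral_map (by fun_prop) (by fun_prop)]

/-- Under equal means and the flat prior, `u` makes a centred Gaussian step. -/
theorem lintegral_evidence_state {N : ℕ} (hM : 0 < M) (hN : 0 < N) (hk : 0 < k)
    (y : Fin k → Fin 2) (x : Fin k → Fin M → ℝ) (ℓ : Fin 2) {h : ℝ → ℝ≥0∞} (hh : Measurable h) :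
    ∫⁻ z : Fin M → ℝ, evidence (Fin.snoc (α := fun _ => Fin M → ℝ) x z) *
        h (stateU N (Fin.snoc (α := fun _ => Fin 2) y ℓ : Fin (k + 1) → Fin 2)
          (Fin.snoc (α := fun _ => Fin M → ℝ) x z)) =
      evidence x * ∫⁻ ξ, h (stateU N y x + ξ)
        ∂gaussianReal 0 (stepVar ((M : ℝ) / N) (stateT M N y) ℓ).toNNReal := by
  have hM' : (0 : ℝ) < M := by exact_mod_cast hM
  have hN' : (0 : ℝ) < N := by exact_mod_cast hN
  have hk' : (0 : ℝ) < k := by exact_mod_cast hk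
  have hs : (0 : ℝ) < √N := Real.sqrt_pos.2 hN'
  have hsq : √(N : ℝ) ^ 2 = N := Real.sq_sqrt hN'.le
  have hn : (count M y 0 : ℝ) + count M y 1 = M * k := by
    have := count_add_count M y
    exact_mod_cast this
  have hX := income_add_income y x
  have hn0 : (0 : ℝ) ≤ count M y 0 := Nat.cast_nonneg _
  have hn1 : (0 : ℝ) ≤ count M y 1 := Nat.cast_nonneg _
  set n₀ : ℝ := (count M y 0 : ℝ) with hn₀
  set n₁ : ℝ := (count M y 1 : ℝ) with hn₁
  -- `u` is an affine function `b * S + e` of the total income `S` of the batch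
  set b : ℝ := (if ℓ = 0 then n₁ else -n₀) / (M * k + M) / √N with hb
  set e : ℝ := (income y x 0 * (n₁ + if ℓ = 0 then 0 else M) -
    income y x 1 * (n₀ + if ℓ = 0 then M else 0)) / (M * k + M) / √N with he
  have hu : ∀ z : Fin M → ℝ, stateU N (Fin.snoc (α := fun _ => Fin 2) y ℓ : Fin (k + 1) → Fin 2)
      (Fin.snoc (α := fun _ => Fin M → ℝ) x z) = b * (∑ i, z i) + e := by
    intro z
    simp only [stateU, statU, count_snoc, income_snoc, Nat.cast_add, ← hn₀, ← hn₁]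
    have hd : n₀ + (((if (0 : Fin 2) = ℓ then M else 0 : ℕ)) : ℝ) +
        (n₁ + (((if (1 : Fin 2) = ℓ then M else 0 : ℕ)) : ℝ)) = M * k + M := by
      rw [← hn]; fin_cases ℓ <;> simp <;> ring
    rw [hd, hb, he]
    fin_cases ℓ <;> simp <;> field_simp <;> ring
  simp only [hu]
  have hw : (((M : ℝ≥0) / k + M : ℝ≥0) : ℝ) = M / k + M := by push_cast; rfl
  rw [lintegral_evidence_snoc hM hk x (h := fun s => h (b * s + e)) (by fun_prop) hw]
  congr 1
  refine lintegral_gaussianReal_affine ?_ ?_ hh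
  · rw [hw, stepVar, stateT_add]
    have h1 : stateT M N y (1 - ℓ) ^ 2 = ((if ℓ = 0 then n₁ else -n₀) / N) ^ 2 := by
      fin_cases ℓ <;> simp [stateT, neg_div, hn₀, hn₁]
    rw [h1, hb]
    generalize (if ℓ = 0 then n₁ else -n₀) = c
    rw [show (c / (M * k + M) / √(N : ℝ)) ^ 2 = c ^ 2 / (M * k + M) ^ 2 / √(N : ℝ) ^ 2 by
      rw [div_pow, div_pow], hsq]
    field_simp
    ring
  · have hM2 : (M : ℝ) * k + M ≠ 0 := by positivity
    rw [stateU, statU, hb, he, ← hX, ← hn₀, ← hn₁, hn]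
    have hn₁' : n₁ = M * k - n₀ := by linarith
    rw [hn₁']
    fin_cases ℓ
    · simp
      field_simp
      ring
    · simp
      field_simp
      ring

end

/-! ### The value function of the recursive equation -/

/-- The loss per unit of time caused by the action `ℓ` for the means `w` and `-w`. -/
def sideLoss (ℓ : Fin 2) (w : ℝ) : ℝ := |w| + ![-w, w] ℓ

theorem sideLoss_nonneg (ℓ : Fin 2) (w : ℝ) : 0 ≤ sideLoss ℓ w := by
  fin_cases ℓ
  · simpa [sideLoss] using le_abs_self w
  · simpa [sideLoss, ← sub_eq_add_neg] using neg_le_iff_add_nonneg.1 (neg_le_abs w)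

theorem sideLoss_le (ℓ : Fin 2) (w : ℝ) : sideLoss ℓ w ≤ 2 * |w| := by
  have h1 := le_abs_self w
  have h2 := neg_le_abs w
  fin_cases ℓ <;> simp [sideLoss] <;> linarith

@[fun_prop]
theorem measurable_sideLoss (ℓ : Fin 2) : Measurable (sideLoss ℓ) := by
  unfold sideLoss
  fin_cases ℓ <;> simp <;> fun_prop

/-- The function `g^(ℓ)` as an integral with respect to the law `μ` of `w`. -/
noncomputable def stageLoss (μ : Measure ℝ) (ℓ : Fin 2) (u : ℝ) (t : Fin 2 → ℝ) : ℝ≥0∞ :=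
  ∫⁻ w, ENNReal.ofReal (sideLoss ℓ w) *
    ENNReal.ofReal (exp (2 * u * w - 2 * w ^ 2 * (t 0 * t 1 / (t 0 + t 1)))) ∂μ

/-- The right-hand side of the recursive equation for the action `ℓ`, where `f` is the value after
one more batch. -/
noncomputable def actionValue (ε : ℝ) (μ : Measure ℝ) (f : ℝ → (Fin 2 → ℝ) → ℝ≥0∞) (ℓ : Fin 2)
    (u : ℝ) (t : Fin 2 → ℝ) : ℝ≥0∞ :=
  ENNReal.ofReal ε * stageLoss μ ℓ u t +
    ∫⁻ ξ, f (u + ξ) (stepT ε t ℓ) ∂gaussianReal 0 (stepVar ε t ℓ).toNNReal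

/-- The value function with `j` batches to go. The Gaussian measures may be degenerate, so that
states with `t 0 = 0` or `t 1 = 0` are included. -/
noncomputable def value (ε : ℝ) (μ : Measure ℝ) : ℕ → ℝ → (Fin 2 → ℝ) → ℝ≥0∞
  | 0, _, _ => 0
  | j + 1, u, t => ⨅ ℓ, actionValue ε μ (value ε μ j) ℓ u t

section

variable {ε : ℝ} {μ : Measure ℝ}

theorem measurable_stageLoss [SFinite μ] (ℓ : Fin 2) (t : Fin 2 → ℝ) :
    Measurable fun u => stageLoss μ ℓ u t := by
  unfold stageLoss
  exact Measurable.lintegral_prod_right' (f := fun p : ℝ × ℝ => ENNReal.ofReal (sideLoss ℓ p.2) *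
    ENNReal.ofReal (exp (2 * p.1 * p.2 - 2 * p.2 ^ 2 * (t 0 * t 1 / (t 0 + t 1))))) (by fun_prop)

theorem measurable_actionValue [SFinite μ] {f : ℝ → (Fin 2 → ℝ) → ℝ≥0∞}
    (hf : ∀ t, Measurable fun u => f u t) (ℓ : Fin 2) (t : Fin 2 → ℝ) :
    Measurable fun u => actionValue ε μ f ℓ u t := by
  refine ((measurable_stageLoss ℓ t).const_mul _).add ?_
  exact Measurable.lintegral_prod_right' (f := fun p : ℝ × ℝ => f (p.1 + p.2) (stepT ε t ℓ))
    ((hf _).comp (by fun_prop))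

theorem measurable_value [SFinite μ] (j : ℕ) (t : Fin 2 → ℝ) :
    Measurable fun u => value ε μ j u t := by
  induction j generalizing t with
  | zero => exact measurable_const
  | succ j ih => exact Measurable.iInf fun ℓ => measurable_actionValue ih ℓ t

theorem value_succ_le (j : ℕ) (ℓ : Fin 2) (u : ℝ) (t : Fin 2 → ℝ) :
    value ε μ (j + 1) u t ≤ actionValue ε μ (value ε μ j) ℓ u t :=
  iInf_le _ ℓ

theorem stepT_nonneg (hε : 0 ≤ ε) {t : Fin 2 → ℝ} (ht : ∀ i, 0 ≤ t i) (ℓ i : Fin 2) :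
    0 ≤ stepT ε t ℓ i := by
  unfold stepT
  split_ifs
  · exact add_nonneg (ht i) hε
  · simpa using ht i

/-- For one of the two actions the exponential weight is at most one wherever this action causes
losses. -/
theorem exists_stageLoss_le (u : ℝ) {t : Fin 2 → ℝ} (ht : ∀ i, 0 ≤ t i) :
    ∃ ℓ, stageLoss μ ℓ u t ≤ ∫⁻ w, ENNReal.ofReal (2 * |w|) ∂μ := by
  have hq : 0 ≤ t 0 * t 1 / (t 0 + t 1) :=
    div_nonneg (mul_nonneg (ht 0) (ht 1)) (add_nonneg (ht 0) (ht 1))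
  have key : ∀ ℓ, (∀ w, sideLoss ℓ w = 0 ∨ u * w ≤ 0) →
      stageLoss μ ℓ u t ≤ ∫⁻ w, ENNReal.ofReal (2 * |w|) ∂μ := by
    intro ℓ h
    refine lintegral_mono fun w => ?_
    rcases h w with h | h
    · simp [h]
    · calc _ ≤ ENNReal.ofReal (2 * |w|) * ENNReal.ofReal 1 := by
            refine mul_le_mul' (ENNReal.ofReal_le_ofReal (sideLoss_le ℓ w))
              (ENNReal.ofReal_le_ofReal (exp_le_one_iff.2 ?_))
            nlinarith [mul_nonneg (sq_nonneg w) hq]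
        _ = _ := by simp
  rcases le_total 0 u with hu | hu
  · refine ⟨0, key 0 fun w => ?_⟩
    rcases le_total 0 w with hw | hw
    · left; simp [sideLoss, abs_of_nonneg hw]
    · right; exact mul_nonpos_of_nonneg_of_nonpos hu hw
  · refine ⟨1, key 1 fun w => ?_⟩
    rcases le_total 0 w with hw | hw
    · right; exact mul_nonpos_of_nonpos_of_nonneg hu hw
    · left; simp [sideLoss, abs_of_nonpos hw]

/-- The value is bounded uniformly in `u`, although the function `g^(ℓ)` of each single action is
not. -/
theorem value_le (hε : 0 ≤ ε) (j : ℕ) (u : ℝ) {t : Fin 2 → ℝ} (ht : ∀ i, 0 ≤ t i) :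
    value ε μ j u t ≤ j * (ENNReal.ofReal ε * ∫⁻ w, ENNReal.ofReal (2 * |w|) ∂μ) := by
  induction j generalizing u t with
  | zero => simp [value]
  | succ j ih =>
    obtain ⟨ℓ, hℓ⟩ := exists_stageLoss_le (μ := μ) u ht
    refine (value_succ_le j ℓ u t).trans ?_
    calc _ ≤ ENNReal.ofReal ε * ∫⁻ w, ENNReal.ofReal (2 * |w|) ∂μ +
          ∫⁻ _, j * (ENNReal.ofReal ε * ∫⁻ w, ENNReal.ofReal (2 * |w|) ∂μ)
            ∂gaussianReal 0 (stepVar ε t ℓ).toNNReal :=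
          add_le_add (mul_le_mul_right hℓ _)
            (lintegral_mono fun ξ => ih _ (stepT_nonneg hε ht ℓ))
      _ = _ := by
          rw [lintegral_const, measure_univ, mul_one]
          push_cast
          ring

/-- The counts `t` if only the action `ℓ` has been applied. -/
def onlyT (ℓ : Fin 2) (τ : ℝ) : Fin 2 → ℝ := stepT τ 0 ℓ

theorem stepT_onlyT (ℓ : Fin 2) (τ : ℝ) : stepT ε (onlyT ℓ τ) ℓ = onlyT ℓ (τ + ε) := by
  ext i
  simp only [onlyT, stepT]
  split_ifs <;> simp

theorem stepT_comm (t : Fin 2 → ℝ) (ℓ ℓ' : Fin 2) :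
    stepT ε (stepT ε t ℓ) ℓ' = stepT ε (stepT ε t ℓ') ℓ := by
  ext i
  simp only [stepT]
  ring

theorem stepVar_onlyT_self (ℓ : Fin 2) (τ : ℝ) : stepVar ε (onlyT ℓ τ) ℓ = 0 := by
  fin_cases ℓ <;> simp [stepVar, onlyT, stepT]

theorem stepVar_onlyT_other (ℓ : Fin 2) (τ : ℝ) :
    stepVar ε (onlyT ℓ τ) (1 - ℓ) = ε * τ ^ 2 / (τ * (τ + ε)) := by
  fin_cases ℓ <;> simp [stepVar, onlyT, stepT]

theorem stageLoss_onlyT (hμ : μ.map (fun w => -w) = μ) (ℓ ℓ' : Fin 2) (τ : ℝ) :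
    stageLoss μ ℓ' 0 (onlyT ℓ τ) = ∫⁻ w, ENNReal.ofReal (sideLoss 0 w) ∂μ := by
  have h : stageLoss μ ℓ' 0 (onlyT ℓ τ) = ∫⁻ w, ENNReal.ofReal (sideLoss ℓ' w) ∂μ := by
    refine lintegral_congr fun w => ?_
    fin_cases ℓ <;> simp [onlyT, stepT]
  rw [h]
  fin_cases ℓ'
  · rfl
  · change _ = ∫⁻ w, ENNReal.ofReal (sideLoss 0 w) ∂μ
    rw [← hμ, lintegral_map (by fun_prop) (by fun_prop), hμ]
    simp [sideLoss]

/-- If `u` is centred with the variance `t₁ t₂ / t`, as it is for equal means, then the mean of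
`g^(ℓ)` does not depend on `t`, because the mean of the exponential weight is one. -/
theorem lintegral_stageLoss [SFinite μ] (ℓ : Fin 2) (t : Fin 2 → ℝ) (v : ℝ≥0)
    (hv : (v : ℝ) = t 0 * t 1 / (t 0 + t 1)) :
    ∫⁻ ξ, stageLoss μ ℓ ξ t ∂gaussianReal 0 v = ∫⁻ w, ENNReal.ofReal (sideLoss ℓ w) ∂μ := by
  unfold stageLoss
  rw [lintegral_lintegral_swap (by fun_prop)]
  refine lintegral_congr fun w => ?_
  rw [lintegral_const_mul' _ _ ENNReal.ofReal_ne_top]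
  have e : ∀ ξ, ENNReal.ofReal (exp (2 * ξ * w - 2 * w ^ 2 * (t 0 * t 1 / (t 0 + t 1)))) =
      ENNReal.ofReal (exp (-(2 * w ^ 2 * (t 0 * t 1 / (t 0 + t 1))))) *
        ENNReal.ofReal (exp ((2 * w) * ξ)) := fun ξ => by
    rw [← ENNReal.ofReal_mul (exp_pos _).le, ← exp_add]
    congr 2; ring
  simp only [e]
  rw [lintegral_const_mul' _ _ ENNReal.ofReal_ne_top, lintegral_exp_gaussianReal,
    ← ENNReal.ofReal_mul (exp_pos _).le, ← exp_add, ← hv]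
  rw [show -(2 * w ^ 2 * (v : ℝ)) + v * (2 * w) ^ 2 / 2 = 0 by ring]
  simp

theorem lintegral_sideLoss (hμ : μ.map (fun w => -w) = μ) (ℓ : Fin 2) :
    ∫⁻ w, ENNReal.ofReal (sideLoss ℓ w) ∂μ = ∫⁻ w, ENNReal.ofReal (sideLoss 0 w) ∂μ := by
  rw [← stageLoss_onlyT hμ 0 ℓ 0]
  refine lintegral_congr fun w => ?_
  simp [onlyT, stepT]

theorem actionValue_onlyT_other (hμ : μ.map (fun w => -w) = μ) (f : ℝ → (Fin 2 → ℝ) → ℝ≥0∞)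
    (ℓ : Fin 2) (τ : ℝ) :
    actionValue ε μ f (1 - ℓ) 0 (onlyT ℓ τ) =
      ENNReal.ofReal ε * ∫⁻ w, ENNReal.ofReal (sideLoss 0 w) ∂μ +
      ∫⁻ ξ, f ξ (stepT ε (onlyT ℓ τ) (1 - ℓ))
        ∂gaussianReal 0 (stepVar ε (onlyT ℓ τ) (1 - ℓ)).toNNReal := by
  rw [actionValue, stageLoss_onlyT hμ]
  simp only [zero_add]

theorem actionValue_onlyT_self [SFinite μ] (hμ : μ.map (fun w => -w) = μ) (j : ℕ)
    (ℓ : Fin 2) (τ : ℝ) :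
    actionValue ε μ (value ε μ j) ℓ 0 (onlyT ℓ τ) =
      ENNReal.ofReal ε * ∫⁻ w, ENNReal.ofReal (sideLoss 0 w) ∂μ +
        value ε μ j 0 (onlyT ℓ (τ + ε)) := by
  rw [actionValue, stageLoss_onlyT hμ, stepVar_onlyT_self, stepT_onlyT, Real.toNNReal_zero,
    gaussianReal_zero_var, lintegral_dirac, add_zero]

/-- Trying the other action at once is not worse than repeating the only action used so far. The
repetition can be made up for after the switch: its mean loss is unchanged by `lintegral_stageLoss`,
and the variances of the two steps of `u` then add up to the variance of the single step after a
later switch. -/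
theorem lintegral_value_le_value_onlyT [SFinite μ] (hμ : μ.map (fun w => -w) = μ) (hε : 0 < ε)
    (ℓ : Fin 2) (j : ℕ) {τ : ℝ} (hτ : 0 < τ) :
    ∫⁻ ξ, value ε μ j ξ (stepT ε (onlyT ℓ τ) (1 - ℓ))
        ∂gaussianReal 0 (stepVar ε (onlyT ℓ τ) (1 - ℓ)).toNNReal ≤
      value ε μ j 0 (onlyT ℓ (τ + ε)) := by
  induction j generalizing τ with
  | zero => simp [value]
  | succ j ih =>
    set t' := stepT ε (onlyT ℓ τ) (1 - ℓ) with ht'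
    have h0 : stepVar ε (onlyT ℓ τ) (1 - ℓ) = t' 0 * t' 1 / (t' 0 + t' 1) := by
      rw [stepVar_onlyT_other, ht']
      fin_cases ℓ
      all_goals
        simp [stepT, onlyT]
        field_simp
      ring
    have h0' : 0 ≤ stepVar ε (onlyT ℓ τ) (1 - ℓ) := by
      rw [stepVar_onlyT_other]; positivity
    have h1 : stepVar ε (onlyT ℓ τ) (1 - ℓ) + stepVar ε t' ℓ =
        stepVar ε (onlyT ℓ (τ + ε)) (1 - ℓ) := by
      rw [stepVar_onlyT_other, stepVar_onlyT_other, ht']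
      fin_cases ℓ
      all_goals
        simp [stepT, onlyT, stepVar]
        field_simp
        ring
    have h1' : 0 ≤ stepVar ε t' ℓ := by
      refine stepVar_nonneg hε.le (fun i => stepT_nonneg hε.le (fun i => ?_) _ i) ℓ
      exact stepT_nonneg hτ.le (fun _ => le_rfl) _ _
    have h2 : stepT ε t' ℓ = stepT ε (onlyT ℓ (τ + ε)) (1 - ℓ) := by
      rw [ht', stepT_comm, stepT_onlyT]
    -- apply `ℓ` first after the switch; the other order of the two batches gives the lower bound
    have upper : ∫⁻ ξ, value ε μ (j + 1) ξ t'
          ∂gaussianReal 0 (stepVar ε (onlyT ℓ τ) (1 - ℓ)).toNNReal ≤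
        ENNReal.ofReal ε * ∫⁻ w, ENNReal.ofReal (sideLoss 0 w) ∂μ +
        ∫⁻ ξ, value ε μ j ξ (stepT ε (onlyT ℓ (τ + ε)) (1 - ℓ))
          ∂gaussianReal 0 (stepVar ε (onlyT ℓ (τ + ε)) (1 - ℓ)).toNNReal := by
      refine (lintegral_mono fun ξ => value_succ_le j ℓ ξ t').trans_eq ?_
      simp only [actionValue]
      rw [lintegral_add_left ((measurable_stageLoss ℓ t').const_mul _),
        lintegral_const_mul _ (measurable_stageLoss ℓ t'),
        lintegral_stageLoss ℓ t' _ (by rw [Real.coe_toNNReal _ h0', h0]),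
        lintegral_sideLoss hμ, h2,
        lintegral_gaussianReal_add _ _ (measurable_value j _), ← Real.toNNReal_add h0' h1', h1]
    refine upper.trans (le_iInf fun ℓ' => ?_)
    rcases eq_or_ne ℓ' ℓ with rfl | h
    · rw [actionValue_onlyT_self hμ]
      exact add_le_add le_rfl (ih (by positivity))
    · have : ℓ' = 1 - ℓ := by omega
      rw [this, actionValue_onlyT_other hμ]

/-- As long as only the action `ℓ` has been used, the other action is optimal. -/
theorem value_succ_onlyT [SFinite μ] (hμ : μ.map (fun w => -w) = μ) (hε : 0 < ε)
    (ℓ : Fin 2) (j : ℕ) {τ : ℝ} (hτ : 0 < τ) :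
    value ε μ (j + 1) 0 (onlyT ℓ τ) = actionValue ε μ (value ε μ j) (1 - ℓ) 0 (onlyT ℓ τ) := by
  refine le_antisymm (value_succ_le _ _ _ _) (le_iInf fun ℓ' => ?_)
  rcases eq_or_ne ℓ' ℓ with rfl | h
  · rw [actionValue_onlyT_self hμ, actionValue_onlyT_other hμ]
    exact add_le_add le_rfl (lintegral_value_le_value_onlyT hμ hε ℓ' j hτ)
  · have : ℓ' = 1 - ℓ := by omega
    rw [this]

theorem value_succ_onlyT_eq [SFinite μ] (hμ : μ.map (fun w => -w) = μ) (hε : 0 < ε)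
    (ℓ : Fin 2) (j : ℕ) :
    value ε μ (j + 1) 0 (onlyT ℓ ε) =
      ENNReal.ofReal ε * ∫⁻ w, ENNReal.ofReal (sideLoss 0 w) ∂μ +
        ∫⁻ ξ, value ε μ j ξ (fun _ => ε) ∂gaussianReal 0 (0.5 * ε).toNNReal := by
  have h1 : stepT ε (onlyT ℓ ε) (1 - ℓ) = fun _ => ε := by
    ext i; fin_cases ℓ <;> fin_cases i <;> simp [stepT, onlyT]
  have h2 : stepVar ε (onlyT ℓ ε) (1 - ℓ) = 0.5 * ε := by
    rw [stepVar_onlyT_other]; field_simp; norm_num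
  rw [value_succ_onlyT hμ hε ℓ j hε, actionValue_onlyT_other hμ, h1, h2]

end

/-! ### The flat prior: expected losses and the value function -/

section

variable {M N k : ℕ} {ν : Measure (ℝ × ℝ)} {μ : Measure ℝ} {σ : Strategy M}

/-- The parameter `(m + v, m - v)` for `v = w / √N`, with coordinates `p = (m, w)`. -/
noncomputable def scaledParam (N : ℕ) (p : ℝ × ℝ) : Fin 2 → ℝ := param (p.1, p.2 / √N)

@[fun_prop]
theorem measurable_param : Measurable param := by
  refine measurable_pi_iff.2 fun i => ?_
  fin_cases i <;> simp [param] <;> fun_prop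

@[fun_prop]
theorem measurable_scaledParam (N : ℕ) : Measurable (scaledParam N) := by
  unfold scaledParam; fun_prop

/-- The losses over the next `j` batches after the history `(y, x)`, integrated against the
likelihood of this history and the measure `ν` of `(m, w)`. -/
noncomputable def futureLoss (N : ℕ) (ν : Measure (ℝ × ℝ)) (σ : Strategy M) (j k : ℕ)
    (y : Fin k → Fin 2) (x : Fin k → Fin M → ℝ) : ℝ≥0∞ :=
  ∫⁻ p, lossE σ (scaledParam N p) j k y x * ENNReal.ofReal (likelihood y x (scaledParam N p)) ∂ν

/-- The losses of the next batch if the action `ℓ` is applied to it, integrated as in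
`futureLoss`. -/
noncomputable def nextLoss (N : ℕ) (ν : Measure (ℝ × ℝ)) (y : Fin k → Fin 2)
    (x : Fin k → Fin M → ℝ) (ℓ : Fin 2) : ℝ≥0∞ :=
  ∫⁻ p, ENNReal.ofReal (batchLoss M (scaledParam N p) ℓ) *
    ENNReal.ofReal (likelihood y x (scaledParam N p)) ∂ν

@[fun_prop]
theorem measurable_lossE_scaledParam {α : Type*} [MeasurableSpace α] (N : ℕ) (σ : Strategy M)
    (j k : ℕ) (y : Fin k → Fin 2) {f : α → ℝ × ℝ} {g : α → Fin k → Fin M → ℝ}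
    (hf : Measurable f) (hg : Measurable g) :
    Measurable fun a => lossE σ (scaledParam N (f a)) j k y (g a) := by
  have h := (measurable_lossE σ j k y).comp (((measurable_scaledParam N).comp hf).prodMk hg)
  simpa only [Function.comp_def] using h

@[fun_prop]
theorem measurable_likelihood_scaledParam {α : Type*} [MeasurableSpace α] (N : ℕ)
    (y : Fin k → Fin 2) {f : α → ℝ × ℝ} {g : α → Fin k → Fin M → ℝ}
    (hf : Measurable f) (hg : Measurable g) :
    Measurable fun a => likelihood y (g a) (scaledParam N (f a)) := by
  have h := (measurable_likelihood y).comp (((measurable_scaledParam N).comp hf).prodMk hg)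
  simpa only [Function.comp_def] using h

@[fun_prop]
theorem measurable_batchLoss_scaledParam {α : Type*} [MeasurableSpace α] (M N : ℕ) (ℓ : Fin 2)
    {f : α → ℝ × ℝ} (hf : Measurable f) :
    Measurable fun a => batchLoss M (scaledParam N (f a)) ℓ := by
  have h := (measurable_batchLoss (M := M) ℓ).comp ((measurable_scaledParam N).comp hf)
  simpa only [Function.comp_def] using h

@[fun_prop]
theorem measurable_snoc_comp {α : Type*} [MeasurableSpace α] {f : α → Fin k → Fin M → ℝ}
    {g : α → Fin M → ℝ} (hf : Measurable f) (hg : Measurable g) :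
    Measurable fun a =>
      (Fin.snoc (α := fun _ => Fin M → ℝ) (f a) (g a) : Fin (k + 1) → Fin M → ℝ) := by
  have h := measurable_snoc.comp (hf.prodMk hg)
  simpa only [Function.comp_def] using h

theorem measurable_futureLoss [SFinite ν] (N : ℕ) (σ : Strategy M) (j k : ℕ) (y : Fin k → Fin 2) :
    Measurable fun x => futureLoss N ν σ j k y x := by
  unfold futureLoss
  exact Measurable.lintegral_prod_left' (f := fun q : (ℝ × ℝ) × (Fin k → Fin M → ℝ) =>
    lossE σ (scaledParam N q.1) j k y q.2 *
      ENNReal.ofReal (likelihood y q.2 (scaledParam N q.1))) (by fun_prop)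

/-- One step of the recursion for an arbitrary prior. The density of the incomes of the next batch
is absorbed into the likelihood of the longer history. -/
theorem futureLoss_succ [SFinite ν] (N : ℕ) (σ : Strategy M) (j k : ℕ) (y : Fin k → Fin 2)
    (x : Fin k → Fin M → ℝ) :
    futureLoss N ν σ (j + 1) k y x = ∑ ℓ, ENNReal.ofReal (σ.prob k y x ℓ) *
      (nextLoss N ν y x ℓ + ∫⁻ z, futureLoss N ν σ j (k + 1) (Fin.snoc (α := fun _ => Fin 2) y ℓ)
        (Fin.snoc (α := fun _ => Fin M → ℝ) x z)) := by
  set Y : Fin 2 → Fin (k + 1) → Fin 2 := fun ℓ => Fin.snoc (α := fun _ => Fin 2) y ℓ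
  set X : (Fin M → ℝ) → Fin (k + 1) → Fin M → ℝ := fun z => Fin.snoc (α := fun _ => Fin M → ℝ) x z
  have hX : Measurable X := by fun_prop
  have mL : Measurable fun p => ENNReal.ofReal (likelihood y x (scaledParam N p)) := by
    fun_prop
  have mB : ∀ ℓ, Measurable fun p => ENNReal.ofReal (batchLoss M (scaledParam N p) ℓ) := fun ℓ => by
    fun_prop
  have mD : ∀ ℓ, Measurable fun q : (ℝ × ℝ) × (Fin M → ℝ) =>
      ENNReal.ofReal (batchDensity (scaledParam N q.1 ℓ) q.2) := fun ℓ => by fun_prop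
  have mF : ∀ ℓ, Measurable fun q : (ℝ × ℝ) × (Fin M → ℝ) =>
      lossE σ (scaledParam N q.1) j (k + 1) (Y ℓ) (X q.2) := fun ℓ => by fun_prop
  have mI : ∀ ℓ, Measurable fun p => ∫⁻ z, ENNReal.ofReal (batchDensity (scaledParam N p ℓ) z) *
      lossE σ (scaledParam N p) j (k + 1) (Y ℓ) (X z) := fun ℓ =>
    Measurable.lintegral_prod_right' ((mD ℓ).mul (mF ℓ))
  have e1 : ∀ p, lossE σ (scaledParam N p) (j + 1) k y x *
      ENNReal.ofReal (likelihood y x (scaledParam N p)) =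
      ∑ ℓ, ENNReal.ofReal (σ.prob k y x ℓ) *
        (ENNReal.ofReal (batchLoss M (scaledParam N p) ℓ) *
            ENNReal.ofReal (likelihood y x (scaledParam N p)) +
          (∫⁻ z, ENNReal.ofReal (batchDensity (scaledParam N p ℓ) z) *
            lossE σ (scaledParam N p) j (k + 1) (Y ℓ) (X z)) *
              ENNReal.ofReal (likelihood y x (scaledParam N p))) := fun p => by
    rw [lossE_succ, Finset.sum_mul]
    exact Finset.sum_congr rfl fun ℓ _ => by rw [mul_assoc, add_mul]
  rw [futureLoss, lintegral_congr e1, lintegral_finsetSum]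
  swap
  · exact fun ℓ _ => (((mB ℓ).mul mL).add ((mI ℓ).mul mL)).const_mul _
  refine Finset.sum_congr rfl fun ℓ _ => ?_
  rw [lintegral_const_mul' _ _ ENNReal.ofReal_ne_top]
  refine congrArg _ ((lintegral_add_left ((mB ℓ).mul mL) _).trans ?_)
  refine congrArg₂ _ rfl ?_
  have e2 : ∀ p, (∫⁻ z, ENNReal.ofReal (batchDensity (scaledParam N p ℓ) z) *
        lossE σ (scaledParam N p) j (k + 1) (Y ℓ) (X z)) *
          ENNReal.ofReal (likelihood y x (scaledParam N p)) =
      ∫⁻ z, lossE σ (scaledParam N p) j (k + 1) (Y ℓ) (X z) *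
        ENNReal.ofReal (likelihood (Y ℓ) (X z) (scaledParam N p)) := fun p => by
    rw [← lintegral_mul_const' _ _ ENNReal.ofReal_ne_top]
    refine lintegral_congr fun z => ?_
    rw [likelihood_snoc, ENNReal.ofReal_mul (likelihood_pos _ _ _).le]
    ring
  simp only [e2]
  rw [lintegral_lintegral_swap]
  · rfl
  · fun_prop

theorem batchLoss_scaledParam (hN : 0 < N) (m w : ℝ) (ℓ : Fin 2) :
    batchLoss M (scaledParam N (m, w)) ℓ = √N * ((M : ℝ) / N) * sideLoss ℓ w := by
  have hN' : (0 : ℝ) < N := by exact_mod_cast hN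
  have hs : (0 : ℝ) < √N := Real.sqrt_pos.2 hN'
  have h1 : max (m + w / √N) (m - w / √N) = m + |w| / √N := by
    rw [sub_eq_add_neg, max_add_add_left, max_comm, ← neg_div, max_div_div_right hs.le,
      max_comm, abs_eq_max_neg]
  have h2 : √(N : ℝ) * ((M : ℝ) / N) = M / √N := by
    rw [mul_div_assoc', div_eq_div_iff hN'.ne' hs.ne', mul_right_comm, Real.mul_self_sqrt hN'.le,
      mul_comm]
  rw [h2, batchLoss]
  fin_cases ℓ
  · simp [scaledParam, param, sideLoss, h1]
    field_simp
    ring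
  · simp [scaledParam, param, sideLoss, h1]
    field_simp

/-- For the flat prior, the losses of the next batch are given by the function `g^(ℓ)` at the
rescaled state; here `√N * (M / N)` is the factor `M / √N` which comes from `v = w / √N`. -/
theorem nextLoss_flat [SFinite μ] (hM : 0 < M) (hN : 0 < N) (hk : 0 < k) (y : Fin k → Fin 2)
    (x : Fin k → Fin M → ℝ) (ℓ : Fin 2) :
    nextLoss N (volume.prod μ) y x ℓ = evidence x * (ENNReal.ofReal √N *
      (ENNReal.ofReal ((M : ℝ) / N) * stageLoss μ ℓ (stateU N y x) (stateT M N y))) := by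
  have hN' : (0 : ℝ) < N := by exact_mod_cast hN
  have hs : (0 : ℝ) < √N := Real.sqrt_pos.2 hN'
  rw [nextLoss, lintegral_prod_symm' _ (by fun_prop), stageLoss,
    ← lintegral_const_mul' _ _ ENNReal.ofReal_ne_top,
    ← lintegral_const_mul' _ _ ENNReal.ofReal_ne_top,
    ← lintegral_const_mul' _ _ (evidence_ne_top hM hk x)]
  refine lintegral_congr fun w => ?_
  simp only [batchLoss_scaledParam hN]
  rw [lintegral_const_mul' _ _ ENNReal.ofReal_ne_top]
  have := lintegral_likelihood y x (count_add_count_pos hM hk y) (w / √N)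
  simp only [scaledParam]
  rw [this, ENNReal.ofReal_mul (by positivity), ENNReal.ofReal_mul (by positivity)]
  have e : 2 * (w / √N) * statU y x - 2 * (w / √N) ^ 2 *
      (count M y 0 * count M y 1 / ((count M y 0 : ℝ) + count M y 1)) =
      2 * stateU N y x * w - 2 * w ^ 2 *
        (stateT M N y 0 * stateT M N y 1 / (stateT M N y 0 + stateT M N y 1)) := by
    have hn := count_add_count_pos hM hk y
    simp only [stateU, stateT, div_pow, Real.sq_sqrt hN'.le]
    field_simp
  rw [e]
  ring

/-- One step of the recursion for the flat prior: the losses of the next batch and the value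
afterwards add up to the right-hand side of the recursive equation. -/
theorem nextLoss_add_lintegral_value [SFinite μ] (hM : 0 < M) (hN : 0 < N) (hk : 0 < k)
    (y : Fin k → Fin 2) (x : Fin k → Fin M → ℝ) (j : ℕ) (ℓ : Fin 2) :
    nextLoss N (volume.prod μ) y x ℓ +
      ∫⁻ z, evidence (Fin.snoc (α := fun _ => Fin M → ℝ) x z) * (ENNReal.ofReal √N *
        value ((M : ℝ) / N) μ j
          (stateU N (Fin.snoc (α := fun _ => Fin 2) y ℓ : Fin (k + 1) → Fin 2)
            (Fin.snoc (α := fun _ => Fin M → ℝ) x z))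
          (stateT M N (Fin.snoc (α := fun _ => Fin 2) y ℓ : Fin (k + 1) → Fin 2))) =
      evidence x * (ENNReal.ofReal √N *
        actionValue ((M : ℝ) / N) μ (value ((M : ℝ) / N) μ j) ℓ (stateU N y x)
          (stateT M N y)) := by
  simp only [stateT_snoc]
  rw [lintegral_evidence_state hM hN hk y x ℓ (h := fun u => ENNReal.ofReal √N *
    value ((M : ℝ) / N) μ j u (stepT ((M : ℝ) / N) (stateT M N y) ℓ))
    ((measurable_value j _).const_mul _), nextLoss_flat hM hN hk,
    lintegral_const_mul' _ _ ENNReal.ofReal_ne_top, actionValue]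
  ring

theorem sum_ofReal_prob (σ : Strategy M) (y : Fin k → Fin 2) (x : Fin k → Fin M → ℝ) :
    ∑ ℓ, ENNReal.ofReal (σ.prob k y x ℓ) = 1 := by
  rw [← ENNReal.ofReal_sum_of_nonneg fun ℓ _ => σ.prob_nonneg k y x ℓ, σ.prob_sum,
    ENNReal.ofReal_one]

/-- For the flat prior, the value function bounds the expected losses of all strategies from
below. -/
theorem value_le_futureLoss [SFinite μ] (hM : 0 < M) (hN : 0 < N) (hk : 0 < k) (σ : Strategy M)
    (j : ℕ) (y : Fin k → Fin 2) (x : Fin k → Fin M → ℝ) :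
    evidence x * (ENNReal.ofReal √N *
      value ((M : ℝ) / N) μ j (stateU N y x) (stateT M N y)) ≤
      futureLoss N (volume.prod μ) σ j k y x := by
  induction j generalizing k with
  | zero => simp [value]
  | succ j ih =>
    rw [futureLoss_succ]
    calc _ = ∑ ℓ, ENNReal.ofReal (σ.prob k y x ℓ) * (evidence x * (ENNReal.ofReal √N *
          value ((M : ℝ) / N) μ (j + 1) (stateU N y x) (stateT M N y))) := by
          rw [← Finset.sum_mul, sum_ofReal_prob, one_mul]
      _ ≤ _ := by
          refine Finset.sum_le_sum fun ℓ _ => mul_le_mul_right ?_ _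
          calc _ ≤ evidence x * (ENNReal.ofReal √N * actionValue ((M : ℝ) / N) μ
                (value ((M : ℝ) / N) μ j) ℓ (stateU N y x) (stateT M N y)) :=
                mul_le_mul_right (mul_le_mul_right (value_succ_le _ _ _ _) _) _
            _ ≤ _ := by
                rw [← nextLoss_add_lintegral_value hM hN hk]
                exact add_le_add le_rfl (lintegral_mono fun z => ih (Nat.succ_pos k) _ _)

/-- From the batch `k₀` on, and as soon as both actions have been used, the strategy chooses only
actions which minimize the right-hand side of the recursive equation. -/
def IsGreedyFrom (N K : ℕ) (μ : Measure ℝ) (k₀ : ℕ) (σ : Strategy M) : Prop :=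
  ∀ (j k : ℕ) (y : Fin k → Fin 2) (x : Fin k → Fin M → ℝ), k₀ ≤ k → j + 1 + k = K → BothUsed y →
    ∀ ℓ, σ.prob k y x ℓ ≠ 0 →
      actionValue ((M : ℝ) / N) μ (value ((M : ℝ) / N) μ j) ℓ (stateU N y x) (stateT M N y) =
        value ((M : ℝ) / N) μ (j + 1) (stateU N y x) (stateT M N y)

theorem BothUsed.snoc {y : Fin k → Fin 2} (hy : BothUsed y) (ℓ : Fin 2) :
    BothUsed (Fin.snoc (α := fun _ => Fin 2) y ℓ : Fin (k + 1) → Fin 2) := fun ℓ' => by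
  obtain ⟨i, hi⟩ := hy ℓ'
  exact ⟨i.castSucc, by rw [Fin.snoc_castSucc, hi]⟩

theorem BothUsed.pos {y : Fin k → Fin 2} (hy : BothUsed y) : 0 < k := by
  obtain ⟨i, -⟩ := hy 0
  exact i.pos

/-- Greedy strategies attain the value function. -/
theorem futureLoss_eq_value [SFinite μ] (hM : 0 < M) (hN : 0 < N) {K k₀ : ℕ}
    (hσ : IsGreedyFrom N K μ k₀ σ) (j : ℕ) (y : Fin k → Fin 2) (x : Fin k → Fin M → ℝ)
    (hk₀ : k₀ ≤ k) (hjk : j + k = K) (hy : BothUsed y) :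
    futureLoss N (volume.prod μ) σ j k y x = evidence x * (ENNReal.ofReal √N *
      value ((M : ℝ) / N) μ j (stateU N y x) (stateT M N y)) := by
  induction j generalizing k with
  | zero => simp [value, futureLoss, lossE_zero]
  | succ j ih =>
    rw [futureLoss_succ]
    have e : ∀ ℓ, ENNReal.ofReal (σ.prob k y x ℓ) * (nextLoss N (volume.prod μ) y x ℓ +
        ∫⁻ z, futureLoss N (volume.prod μ) σ j (k + 1) (Fin.snoc (α := fun _ => Fin 2) y ℓ)
          (Fin.snoc (α := fun _ => Fin M → ℝ) x z)) =
        ENNReal.ofReal (σ.prob k y x ℓ) * (evidence x * (ENNReal.ofReal √N *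
          value ((M : ℝ) / N) μ (j + 1) (stateU N y x) (stateT M N y))) := by
      intro ℓ
      rcases eq_or_ne (σ.prob k y x ℓ) 0 with h | h
      · simp [h]
      · rw [← hσ j k y x hk₀ hjk hy ℓ h, ← nextLoss_add_lintegral_value hM hN hy.pos]
        congr 2
        exact lintegral_congr fun z => ih _ _ (by omega) (by omega) (hy.snoc ℓ)
    simp only [e]
    rw [← Finset.sum_mul, sum_ofReal_prob, one_mul]

end

/-! ### From the flat prior to uniform priors on long intervals -/

section

variable {M N k : ℕ} {μ : Measure ℝ} {σ : Strategy M}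

/-- Integrals over the mean `m` of Gaussian probabilities reduce to the lengths of sets of `m`, for
each value `ξ` of the centred noise. -/
theorem lintegral_gaussianReal_apply (A S : Set ℝ) (hS : MeasurableSet S) (b : ℝ) :
    ∫⁻ m in A, gaussianReal (m + b) 1 S =
      ∫⁻ ξ, volume ({m | m + b + ξ ∈ S} ∩ A) ∂gaussianReal 0 1 := by
  have h1 : ∀ m, gaussianReal (m + b) 1 S =
      ∫⁻ ξ, S.indicator 1 (m + b + ξ) ∂gaussianReal 0 1 := fun m => by
    have := gaussianReal_map_const_add (μ := 0) (v := 1) (m + b)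
    rw [zero_add] at this
    rw [← this, ← lintegral_indicator_one hS,
      lintegral_map (measurable_one.indicator hS) (by fun_prop)]
  simp only [h1]
  have hm : Measurable fun q : ℝ × ℝ => S.indicator (1 : ℝ → ℝ≥0∞) (q.1 + b + q.2) :=
    (measurable_one.indicator hS).comp (by fun_prop)
  rw [lintegral_lintegral_swap hm.aemeasurable]
  refine lintegral_congr fun ξ => ?_
  have hP : MeasurableSet {m | m + b + ξ ∈ S} :=
    (by fun_prop : Measurable fun m : ℝ => m + b + ξ) hS
  rw [← Measure.restrict_apply hP, ← lintegral_indicator_one hP]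
  rfl

theorem volume_exit_le (a η : ℝ) : volume ({m : ℝ | ¬ |m + η| ≤ a} ∩ {m | |m| ≤ a}) ≤
    ENNReal.ofReal (2 * |η|) := by
  have h : {m : ℝ | ¬ |m + η| ≤ a} ∩ {m | |m| ≤ a} ⊆
      Icc (a - |η|) a ∪ Icc (-a) (-a + |η|) := by
    rintro m ⟨h1, h2⟩
    simp only [mem_ofPred_eq, not_le] at h1 h2
    have h3 := abs_add_le m η
    rcases abs_cases m with ⟨h4, -⟩ | ⟨h4, -⟩
    · left; constructor <;> linarith
    · right; constructor <;> linarith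
  calc _ ≤ volume (Icc (a - |η|) a) + volume (Icc (-a) (-a + |η|)) :=
        (measure_mono h).trans (measure_union_le _ _)
    _ = _ := by
        rw [Real.volume_Icc, Real.volume_Icc, ← ENNReal.ofReal_add (by simp) (by simp)]
        congr 1; ring

theorem volume_enter_le (a η : ℝ) : volume ({m : ℝ | |m + η| ≤ a} ∩ {m | ¬ |m| ≤ a}) ≤
    ENNReal.ofReal (2 * |η|) := by
  have h : {m : ℝ | |m + η| ≤ a} ∩ {m | ¬ |m| ≤ a} ⊆
      Icc a (a + |η|) ∪ Icc (-a - |η|) (-a) := by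
    rintro m ⟨h1, h2⟩
    simp only [mem_ofPred_eq, not_le] at h1 h2
    have h3 := abs_sub_abs_le_abs_sub m (-η)
    rw [sub_neg_eq_add, abs_neg] at h3
    rcases abs_cases m with ⟨h4, -⟩ | ⟨h4, -⟩
    · left; constructor <;> linarith
    · right; constructor <;> linarith
  calc _ ≤ volume (Icc a (a + |η|)) + volume (Icc (-a - |η|) (-a)) :=
        (measure_mono h).trans (measure_union_le _ _)
    _ = _ := by
        rw [Real.volume_Icc, Real.volume_Icc, ← ENNReal.ofReal_add (by simp) (by simp)]
        congr 1; ring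

/-- The incomes of a batch with the first income in `S`. -/
def firstIncome (hM : 0 < M) (S : Set ℝ) : Set (Fin M → ℝ) := {z | z ⟨0, hM⟩ ∈ S}

theorem measurableSet_firstIncome (hM : 0 < M) {S : Set ℝ} (hS : MeasurableSet S) :
    MeasurableSet (firstIncome hM S) :=
  (measurable_pi_apply _) hS

theorem batchLaw_firstIncome (hM : 0 < M) (m : ℝ) {S : Set ℝ} (hS : MeasurableSet S) :
    batchLaw M m (firstIncome hM S) = gaussianReal m 1 S :=
  (measurePreserving_eval (fun _ : Fin M => gaussianReal m 1) ⟨0, hM⟩).measure_preimage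
    hS.nullMeasurableSet

theorem setLIntegral_batchDensity (m : ℝ) {S : Set (Fin M → ℝ)} (hS : MeasurableSet S) :
    ∫⁻ z in S, ENNReal.ofReal (batchDensity m z) = batchLaw M m S := by
  rw [batchLaw_eq_withDensity, withDensity_apply _ hS]

/-- The history which consists of one batch with the action `ℓ`. -/
def oneAction (ℓ : Fin 2) : Fin 1 → Fin 2 := fun _ => ℓ

/-- The incomes of a history which consists of one batch. -/
def oneBatch (z : Fin M → ℝ) : Fin 1 → Fin M → ℝ := fun _ => z

theorem snoc_elim0_action (ℓ : Fin 2) (y : Fin 0 → Fin 2) :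
    (Fin.snoc (α := fun _ => Fin 2) y ℓ : Fin 1 → Fin 2) = oneAction ℓ := by
  funext i; rw [Fin.fin_one_eq_zero i]; exact Fin.snoc_last (α := fun _ => Fin 2) ℓ y

theorem snoc_elim0_batch (x : Fin 0 → Fin M → ℝ) (z : Fin M → ℝ) :
    (Fin.snoc (α := fun _ => Fin M → ℝ) x z : Fin 1 → Fin M → ℝ) = oneBatch z := by
  funext i; rw [Fin.fin_one_eq_zero i]; exact Fin.snoc_last (α := fun _ => Fin M → ℝ) z x

theorem likelihood_oneAction (ℓ : Fin 2) (z : Fin M → ℝ) (θ : Fin 2 → ℝ) :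
    likelihood (oneAction ℓ) (oneBatch z) θ = batchDensity (θ ℓ) z := by
  simp [likelihood, oneAction, oneBatch, batchDensity]

theorem stateU_oneAction (N : ℕ) (ℓ : Fin 2) (z : Fin M → ℝ) :
    stateU N (oneAction ℓ) (oneBatch z) = 0 := by
  have h : statU (oneAction ℓ) (oneBatch z) = 0 := by
    fin_cases ℓ <;> simp [statU, income, count, oneAction]
  rw [stateU, h, zero_div]

theorem stateT_oneAction (M N : ℕ) (ℓ : Fin 2) :
    stateT M N (oneAction ℓ) = onlyT ℓ ((M : ℝ) / N) := by
  ext i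
  fin_cases ℓ <;> fin_cases i <;> simp [stateT, count, oneAction, onlyT, stepT]

/-- For the flat prior, the first income lies in `[-a, a]` with total mass `2 a`. -/
theorem lintegral_evidence_oneBatch (hM : 0 < M) (a : ℝ) :
    ∫⁻ z in firstIncome hM {ζ | |ζ| ≤ a}, evidence (oneBatch z) = ENNReal.ofReal (2 * a) := by
  have hS : MeasurableSet {ζ : ℝ | |ζ| ≤ a} := measurableSet_le (by fun_prop) (by fun_prop)
  have h1 : ∀ z : Fin M → ℝ, evidence (oneBatch z) = ∫⁻ m, ENNReal.ofReal (batchDensity m z) :=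
    fun z => by simp [evidence, oneBatch]
  simp only [h1]
  rw [lintegral_lintegral_swap (by fun_prop)]
  simp only [setLIntegral_batchDensity _ (measurableSet_firstIncome hM hS),
    batchLaw_firstIncome hM _ hS]
  have h2 := lintegral_gaussianReal_apply univ {ζ : ℝ | |ζ| ≤ a} hS 0
  simp only [add_zero, Measure.restrict_univ, inter_univ] at h2
  rw [h2]
  have h3 : ∀ ξ : ℝ, volume {m : ℝ | m + ξ ∈ {ζ : ℝ | |ζ| ≤ a}} = ENNReal.ofReal (2 * a) := by
    intro ξ
    have : {m : ℝ | m + ξ ∈ {ζ : ℝ | |ζ| ≤ a}} = Icc (-a - ξ) (a - ξ) := by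
      ext m
      simp only [mem_ofPred_eq, abs_le, mem_Icc]
      constructor <;> rintro ⟨_, _⟩ <;> constructor <;> linarith
    rw [this, Real.volume_Icc]
    congr 1; ring
  rw [lintegral_congr h3, lintegral_const, measure_univ, mul_one]

/-- A bound, independent of `a` and of the strategy, for the losses after the first batch on the
event that exactly one of the mean `m` and the first income lies in `[-a, a]`. -/
noncomputable def edgeError (M N : ℕ) (μ : Measure ℝ) (j : ℕ) : ℝ≥0∞ :=
  ∫⁻ w, ENNReal.ofReal (j * (M * (2 * (|w| / √N)))) *
    ∫⁻ ξ, ENNReal.ofReal (2 * (|w| / √N + |ξ|)) ∂gaussianReal 0 1 ∂μ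

theorem abs_scaledParam_sub (N : ℕ) (m w : ℝ) :
    |scaledParam N (m, w) 0 - scaledParam N (m, w) 1| = 2 * (|w| / √N) := by
  have : scaledParam N (m, w) 0 - scaledParam N (m, w) 1 = 2 * (w / √N) := by
    simp [scaledParam, param]; ring
  rw [this, abs_mul, abs_div, abs_of_nonneg (Real.sqrt_nonneg _), abs_two]

theorem exists_scaledParam_eq (N : ℕ) (w : ℝ) (ℓ : Fin 2) :
    ∃ b : ℝ, |b| = |w| / √N ∧ ∀ m, scaledParam N (m, w) ℓ = m + b := by
  fin_cases ℓ
  · refine ⟨w / √N, ?_, fun m => by simp [scaledParam, param]⟩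
    rw [abs_div, abs_of_nonneg (Real.sqrt_nonneg _)]
  · refine ⟨-(w / √N), ?_, fun m => by simp [scaledParam, param, sub_eq_add_neg]⟩
    rw [abs_neg, abs_div, abs_of_nonneg (Real.sqrt_nonneg _)]

/-- The losses are at most proportional to `|w|`, and for each value of the noise the set of means
`m` in question has a length which does not depend on the window. -/
theorem setLIntegral_futureLoss_le_edgeError [SFinite μ] (hM : 0 < M) (σ : Strategy M) (j : ℕ)
    (ℓ : Fin 2) {A S : Set ℝ} (hS : MeasurableSet S)
    (h : ∀ η, volume ({m | m + η ∈ S} ∩ A) ≤ ENNReal.ofReal (2 * |η|)) :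
    ∫⁻ z in firstIncome hM S, futureLoss N ((volume.restrict A).prod μ) σ j 1 (oneAction ℓ)
      (oneBatch z) ≤ edgeError M N μ j := by
  have hm : Measurable fun z : Fin M → ℝ => oneBatch z := by unfold oneBatch; fun_prop
  unfold futureLoss
  rw [lintegral_lintegral_swap (by fun_prop), lintegral_prod_symm', edgeError]
  · refine lintegral_mono fun w => ?_
    obtain ⟨b, hb, hp⟩ := exists_scaledParam_eq N w ℓ
    calc _ ≤ ∫⁻ m in A, ENNReal.ofReal (j * (M * (2 * (|w| / √N)))) *
          gaussianReal (m + b) 1 S := by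
          refine lintegral_mono fun m => ?_
          rw [← hp m, ← batchLaw_firstIncome hM _ hS,
            ← setLIntegral_batchDensity _ (measurableSet_firstIncome hM hS),
            ← lintegral_const_mul' _ _ ENNReal.ofReal_ne_top]
          refine lintegral_mono fun z => ?_
          rw [likelihood_oneAction]
          refine mul_le_mul_left ?_ _
          rw [← abs_scaledParam_sub N m w]
          exact lossE_le σ _ j 1 _ _
      _ = ENNReal.ofReal (j * (M * (2 * (|w| / √N)))) *
            ∫⁻ ξ, volume ({m | m + b + ξ ∈ S} ∩ A) ∂gaussianReal 0 1 := by
          rw [lintegral_const_mul' _ _ ENNReal.ofReal_ne_top,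
            lintegral_gaussianReal_apply _ _ hS]
      _ ≤ _ := by
          refine mul_le_mul_right (lintegral_mono fun ξ => ?_) _
          simp only [add_assoc]
          refine (h (b + ξ)).trans (ENNReal.ofReal_le_ofReal ?_)
          rw [← hb]
          linarith [abs_add_le b ξ]
  · refine Measurable.lintegral_prod_left' (f := fun q : (Fin M → ℝ) × (ℝ × ℝ) =>
      lossE σ (scaledParam N q.2) j 1 (oneAction ℓ) (oneBatch q.1) *
        ENNReal.ofReal (likelihood (oneAction ℓ) (oneBatch q.1) (scaledParam N q.2))) ?_
    fun_prop

/-- Lebesgue measure on `[-a, a]` for `m`, times the law `μ` of `w`. This is the uniform prior up to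
the factor `2 a`. -/
noncomputable def windowPrior (a : ℝ) (μ : Measure ℝ) : Measure (ℝ × ℝ) :=
  (volume.restrict {m : ℝ | |m| ≤ a}).prod μ

theorem measurableSet_abs_le (a : ℝ) : MeasurableSet {m : ℝ | |m| ≤ a} :=
  measurableSet_le (by fun_prop) (by fun_prop)

theorem windowPrior_add [SFinite μ] (a : ℝ) :
    windowPrior a μ + (volume.restrict {m : ℝ | |m| ≤ a}ᶜ).prod μ = volume.prod μ := by
  rw [windowPrior, ← Measure.add_prod, Measure.restrict_add_restrict_compl (measurableSet_abs_le a)]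

instance [SFinite μ] (a : ℝ) : SFinite (windowPrior a μ) := by
  unfold windowPrior; infer_instance

theorem setLIntegral_futureLoss_flat_le [SFinite μ] (hM : 0 < M) (σ : Strategy M) (j : ℕ)
    (ℓ : Fin 2) (a : ℝ) :
    ∫⁻ z in firstIncome hM {ζ | |ζ| ≤ a}, futureLoss N (volume.prod μ) σ j 1 (oneAction ℓ)
      (oneBatch z) ≤
      (∫⁻ z, futureLoss N (windowPrior a μ) σ j 1 (oneAction ℓ) (oneBatch z)) +
        edgeError M N μ j := by
  have hm : Measurable fun z : Fin M → ℝ => oneBatch z := by unfold oneBatch; fun_prop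
  have e : ∀ z : Fin M → ℝ, futureLoss N (volume.prod μ) σ j 1 (oneAction ℓ) (oneBatch z) =
      futureLoss N (windowPrior a μ) σ j 1 (oneAction ℓ) (oneBatch z) +
      futureLoss N ((volume.restrict {m : ℝ | |m| ≤ a}ᶜ).prod μ) σ j 1 (oneAction ℓ)
        (oneBatch z) := fun z => by
    rw [← windowPrior_add a, futureLoss, lintegral_add_measure]; rfl
  simp only [e]
  have hF : Measurable fun z : Fin M → ℝ =>
      futureLoss N (windowPrior a μ) σ j 1 (oneAction ℓ) (oneBatch z) :=
    (measurable_futureLoss N σ j 1 (oneAction ℓ)).comp hm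
  rw [lintegral_add_left hF]
  refine add_le_add (setLIntegral_le_lintegral _ _) ?_
  exact setLIntegral_futureLoss_le_edgeError hM σ j ℓ (measurableSet_abs_le a)
    fun η => volume_enter_le a η

theorem lintegral_futureLoss_windowPrior_le [SFinite μ] (hM : 0 < M) (σ : Strategy M) (j : ℕ)
    (ℓ : Fin 2) (a : ℝ) :
    ∫⁻ z, futureLoss N (windowPrior a μ) σ j 1 (oneAction ℓ) (oneBatch z) ≤
      (∫⁻ z in firstIncome hM {ζ | |ζ| ≤ a}, futureLoss N (volume.prod μ) σ j 1 (oneAction ℓ)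
        (oneBatch z)) + edgeError M N μ j := by
  rw [← lintegral_add_compl _ (measurableSet_firstIncome hM (measurableSet_abs_le a))]
  refine add_le_add (lintegral_mono fun z => ?_) ?_
  · rw [futureLoss, futureLoss, ← windowPrior_add a, lintegral_add_measure]
    exact le_self_add
  · exact setLIntegral_futureLoss_le_edgeError hM σ j ℓ (measurableSet_abs_le a).compl
      fun η => volume_exit_le a η

/-- The limiting normalized risk with `j` batches after the first one: the loss of the first batch,
and the value after it. By symmetry the choice of the first action does not matter. -/
noncomputable def totalValue (ε : ℝ) (μ : Measure ℝ) (j : ℕ) : ℝ≥0∞ :=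
  ENNReal.ofReal ε * ∫⁻ w, ENNReal.ofReal (sideLoss 0 w) ∂μ + value ε μ j 0 (onlyT 0 ε)

theorem value_onlyT_eq [SFinite μ] (hμ : μ.map (fun w => -w) = μ) {ε : ℝ} (hε : 0 < ε)
    (ℓ : Fin 2) (j : ℕ) : value ε μ j 0 (onlyT ℓ ε) = value ε μ j 0 (onlyT 0 ε) := by
  cases j with
  | zero => rfl
  | succ j => rw [value_succ_onlyT_eq hμ hε, value_succ_onlyT_eq hμ hε]

theorem nextLoss_windowPrior [SFinite μ] (hμ : μ.map (fun w => -w) = μ) (hN : 0 < N)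
    {a : ℝ} (y : Fin 0 → Fin 2) (x : Fin 0 → Fin M → ℝ) (ℓ : Fin 2) :
    nextLoss N (windowPrior a μ) y x ℓ = ENNReal.ofReal (2 * a) * (ENNReal.ofReal √N *
      (ENNReal.ofReal ((M : ℝ) / N) * ∫⁻ w, ENNReal.ofReal (sideLoss 0 w) ∂μ)) := by
  have hv : volume {m : ℝ | |m| ≤ a} = ENNReal.ofReal (2 * a) := by
    have : {m : ℝ | |m| ≤ a} = Icc (-a) a := by ext m; simp [abs_le]
    rw [this, Real.volume_Icc]; congr 1; ring
  have h1 : ∀ p : ℝ × ℝ, likelihood y x (scaledParam N p) = 1 := fun p => by simp [likelihood]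
  rw [nextLoss, windowPrior, lintegral_prod_symm' _ (by fun_prop), ← lintegral_sideLoss hμ ℓ,
    ← lintegral_const_mul' _ _ ENNReal.ofReal_ne_top,
    ← lintegral_const_mul' _ _ ENNReal.ofReal_ne_top,
    ← lintegral_const_mul' _ _ ENNReal.ofReal_ne_top]
  refine lintegral_congr fun w => ?_
  simp only [batchLoss_scaledParam hN, h1, ENNReal.ofReal_one, mul_one, lintegral_const,
    Measure.restrict_apply_univ, hv]
  rw [ENNReal.ofReal_mul (by positivity), ENNReal.ofReal_mul (by positivity)]
  ring

theorem futureLoss_windowPrior_eq [SFinite μ] (hμ : μ.map (fun w => -w) = μ) (hN : 0 < N)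
    (σ : Strategy M) (j : ℕ) {a : ℝ} (y : Fin 0 → Fin 2) (x : Fin 0 → Fin M → ℝ) :
    futureLoss N (windowPrior a μ) σ (j + 1) 0 y x =
      ∑ ℓ, ENNReal.ofReal (σ.prob 0 y x ℓ) * (ENNReal.ofReal (2 * a) * (ENNReal.ofReal √N *
        (ENNReal.ofReal ((M : ℝ) / N) * ∫⁻ w, ENNReal.ofReal (sideLoss 0 w) ∂μ)) +
        ∫⁻ z, futureLoss N (windowPrior a μ) σ j 1 (oneAction ℓ) (oneBatch z)) := by
  rw [futureLoss_succ]
  simp only [nextLoss_windowPrior hμ hN, snoc_elim0_action, snoc_elim0_batch]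

/-- Up to an error which does not depend on `a`, no strategy has smaller losses than
`totalValue`. -/
theorem totalValue_le_futureLoss [SFinite μ] (hμ : μ.map (fun w => -w) = μ) (hM : 0 < M)
    (hN : 0 < N) (σ : Strategy M) (j : ℕ) (a : ℝ) (y : Fin 0 → Fin 2) (x : Fin 0 → Fin M → ℝ) :
    ENNReal.ofReal (2 * a) * (ENNReal.ofReal √N * totalValue ((M : ℝ) / N) μ j) ≤
      futureLoss N (windowPrior a μ) σ (j + 1) 0 y x + edgeError M N μ j := by
  have hε : (0 : ℝ) < (M : ℝ) / N := by positivity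
  have key : ∀ ℓ, ENNReal.ofReal (2 * a) * (ENNReal.ofReal √N *
      value ((M : ℝ) / N) μ j 0 (onlyT 0 ((M : ℝ) / N))) ≤
      (∫⁻ z, futureLoss N (windowPrior a μ) σ j 1 (oneAction ℓ) (oneBatch z)) +
        edgeError M N μ j := by
    intro ℓ
    refine le_trans ?_ (setLIntegral_futureLoss_flat_le hM σ j ℓ a)
    rw [← lintegral_evidence_oneBatch hM a, ← value_onlyT_eq hμ hε ℓ]
    rw [← lintegral_mul_const'']
    · refine lintegral_mono fun z => ?_
      have := value_le_futureLoss (μ := μ) hM hN one_pos σ j (oneAction ℓ) (oneBatch z)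
      rwa [stateU_oneAction, stateT_oneAction] at this
    · refine Measurable.aemeasurable ?_
      unfold evidence oneBatch
      exact Measurable.lintegral_prod_right' (f := fun q : (Fin M → ℝ) × ℝ =>
        ENNReal.ofReal (∏ _i : Fin 1, batchDensity q.2 q.1)) (by fun_prop)
  have hp := sum_ofReal_prob σ y x
  rw [futureLoss_windowPrior_eq hμ hN]
  calc _ = ∑ ℓ, ENNReal.ofReal (σ.prob 0 y x ℓ) * (ENNReal.ofReal (2 * a) *
        (ENNReal.ofReal √N * totalValue ((M : ℝ) / N) μ j)) := by
        rw [← Finset.sum_mul, hp, one_mul]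
    _ ≤ ∑ ℓ, ENNReal.ofReal (σ.prob 0 y x ℓ) * (ENNReal.ofReal (2 * a) * (ENNReal.ofReal √N *
        (ENNReal.ofReal ((M : ℝ) / N) * ∫⁻ w, ENNReal.ofReal (sideLoss 0 w) ∂μ)) +
        ((∫⁻ z, futureLoss N (windowPrior a μ) σ j 1 (oneAction ℓ) (oneBatch z)) +
          edgeError M N μ j)) := by
        refine Finset.sum_le_sum fun ℓ _ => mul_le_mul_right ?_ _
        rw [totalValue, mul_add, mul_add]
        exact add_le_add le_rfl (key ℓ)
    _ = _ := by
        simp only [← add_assoc]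
        simp only [mul_add _ _ (edgeError M N μ j), Finset.sum_add_distrib, ← Finset.sum_mul, hp,
          one_mul]

/-- Strategies which apply the actions turn-by-turn to the first two batches and are greedy
afterwards attain `totalValue`, up to an error which does not depend on `a`. -/
theorem futureLoss_le_totalValue [SFinite μ] (hμ : μ.map (fun w => -w) = μ) (hM : 0 < M)
    (hN : 0 < N) (j : ℕ) (h1 : ∀ ℓ (z : Fin M → ℝ), σ.prob 1 (oneAction ℓ) (oneBatch z) ℓ = 0)
    (h2 : IsGreedyFrom N (j + 2) μ 2 σ) (a : ℝ) (y : Fin 0 → Fin 2) (x : Fin 0 → Fin M → ℝ) :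
    futureLoss N (windowPrior a μ) σ (j + 2) 0 y x ≤
      ENNReal.ofReal (2 * a) * (ENNReal.ofReal √N * totalValue ((M : ℝ) / N) μ (j + 1)) +
        edgeError M N μ (j + 1) := by
  have hε : (0 : ℝ) < (M : ℝ) / N := by positivity
  -- for the flat prior there is equality: the second batch uses the other action, which is optimal
  have flat : ∀ ℓ (z : Fin M → ℝ), futureLoss N (volume.prod μ) σ (j + 1) 1 (oneAction ℓ)
      (oneBatch z) = evidence (oneBatch z) * (ENNReal.ofReal √N *
        value ((M : ℝ) / N) μ (j + 1) 0 (onlyT 0 ((M : ℝ) / N))) := by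
    intro ℓ z
    have hp := sum_ofReal_prob σ (oneAction ℓ) (oneBatch z)
    have hsum : ∀ f : Fin 2 → ℝ≥0∞, ∑ ℓ', f ℓ' = f ℓ + f (1 - ℓ) := fun f => by
      fin_cases ℓ <;> simp [add_comm]
    have hB : BothUsed (Fin.snoc (α := fun _ => Fin 2) (oneAction ℓ) (1 - ℓ) : Fin 2 → Fin 2) := by
      intro ℓ'
      rcases eq_or_ne ℓ' ℓ with rfl | h
      · exact ⟨Fin.castSucc 0, by rw [Fin.snoc_castSucc]; rfl⟩
      · exact ⟨Fin.last 1, by rw [Fin.snoc_last]; omega⟩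
    rw [hsum, h1, ENNReal.ofReal_zero, zero_add] at hp
    rw [futureLoss_succ, hsum, h1, hp, ENNReal.ofReal_zero, zero_mul, zero_add, one_mul,
      lintegral_congr fun z' => futureLoss_eq_value hM hN h2 j _ _ le_rfl rfl hB,
      nextLoss_add_lintegral_value hM hN one_pos, stateU_oneAction, stateT_oneAction,
      ← value_succ_onlyT hμ hε ℓ j hε, value_onlyT_eq hμ hε ℓ]
  have key : ∀ ℓ, ∫⁻ z, futureLoss N (windowPrior a μ) σ (j + 1) 1 (oneAction ℓ) (oneBatch z) ≤
      ENNReal.ofReal (2 * a) * (ENNReal.ofReal √N *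
        value ((M : ℝ) / N) μ (j + 1) 0 (onlyT 0 ((M : ℝ) / N))) + edgeError M N μ (j + 1) := by
    intro ℓ
    refine (lintegral_futureLoss_windowPrior_le hM σ (j + 1) ℓ a).trans_eq ?_
    rw [lintegral_congr fun z => flat ℓ z, ← lintegral_evidence_oneBatch hM a,
      lintegral_mul_const'']
    refine Measurable.aemeasurable ?_
    unfold evidence oneBatch
    exact Measurable.lintegral_prod_right' (f := fun q : (Fin M → ℝ) × ℝ =>
      ENNReal.ofReal (∏ _i : Fin 1, batchDensity q.2 q.1)) (by fun_prop)
  rw [futureLoss_windowPrior_eq hμ hN]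
  refine (Finset.sum_le_sum fun ℓ _ => mul_le_mul_right (add_le_add le_rfl (key ℓ)) _).trans_eq ?_
  rw [← Finset.sum_mul, sum_ofReal_prob, one_mul, totalValue]
  ring

end

/-! ### The law of `w` -/

/-- The law of `w`, with the density `ϱ` on `[-c, c]`. -/
noncomputable def weightLaw (c : ℝ) (ϱ : ℝ → ℝ) : Measure ℝ :=
  (volume.restrict (Icc (-c) c)).withDensity fun w => ENNReal.ofReal (ϱ w)

section

variable {c : ℝ} {ϱ : ℝ → ℝ}

/-- A function which is not integrable would have the integral zero by convention. -/
theorem IsSymmDensity.intervalIntegrable (hϱ : IsSymmDensity c ϱ) :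
    IntervalIntegrable ϱ volume (-c) c := by
  by_contra h
  have := hϱ.integral_eq_one
  rw [intervalIntegral.integral_undef h] at this
  exact zero_ne_one this

theorem lintegral_weightLaw (hϱ : IsSymmDensity c ϱ) {f : ℝ → ℝ≥0∞} :
    ∫⁻ w, f w ∂weightLaw c ϱ = ∫⁻ w in Icc (-c) c, ENNReal.ofReal (ϱ w) * f w := by
  rw [weightLaw, lintegral_withDensity_eq_lintegral_mul_non_measurable _
    hϱ.measurable.ennreal_ofReal (ae_of_all _ fun _ => ENNReal.ofReal_lt_top)]
  rfl

theorem lintegral_ofReal_weightLaw (hc : 0 < c) (hϱ : IsSymmDensity c ϱ) {f : ℝ → ℝ}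
    (hf : Continuous f) (h0 : ∀ w, 0 ≤ f w) :
    ∫⁻ w, ENNReal.ofReal (f w) ∂weightLaw c ϱ = ENNReal.ofReal (∫ w in (-c)..c, f w * ϱ w) := by
  have hi : IntervalIntegrable (fun w => f w * ϱ w) volume (-c) c :=
    hϱ.intervalIntegrable.continuousOn_mul hf.continuousOn
  rw [lintegral_weightLaw hϱ, intervalIntegral.integral_of_le (by linarith),
    ← integral_Icc_eq_integral_Ioc, ofReal_integral_eq_lintegral_ofReal]
  · refine lintegral_congr fun w => ?_
    rw [ENNReal.ofReal_mul (h0 w), mul_comm]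
  · exact (intervalIntegrable_iff_integrableOn_Icc_of_le (by linarith)).1 hi
  · exact ae_of_all _ fun w => mul_nonneg (h0 w) (hϱ.nonneg w)

theorem isProbabilityMeasure_weightLaw (hc : 0 < c) (hϱ : IsSymmDensity c ϱ) :
    IsProbabilityMeasure (weightLaw c ϱ) := by
  refine ⟨?_⟩
  have := lintegral_ofReal_weightLaw hc hϱ (f := fun _ => 1) continuous_const
    fun _ => zero_le_one
  simpa [hϱ.integral_eq_one] using this

instance (c : ℝ) (ϱ : ℝ → ℝ) : SFinite (weightLaw c ϱ) := by
  unfold weightLaw; infer_instance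

theorem weightLaw_map_neg (hϱ : IsSymmDensity c ϱ) :
    (weightLaw c ϱ).map (fun w => -w) = weightLaw c ϱ := by
  refine Measure.ext_of_lintegral _ fun f hf => ?_
  rw [lintegral_map hf (by fun_prop), lintegral_weightLaw hϱ, lintegral_weightLaw hϱ,
    ← lintegral_indicator measurableSet_Icc, ← lintegral_indicator measurableSet_Icc,
    ← lintegral_neg_eq_self]
  refine lintegral_congr fun w => ?_
  have h : -w ∈ Icc (-c) c ↔ w ∈ Icc (-c) c := by
    simp only [mem_Icc]; constructor <;> rintro ⟨_, _⟩ <;> constructor <;> linarith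
  by_cases hw : w ∈ Icc (-c) c
  · rw [indicator_of_mem hw, indicator_of_mem (h.2 hw), hϱ.symm, neg_neg]
  · rw [indicator_of_notMem hw, indicator_of_notMem (fun h' => hw (h.1 h'))]

theorem continuous_sideLoss (ℓ : Fin 2) : Continuous (sideLoss ℓ) := by
  unfold sideLoss
  fin_cases ℓ <;> simp <;> fun_prop

/-- The action causes losses only for one sign of `w`; the symmetry of `ϱ` reduces the integral to
positive values of `w`. -/
theorem stageLoss_weightLaw (hc : 0 < c) (hϱ : IsSymmDensity c ϱ) (ℓ : Fin 2) (u : ℝ)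
    (t : Fin 2 → ℝ) :
    stageLoss (weightLaw c ϱ) ℓ u t = ENNReal.ofReal (gFun c ϱ ℓ u (t 0) (t 1)) := by
  set q := t 0 * t 1 / (t 0 + t 1) with hq
  set f : ℝ → ℝ := fun w => sideLoss ℓ w * exp (2 * u * w - 2 * w ^ 2 * q) with hf
  have hfc : Continuous f := (continuous_sideLoss ℓ).mul (by fun_prop)
  have h1 : stageLoss (weightLaw c ϱ) ℓ u t = ENNReal.ofReal (∫ w in (-c)..c, f w * ϱ w) := by
    rw [← lintegral_ofReal_weightLaw hc hϱ hfc
      fun w => mul_nonneg (sideLoss_nonneg ℓ w) (exp_pos _).le]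
    exact lintegral_congr fun w => (ENNReal.ofReal_mul (sideLoss_nonneg ℓ w)).symm
  have hi : ∀ a b, -c ≤ a → b ≤ c → a ≤ b →
      IntervalIntegrable (fun w => f w * ϱ w) volume a b := by
    intro a b h1 h2 h3
    refine (hϱ.intervalIntegrable.mono_set ?_).continuousOn_mul hfc.continuousOn
    rw [uIcc_of_le h3, uIcc_of_le (by linarith)]
    exact Icc_subset_Icc h1 h2
  rw [h1, ← intervalIntegral.integral_add_adjacent_intervals (hi (-c) 0 le_rfl hc.le (by linarith))
    (hi 0 c (by linarith) le_rfl hc.le)]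
  congr 1
  have hneg : ∫ w in (-c)..0, f w * ϱ w = ∫ w in (0 : ℝ)..c, f (-w) * ϱ w := by
    have := intervalIntegral.integral_comp_neg (a := 0) (b := c) fun w => f w * ϱ w
    rw [neg_zero] at this
    rw [← this]
    simp only [hϱ.symm]
  have hcongr : ∀ g h : ℝ → ℝ, (∀ w, 0 ≤ w → g w = h w) →
      ∫ w in (0 : ℝ)..c, g w = ∫ w in (0 : ℝ)..c, h w := fun g h H =>
    intervalIntegral.integral_congr fun w hw => by
      rw [uIcc_of_le hc.le] at hw; exact H w hw.1
  rw [hneg, gFun]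
  have hexp : ∀ w, 2 * w ^ 2 * t 0 * t 1 / (t 0 + t 1) = 2 * w ^ 2 * q := fun w => by
    rw [hq]; ring
  fin_cases ℓ
  · rw [hcongr (fun w => f w * ϱ w) (fun _ => 0) fun w hw => by
      simp [hf, sideLoss, abs_of_nonneg hw], intervalIntegral.integral_zero, add_zero]
    refine hcongr _ _ fun w hw => ?_
    simp only [hf, hexp]
    simp [sideLoss, abs_of_nonneg hw]
    left
    ring_nf
  · rw [hcongr (fun w => f (-w) * ϱ w) (fun _ => 0) fun w hw => by
      simp [hf, sideLoss, abs_of_nonneg hw], intervalIntegral.integral_zero, zero_add]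
    refine hcongr _ _ fun w hw => ?_
    simp only [hf, hexp]
    simp [sideLoss, abs_of_nonneg hw]
    left
    ring_nf

theorem gFun_nonneg (hc : 0 < c) (hϱ : IsSymmDensity c ϱ) (ℓ : Fin 2) (u t₁ t₂ : ℝ) :
    0 ≤ gFun c ϱ ℓ u t₁ t₂ :=
  intervalIntegral.integral_nonneg hc.le fun w hw =>
    mul_nonneg (mul_nonneg (mul_nonneg two_pos.le hw.1) (exp_pos _).le) (hϱ.nonneg w)

/-! ### The recursive equation -/

variable {ε : ℝ}

theorem value_ne_top (hc : 0 < c) (hϱ : IsSymmDensity c ϱ) (hε : 0 < ε) (j : ℕ) :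
    ∃ B : ℝ≥0∞, B ≠ ∞ ∧ ∀ (u : ℝ) (t : Fin 2 → ℝ), (∀ i, 0 ≤ t i) →
      value ε (weightLaw c ϱ) j u t ≤ B := by
  refine ⟨_, ?_, fun u t ht => value_le hε.le j u ht⟩
  rw [lintegral_ofReal_weightLaw hc hϱ (by fun_prop) (fun w => by positivity)]
  finiteness

theorem actionValue_ne_top (hc : 0 < c) (hϱ : IsSymmDensity c ϱ) (hε : 0 < ε) (j : ℕ)
    (ℓ : Fin 2) (u : ℝ) {t : Fin 2 → ℝ} (ht : ∀ i, 0 ≤ t i) :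
    actionValue ε (weightLaw c ϱ) (value ε (weightLaw c ϱ) j) ℓ u t ≠ ∞ := by
  obtain ⟨B, hB, h⟩ := value_ne_top hc hϱ hε j
  rw [actionValue, stageLoss_weightLaw hc hϱ]
  refine ENNReal.add_ne_top.2 ⟨by finiteness, ?_⟩
  refine ne_top_of_le_ne_top hB ((lintegral_mono fun ξ => h _ _ (stepT_nonneg hε.le ht ℓ)).trans ?_)
  simp

/-- The right-hand side of the recursive equation with `j` batches to go; it vanishes at the
horizon. -/
noncomputable def actionStage (ε : ℝ) (μ : Measure ℝ) : ℕ → Fin 2 → ℝ → (Fin 2 → ℝ) → ℝ≥0∞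
  | 0, _, _, _ => 0
  | j + 1, ℓ, u, t => actionValue ε μ (value ε μ j) ℓ u t

theorem value_eq_min (ε : ℝ) (μ : Measure ℝ) (j : ℕ) (u : ℝ) (t : Fin 2 → ℝ) :
    value ε μ j u t = min (actionStage ε μ j 0 u t) (actionStage ε μ j 1 u t) := by
  cases j with
  | zero => simp [value, actionStage]
  | succ j =>
    refine le_antisymm (le_min (iInf_le _ 0) (iInf_le _ 1)) (le_iInf fun ℓ => ?_)
    fin_cases ℓ
    exacts [min_le_left _ _, min_le_right _ _]

theorem actionStage_ne_top (hc : 0 < c) (hϱ : IsSymmDensity c ϱ) (hε : 0 < ε) (j : ℕ)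
    (ℓ : Fin 2) (u : ℝ) {t : Fin 2 → ℝ} (ht : ∀ i, 0 ≤ t i) :
    actionStage ε (weightLaw c ϱ) j ℓ u t ≠ ∞ := by
  cases j with
  | zero => exact ENNReal.zero_ne_top
  | succ j => exact actionValue_ne_top hc hϱ hε j ℓ u ht

theorem measurable_actionStage (j : ℕ) (ℓ : Fin 2) (t : Fin 2 → ℝ) :
    Measurable fun u => actionStage ε (weightLaw c ϱ) j ℓ u t := by
  cases j with
  | zero => exact measurable_const
  | succ j => exact measurable_actionValue (measurable_value j) ℓ t

theorem integrable_mul_gaussDensity {f : ℝ → ℝ≥0∞} (hf : Measurable f) {B : ℝ≥0∞} (hB : B ≠ ∞)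
    (hfB : ∀ x, f x ≤ B) {D : ℝ} (hD : 0 < D) :
    (Integrable fun x => (f x).toReal * gaussDensity D 0 x) ∧
      ∫ x, (f x).toReal * gaussDensity D 0 x =
        (∫⁻ x, f x ∂gaussianReal 0 D.toNNReal).toReal := by
  have hv : D.toNNReal ≠ 0 := (Real.toNNReal_pos.2 hD).ne'
  have hfm : Measurable fun x => (f x).toReal := hf.ennreal_toReal
  have hlt : ∀ x, f x < ∞ := fun x => (hfB x).trans_lt hB.lt_top
  constructor
  · refine Integrable.bdd_mul (c := B.toReal) (integrable_gaussianPDFReal 0 D.toNNReal)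
      hfm.aestronglyMeasurable (ae_of_all _ fun x => ?_)
    rw [Real.norm_of_nonneg ENNReal.toReal_nonneg]
    exact ENNReal.toReal_mono hB (hfB x)
  · rw [← integral_toReal hf.aemeasurable (ae_of_all _ hlt),
      integral_gaussianReal_eq_integral_smul hv]
    refine integral_congr_ae (ae_of_all _ fun x => ?_)
    simp only [smul_eq_mul, gaussDensity, mul_comm]

theorem lintegral_gaussianReal_sub (v : ℝ≥0) (u : ℝ) {f : ℝ → ℝ≥0∞} (hf : Measurable f) :
    ∫⁻ x, f (u - x) ∂gaussianReal 0 v = ∫⁻ x, f (u + x) ∂gaussianReal 0 v := by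
  have h := gaussianReal_map_neg (μ := 0) (v := v)
  rw [neg_zero] at h
  conv_rhs => rw [← h, lintegral_map (by fun_prop) (by fun_prop)]
  simp only [sub_eq_add_neg]

theorem actionValue_toReal (hc : 0 < c) (hϱ : IsSymmDensity c ϱ) (hε : 0 < ε) (j : ℕ)
    (ℓ : Fin 2) (u : ℝ) {t : Fin 2 → ℝ} (ht : ∀ i, 0 < t i) :
    (Integrable fun x => (value ε (weightLaw c ϱ) j (u - x) (stepT ε t ℓ)).toReal *
      gaussDensity (stepVar ε t ℓ) 0 x) ∧
    (actionValue ε (weightLaw c ϱ) (value ε (weightLaw c ϱ) j) ℓ u t).toReal =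
      ε * gFun c ϱ ℓ u (t 0) (t 1) +
        ∫ x, (value ε (weightLaw c ϱ) j (u - x) (stepT ε t ℓ)).toReal *
          gaussDensity (stepVar ε t ℓ) 0 x := by
  obtain ⟨B, hB, h⟩ := value_ne_top hc hϱ hε j
  have hm := measurable_value (ε := ε) (μ := weightLaw c ϱ) j (stepT ε t ℓ)
  have hD : 0 < stepVar ε t ℓ := by
    have h0 := ht 0
    have h1 := ht 1
    have h2 := ht (1 - ℓ)
    unfold stepVar
    positivity
  have hst := stepT_nonneg hε.le (fun i => (ht i).le) ℓ
  obtain ⟨h1, h2⟩ := integrable_mul_gaussDensity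
    (f := fun x => value ε (weightLaw c ϱ) j (u - x) (stepT ε t ℓ)) (hm.comp (by fun_prop)) hB
    (fun x => h _ _ hst) hD
  refine ⟨h1, ?_⟩
  rw [h2, lintegral_gaussianReal_sub _ _ hm, actionValue, stageLoss_weightLaw hc hϱ,
    ENNReal.toReal_add (by finiteness), ENNReal.toReal_mul, ENNReal.toReal_ofReal hε.le,
    ENNReal.toReal_ofReal (gFun_nonneg hc hϱ _ _ _ _)]
  refine ne_top_of_le_ne_top hB ((lintegral_mono fun ξ => h _ _ hst).trans ?_)
  simp

theorem OnGrid.pos (hε : 0 < ε) {t₁ t₂ : ℝ} (h : OnGrid ε t₁ t₂) : 0 < t₁ ∧ 0 < t₂ := by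
  obtain ⟨⟨a, ha, rfl⟩, ⟨b, hb, rfl⟩, -⟩ := h
  have ha' : (0 : ℝ) < a := by exact_mod_cast ha
  have hb' : (0 : ℝ) < b := by exact_mod_cast hb
  exact ⟨by positivity, by positivity⟩

theorem OnGrid.exists_remaining (hε : 0 < ε) {K : ℕ} (hK : K * ε = 1) {t₁ t₂ : ℝ}
    (h : OnGrid ε t₁ t₂) : ∃ j : ℕ, t₁ + t₂ + j * ε = 1 := by
  obtain ⟨⟨a, ha, rfl⟩, ⟨b, hb, rfl⟩, hs⟩ := h
  have h1 : ((a + b : ℕ) : ℝ) * ε ≤ K * ε := by rw [hK]; push_cast; linarith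
  have h2 : a + b ≤ K := by exact_mod_cast le_of_mul_le_mul_right h1 hε
  refine ⟨K - (a + b), ?_⟩
  rw [← hK, Nat.cast_sub h2]
  push_cast
  ring

theorem OnGrid.step (hε : 0 < ε) {t : Fin 2 → ℝ} (h : OnGrid ε (t 0) (t 1)) {j : ℕ}
    (hj : t 0 + t 1 + (j + 1 : ℕ) * ε = 1) (ℓ : Fin 2) :
    OnGrid ε (stepT ε t ℓ 0) (stepT ε t ℓ 1) ∧
      stepT ε t ℓ 0 + stepT ε t ℓ 1 + j * ε = 1 := by
  obtain ⟨⟨a, ha, ha'⟩, ⟨b, hb, hb'⟩, hs⟩ := h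
  push_cast at hj
  have hjε : 0 ≤ j * ε := by positivity
  fin_cases ℓ
  · simp only [stepT, Fin.zero_eta, if_true, one_ne_zero, if_false, add_zero]
    refine ⟨⟨⟨a + 1, by omega, by push_cast; linarith⟩, ⟨b, hb, hb'⟩, by linarith⟩, by linarith⟩
  · simp only [stepT, Fin.mk_one, if_true, zero_ne_one, if_false, add_zero]
    refine ⟨⟨⟨a, ha, ha'⟩, ⟨b + 1, by omega, by push_cast; linarith⟩, by linarith⟩, by linarith⟩

/-- Every solution of the recursive equation is given by the value function. -/
theorem IsSolution.eq_value (hc : 0 < c) (hϱ : IsSymmDensity c ϱ) (hε : 0 < ε)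
    {r : ℝ → ℝ → ℝ → ℝ} {rA : Fin 2 → ℝ → ℝ → ℝ → ℝ} (h : IsSolution ε c ϱ r rA) (j : ℕ) (u : ℝ)
    (t : Fin 2 → ℝ) (ht : OnGrid ε (t 0) (t 1)) (hj : t 0 + t 1 + j * ε = 1) :
    r u (t 0) (t 1) = (value ε (weightLaw c ϱ) j u t).toReal ∧
      ∀ ℓ, rA ℓ u (t 0) (t 1) = (actionStage ε (weightLaw c ϱ) j ℓ u t).toReal := by
  induction j generalizing u t with
  | zero =>
    have hj' : t 0 + t 1 = 1 := by simpa using hj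
    have h0 : ∀ ℓ, rA ℓ u (t 0) (t 1) = 0 := fun ℓ => h.terminal ℓ u _ _ ht hj'
    refine ⟨?_, fun ℓ => by simp [h0, actionStage]⟩
    rw [h.min_eq u _ _ ht, h0, h0]
    simp [value]
  | succ j ih =>
    have hpos : ∀ i, 0 < t i := fun i => by
      obtain ⟨h1, h2⟩ := ht.pos hε
      fin_cases i
      exacts [h1, h2]
    have hlt : t 0 + t 1 < 1 := by
      push_cast at hj
      have : (0 : ℝ) ≤ j * ε := by positivity
      linarith
    have hA : ∀ ℓ, rA ℓ u (t 0) (t 1) =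
        (actionStage ε (weightLaw c ϱ) (j + 1) ℓ u t).toReal := by
      intro ℓ
      rw [actionStage, (actionValue_toReal hc hϱ hε j ℓ u hpos).2]
      obtain ⟨h1, h2⟩ := ht.step hε hj ℓ
      simp only [← fun x => (ih (u - x) _ h1 h2).1]
      fin_cases ℓ
      · simpa [stepT, stepVar] using h.step_fst u _ _ ht hlt
      · simpa [stepT, stepVar] using h.step_snd u _ _ ht hlt
    refine ⟨?_, hA⟩
    rw [h.min_eq u _ _ ht, hA, hA, value_eq_min, ENNReal.toReal_min]
    · exact actionStage_ne_top hc hϱ hε _ _ _ fun i => (hpos i).le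
    · exact actionStage_ne_top hc hϱ hε _ _ _ fun i => (hpos i).le

/-- The number of batches left at the state `(t₁, t₂)`. On the grid the quotient is a natural
number. -/
noncomputable def remaining (ε t₁ t₂ : ℝ) : ℕ := ⌊(1 - (t₁ + t₂)) / ε⌋₊

theorem remaining_eq (hε : 0 < ε) {t₁ t₂ : ℝ} {j : ℕ} (hj : t₁ + t₂ + j * ε = 1) :
    remaining ε t₁ t₂ = j := by
  have : (1 - (t₁ + t₂)) / ε = j := by
    rw [div_eq_iff hε.ne']; linarith
  rw [remaining, this, Nat.floor_natCast]

/-- The value function solves the recursive equation. -/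
theorem isSolution_value (hc : 0 < c) (hϱ : IsSymmDensity c ϱ) (hε : 0 < ε) {K : ℕ}
    (hK : K * ε = 1) :
    IsSolution ε c ϱ
      (fun u t₁ t₂ => (value ε (weightLaw c ϱ) (remaining ε t₁ t₂) u ![t₁, t₂]).toReal)
      (fun ℓ u t₁ t₂ =>
        (actionStage ε (weightLaw c ϱ) (remaining ε t₁ t₂) ℓ u ![t₁, t₂]).toReal) := by
  have hpos : ∀ {t₁ t₂ : ℝ}, OnGrid ε t₁ t₂ → ∀ i, 0 < ![t₁, t₂] i := fun h i => by
    obtain ⟨h1, h2⟩ := h.pos hε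
    fin_cases i
    exacts [h1, h2]
  have hrec : ∀ (ℓ : Fin 2) (u t₁ t₂ : ℝ), OnGrid ε t₁ t₂ → t₁ + t₂ < 1 → ∃ j,
      remaining ε t₁ t₂ = j + 1 ∧ remaining ε (stepT ε ![t₁, t₂] ℓ 0) (stepT ε ![t₁, t₂] ℓ 1) = j := by
    intro ℓ u t₁ t₂ h hlt
    obtain ⟨j, hj⟩ := h.exists_remaining hε hK
    obtain ⟨j, rfl⟩ : ∃ i, j = i + 1 := by
      refine Nat.exists_eq_succ_of_ne_zero fun h0 => ?_
      rw [h0] at hj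
      simp at hj
      linarith
    exact ⟨j, remaining_eq hε hj, remaining_eq hε (OnGrid.step hε (t := ![t₁, t₂]) h hj ℓ).2⟩
  have e0 : ∀ t₁ t₂ : ℝ, stepT ε ![t₁, t₂] 0 = ![t₁ + ε, t₂] := fun t₁ t₂ => by
    ext i; fin_cases i <;> simp [stepT]
  have e1 : ∀ t₁ t₂ : ℝ, stepT ε ![t₁, t₂] 1 = ![t₁, t₂ + ε] := fun t₁ t₂ => by
    ext i; fin_cases i <;> simp [stepT]
  refine ⟨fun u t₁ t₂ h => ?_, fun ℓ u t₁ t₂ h ht => ?_, fun u t₁ t₂ h hlt => ?_,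
    fun u t₁ t₂ h hlt => ?_, fun u t₁ t₂ h hlt => ?_, fun u t₁ t₂ h hlt => ?_⟩
  · rw [value_eq_min, ENNReal.toReal_min]
    · exact actionStage_ne_top hc hϱ hε _ _ _ fun i => (hpos h i).le
    · exact actionStage_ne_top hc hϱ hε _ _ _ fun i => (hpos h i).le
  · have : remaining ε t₁ t₂ = 0 := remaining_eq hε (j := 0) (by simpa using ht)
    simp [this, actionStage]
  all_goals
    first
    | obtain ⟨j, h1, h2⟩ := hrec 0 u t₁ t₂ h hlt
      have := actionValue_toReal hc hϱ hε j 0 u (hpos h)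
      rw [e0] at h2 this
      simp only [Matrix.cons_val_zero, Matrix.cons_val_one] at h2 this
      simp only [h1, h2, actionStage]
      first
      | exact this.1
      | exact this.2
    | obtain ⟨j, h1, h2⟩ := hrec 1 u t₁ t₂ h hlt
      have := actionValue_toReal hc hϱ hε j 1 u (hpos h)
      rw [e1] at h2 this
      simp only [Matrix.cons_val_zero, Matrix.cons_val_one] at h2 this
      simp only [h1, h2, actionStage]
      first
      | exact this.1
      | exact this.2

end

/-! ### Averages with respect to the prior densities -/

section

variable {M N k : ℕ} {c : ℝ} {ϱ : ℝ → ℝ}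

theorem lintegral_unscale (hN : 0 < N) (hϱ : IsSymmDensity c ϱ) (F : ℝ → ℝ≥0∞) :
    ∫⁻ v in Icc (-(c / √N)) (c / √N), F v * ENNReal.ofReal (unscale N ϱ v) =
      ∫⁻ w, F (w / √N) ∂weightLaw c ϱ := by
  have hs : (0 : ℝ) < √N := Real.sqrt_pos.2 (by exact_mod_cast hN)
  rw [lintegral_weightLaw hϱ, ← lintegral_indicator measurableSet_Icc,
    ← lintegral_indicator measurableSet_Icc]
  have hmap : ∀ G : ℝ → ℝ≥0∞, ∫⁻ w, G w ∂Measure.map (√N * ·) volume = ∫⁻ v, G (√N * v) :=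
    fun G => (Homeomorph.mulLeft₀ (√N : ℝ) hs.ne').measurableEmbedding.lintegral_map G
  conv_rhs => rw [← Real.smul_map_volume_mul_left hs.ne', lintegral_smul_measure, hmap,
    abs_of_pos hs]
  rw [smul_eq_mul, ← lintegral_const_mul' _ _ ENNReal.ofReal_ne_top]
  refine lintegral_congr fun v => ?_
  have hiff : √N * v ∈ Icc (-c) c ↔ v ∈ Icc (-(c / √N)) (c / √N) := by
    rw [mem_Icc, mem_Icc, ← neg_div, div_le_iff₀' hs, le_div_iff₀' hs]
  by_cases hv : v ∈ Icc (-(c / √N)) (c / √N)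
  · rw [indicator_of_mem hv, indicator_of_mem (hiff.2 hv), unscale, ENNReal.ofReal_mul hs.le,
      mul_div_cancel_left₀ _ hs.ne']
    ring
  · rw [indicator_of_notMem hv, indicator_of_notMem (fun h => hv (hiff.1 h)), mul_zero]

theorem unscale_nonneg (N : ℕ) (hϱ : IsSymmDensity c ϱ) (v : ℝ) : 0 ≤ unscale N ϱ v :=
  mul_nonneg (Real.sqrt_nonneg _) (hϱ.nonneg _)

theorem measurable_unscale (N : ℕ) (hϱ : IsSymmDensity c ϱ) : Measurable (unscale N ϱ) :=
  (hϱ.measurable.comp (measurable_const_mul _)).const_mul _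

/-- Integrals over the set of parameters against the density of `v`, in the coordinates
`(m, w)`. -/
theorem integral_paramSet (hN : 0 < N) (hϱ : IsSymmDensity c ϱ) {H : ℝ × ℝ → ℝ}
    (hH : Measurable H) (h0 : ∀ p, 0 ≤ H p) :
    ∫ p in paramSet (c / √N), H p * unscale N ϱ p.2 =
      (∫⁻ p, ENNReal.ofReal (H (p.1, p.2 / √N)) ∂volume.prod (weightLaw c ϱ)).toReal := by
  have hset : paramSet (c / √N) = univ ×ˢ Icc (-(c / √N)) (c / √N) := by
    ext p; simp [paramSet, abs_le]
  have hm := measurable_unscale N hϱ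
  rw [integral_eq_lintegral_of_nonneg_ae
    (ae_of_all _ fun p => mul_nonneg (h0 p) (unscale_nonneg N hϱ p.2))
    (by fun_prop : Measurable fun p : ℝ × ℝ => H p * unscale N ϱ p.2).aestronglyMeasurable,
    hset, Measure.volume_eq_prod, ← Measure.prod_restrict, Measure.restrict_univ,
    lintegral_prod _ (by fun_prop), lintegral_prod _ (by fun_prop)]
  congr 1
  refine lintegral_congr fun m => ?_
  rw [← lintegral_unscale hN hϱ fun v => ENNReal.ofReal (H (m, v))]
  refine lintegral_congr fun v => ?_
  rw [ENNReal.ofReal_mul (h0 _)]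

theorem measurable_lossToGo_param (σ : Strategy M) (j k : ℕ) (y : Fin k → Fin 2)
    (x : Fin k → Fin M → ℝ) : Measurable fun p => lossToGo σ (param p) j k y x := by
  have h := (measurable_lossToGo σ j k y).comp (measurable_param.prodMk (measurable_const (a := x)))
  simpa only [Function.comp_def] using h

theorem measurable_likelihood_param (y : Fin k → Fin 2) (x : Fin k → Fin M → ℝ) :
    Measurable fun p => likelihood y x (param p) := by
  have h := (measurable_likelihood y).comp (measurable_param.prodMk (measurable_const (a := x)))
  simpa only [Function.comp_def] using h

theorem averageLoss_eq (hN : 0 < N) (hϱ : IsSymmDensity c ϱ) (K : ℕ) (a : ℝ)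
    (σ : Strategy M) :
    averageLoss K (c / √N) (uniformPrior a (unscale N ϱ)) σ =
      (futureLoss N (windowPrior a (weightLaw c ϱ)) σ K 0 Fin.elim0 Fin.elim0).toReal /
        (2 * a) := by
  have hA : {m : ℝ | |m| ≤ a} = Icc (-a) a := by ext m; simp [abs_le]
  set H : ℝ × ℝ → ℝ := fun p => lossToGo σ (param p) K 0 Fin.elim0 Fin.elim0 *
    (Icc (-a) a).indicator (fun _ => (1 : ℝ)) p.1 with hH
  have hHm : Measurable H := (measurable_lossToGo_param σ K 0 _ _).mul
    ((measurable_const.indicator measurableSet_Icc).comp measurable_fst)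
  have hH0 : ∀ p, 0 ≤ H p := fun p =>
    mul_nonneg (lossToGo_mem σ _ K 0 _ _).1 (indicator_nonneg (fun _ _ => zero_le_one) _)
  have e : ∀ p : ℝ × ℝ, loss K σ (param p) * uniformPrior a (unscale N ϱ) p =
      H p * unscale N ϱ p.2 / (2 * a) := fun p => by
    simp only [hH, uniformPrior, loss]
    by_cases hp : p.1 ∈ Icc (-a) a
    · simp only [indicator_of_mem hp]; ring
    · simp only [indicator_of_notMem hp]; ring
  rw [averageLoss, integral_congr_ae (ae_of_all _ e), integral_div, integral_paramSet hN hϱ hHm hH0]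
  congr 2
  rw [futureLoss, windowPrior, hA, lintegral_prod _ (by fun_prop), lintegral_prod _ (by fun_prop),
    ← lintegral_indicator measurableSet_Icc]
  refine lintegral_congr fun m => ?_
  by_cases hm : m ∈ Icc (-a) a
  · rw [indicator_of_mem hm]
    refine lintegral_congr fun w => ?_
    simp only [hH, indicator_of_mem hm, mul_one, likelihood, Finset.univ_eq_empty,
      Finset.prod_empty, ENNReal.ofReal_one]
    rfl
  · rw [indicator_of_notMem hm]
    simp [hH, indicator_of_notMem hm]

/-- The normalizing constant of the posterior distribution, for the flat prior. -/
noncomputable def posteriorMass (N : ℕ) (μ : Measure ℝ) (y : Fin k → Fin 2)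
    (x : Fin k → Fin M → ℝ) : ℝ≥0∞ :=
  ∫⁻ p, ENNReal.ofReal (likelihood y x (scaledParam N p)) ∂volume.prod μ

theorem integral_posterior_eq (hN : 0 < N) (hϱ : IsSymmDensity c ϱ) (σ : Strategy M) (j : ℕ)
    (y : Fin k → Fin 2) (x : Fin k → Fin M → ℝ) :
    ∫ p in paramSet (c / √N), lossToGo σ (param p) j k y x *
        posterior (c / √N) (flatPrior (unscale N ϱ)) y x p =
      (futureLoss N (volume.prod (weightLaw c ϱ)) σ j k y x).toReal /
        (posteriorMass N (weightLaw c ϱ) y x).toReal := by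
  have hZ := integral_paramSet hN hϱ (measurable_likelihood_param y x)
    (fun p => (likelihood_pos y x (param p)).le)
  have hF := integral_paramSet hN hϱ
    ((measurable_lossToGo_param σ j k y x).mul (measurable_likelihood_param y x))
    (fun p => mul_nonneg (lossToGo_mem σ _ j k y x).1 (likelihood_pos y x (param p)).le)
  have e : ∀ p : ℝ × ℝ, lossToGo σ (param p) j k y x *
      posterior (c / √N) (flatPrior (unscale N ϱ)) y x p =
      lossToGo σ (param p) j k y x * likelihood y x (param p) * unscale N ϱ p.2 /
        (∫ q in paramSet (c / √N), likelihood y x (param q) * unscale N ϱ q.2) := fun p => by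
    simp only [posterior, flatPrior]; ring
  rw [integral_congr_ae (ae_of_all _ e), integral_div, hZ]
  refine congrArg₂ _ (hF.trans ?_) rfl
  refine congrArg _ (lintegral_congr fun p => ?_)
  exact ENNReal.ofReal_mul (lossToGo_mem σ _ j k y x).1

theorem lintegral_weightLaw_ne_top (hc : 0 < c) (hϱ : IsSymmDensity c ϱ) {f : ℝ → ℝ}
    (hf : Continuous f) (h0 : ∀ w, 0 ≤ f w) :
    ∫⁻ w, ENNReal.ofReal (f w) ∂weightLaw c ϱ ≠ ∞ := by
  rw [lintegral_ofReal_weightLaw hc hϱ hf h0]; finiteness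

theorem posteriorMass_eq (hM : 0 < M) (hk : 0 < k) (μ : Measure ℝ) [SFinite μ]
    (y : Fin k → Fin 2) (x : Fin k → Fin M → ℝ) :
    posteriorMass N μ y x = evidence x * ∫⁻ w, ENNReal.ofReal (exp (2 * (w / √N) * statU y x -
      2 * (w / √N) ^ 2 * (count M y 0 * count M y 1 / ((count M y 0 : ℝ) + count M y 1)))) ∂μ := by
  rw [posteriorMass, lintegral_prod_symm' _ (by fun_prop),
    ← lintegral_const_mul' _ _ (evidence_ne_top hM hk x)]
  exact lintegral_congr fun w =>
    lintegral_likelihood y x (count_add_count_pos hM hk y) (w / √N)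

theorem posteriorMass_pos (hM : 0 < M) (hk : 0 < k) (hc : 0 < c) (hϱ : IsSymmDensity c ϱ)
    (y : Fin k → Fin 2) (x : Fin k → Fin M → ℝ) :
    0 < (posteriorMass N (weightLaw c ϱ) y x).toReal := by
  have := isProbabilityMeasure_weightLaw hc hϱ
  rw [posteriorMass_eq hM hk, ENNReal.toReal_mul]
  refine mul_pos (ENNReal.toReal_pos (evidence_ne_zero hM hk x) (evidence_ne_top hM hk x))
    (ENNReal.toReal_pos ?_ (lintegral_weightLaw_ne_top hc hϱ (by fun_prop)
      fun w => (exp_pos _).le))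
  refine ((lintegral_pos_iff_support (by fun_prop)).2 ?_).ne'
  have : (Function.support fun w : ℝ => ENNReal.ofReal (exp (2 * (w / √N) * statU y x -
      2 * (w / √N) ^ 2 * (count M y 0 * count M y 1 / ((count M y 0 : ℝ) + count M y 1))))) =
      univ := eq_univ_of_forall fun w => (ENNReal.ofReal_pos.2 (exp_pos _)).ne'
  rw [this, measure_univ]
  exact one_pos

theorem futureLoss_le (ν : Measure (ℝ × ℝ)) (σ : Strategy M) (j : ℕ) (y : Fin k → Fin 2)
    (x : Fin k → Fin M → ℝ) :
    futureLoss N ν σ j k y x ≤ ∫⁻ p, ENNReal.ofReal (j * (M * (2 * (|p.2| / √N)))) *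
      ENNReal.ofReal (likelihood y x (scaledParam N p)) ∂ν := by
  refine lintegral_mono fun p => mul_le_mul_left ?_ _
  rw [← abs_scaledParam_sub N p.1 p.2]
  exact lossE_le σ _ j k y x

theorem futureLoss_flat_ne_top (hM : 0 < M) (hk : 0 < k) (hc : 0 < c) (hϱ : IsSymmDensity c ϱ)
    (σ : Strategy M) (j : ℕ) (y : Fin k → Fin 2) (x : Fin k → Fin M → ℝ) :
    futureLoss N (volume.prod (weightLaw c ϱ)) σ j k y x ≠ ∞ := by
  refine ne_top_of_le_ne_top ?_ (futureLoss_le _ σ j y x)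
  rw [lintegral_prod_symm' _ (by fun_prop)]
  have e : ∀ w : ℝ, ∫⁻ m : ℝ, ENNReal.ofReal (j * (M * (2 * (|w| / √N)))) *
      ENNReal.ofReal (likelihood y x (scaledParam N (m, w))) =
      evidence x * ENNReal.ofReal (j * (M * (2 * (|w| / √N))) * exp (2 * (w / √N) * statU y x -
        2 * (w / √N) ^ 2 *
          (count M y 0 * count M y 1 / ((count M y 0 : ℝ) + count M y 1)))) := fun w => by
    rw [lintegral_const_mul' _ _ ENNReal.ofReal_ne_top,
      ENNReal.ofReal_mul (p := j * (M * (2 * (|w| / √N)))) (by positivity)]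
    refine (congrArg _ (lintegral_likelihood y x (count_add_count_pos hM hk y) (w / √N))).trans ?_
    rw [mul_left_comm]
  simp only [e]
  rw [lintegral_const_mul' _ _ (evidence_ne_top hM hk x)]
  exact ENNReal.mul_ne_top (evidence_ne_top hM hk x)
    (lintegral_weightLaw_ne_top hc hϱ (by fun_prop) fun w => by positivity)

theorem futureLoss_windowPrior_ne_top (hc : 0 < c) (hϱ : IsSymmDensity c ϱ)
    (σ : Strategy M) (j : ℕ) (a : ℝ) (y : Fin 0 → Fin 2) (x : Fin 0 → Fin M → ℝ) :
    futureLoss N (windowPrior a (weightLaw c ϱ)) σ j 0 y x ≠ ∞ := by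
  refine ne_top_of_le_ne_top ?_ (futureLoss_le _ σ j y x)
  have h1 : ∀ p : ℝ × ℝ, likelihood y x (scaledParam N p) = 1 := fun p => by simp [likelihood]
  have hA : {m : ℝ | |m| ≤ a} = Icc (-a) a := by ext m; simp [abs_le]
  simp only [h1, ENNReal.ofReal_one, mul_one]
  rw [windowPrior, hA, lintegral_prod _ (by fun_prop)]
  dsimp only
  rw [lintegral_const]
  exact ENNReal.mul_ne_top (lintegral_weightLaw_ne_top hc hϱ (by fun_prop)
    fun w => by positivity) (by simp)

theorem edgeError_ne_top (hc : 0 < c) (hϱ : IsSymmDensity c ϱ) (j : ℕ) :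
    edgeError M N (weightLaw c ϱ) j ≠ ∞ := by
  have hξ : Integrable (fun ξ : ℝ => |ξ|) (gaussianReal 0 1) :=
    (memLp_one_iff_integrable.1 (memLp_id_gaussianReal (μ := 0) (v := 1) 1)).abs
  have e : ∀ w : ℝ, ∫⁻ ξ, ENNReal.ofReal (2 * (|w| / √N + |ξ|)) ∂gaussianReal 0 1 =
      ENNReal.ofReal (2 * (|w| / √N + ∫ ξ, |ξ| ∂gaussianReal 0 1)) := fun w => by
    have hi : Integrable (fun ξ : ℝ => 2 * (|w| / √N + |ξ|)) (gaussianReal 0 1) :=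
      ((integrable_const _).add hξ).const_mul 2
    rw [← ofReal_integral_eq_lintegral_ofReal hi
      (ae_of_all _ fun ξ => by positivity), integral_const_mul,
      integral_add (integrable_const _) hξ]
    simp
  have hpos : 0 ≤ ∫ ξ, |ξ| ∂gaussianReal 0 1 := integral_nonneg fun ξ => abs_nonneg ξ
  have e2 : ∀ w : ℝ, ENNReal.ofReal (j * (M * (2 * (|w| / √N)))) *
      ENNReal.ofReal (2 * (|w| / √N + ∫ ξ, |ξ| ∂gaussianReal 0 1)) =
      ENNReal.ofReal (j * (M * (2 * (|w| / √N))) *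
        (2 * (|w| / √N + ∫ ξ, |ξ| ∂gaussianReal 0 1))) := fun w =>
    (ENNReal.ofReal_mul (by positivity)).symm
  simp only [edgeError, e, e2]
  exact lintegral_weightLaw_ne_top hc hϱ (by fun_prop) fun w => by positivity

end

/-! ### Optimal strategies -/

section

variable {M N K k : ℕ} {c : ℝ} {ϱ : ℝ → ℝ} {r : ℝ → ℝ → ℝ → ℝ} {rA : Fin 2 → ℝ → ℝ → ℝ → ℝ}

theorem measurable_stateU (N : ℕ) (y : Fin k → Fin 2) :
    Measurable fun x : Fin k → Fin M → ℝ => stateU N y x := by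
  unfold stateU statU income
  fun_prop

/-- The strategy which applies the actions turn-by-turn to the first two batches, and afterwards
minimizes the right-hand side of the recursive equation, with ties broken in favour of the first
action. -/
noncomputable def greedyStrategy (M N K : ℕ) (c : ℝ) (ϱ : ℝ → ℝ) : Strategy M where
  prob k y x ℓ :=
    if h : k = 1 then (if y ⟨0, h ▸ one_pos⟩ = ℓ then 0 else 1)
    else if actionStage ((M : ℝ) / N) (weightLaw c ϱ) (K - k) 0 (stateU N y x) (stateT M N y) ≤
        actionStage ((M : ℝ) / N) (weightLaw c ϱ) (K - k) 1 (stateU N y x) (stateT M N y)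
      then (if ℓ = 0 then 1 else 0) else (if ℓ = 1 then 1 else 0)
  prob_nonneg k y x ℓ := by split_ifs <;> simp
  prob_sum k y x := by
    rw [Fin.sum_univ_two]
    split_ifs with h h1 h2 h3 <;> simp_all
    omega
  prob_measurable k y ℓ := by
    by_cases h : k = 1
    · simp only [h, dif_pos]
      exact measurable_const
    · simp only [h, dif_neg, not_false_eq_true]
      have hm : ∀ ℓ, Measurable fun x : Fin k → Fin M → ℝ =>
          actionStage ((M : ℝ) / N) (weightLaw c ϱ) (K - k) ℓ (stateU N y x) (stateT M N y) :=
        fun ℓ => (measurable_actionStage _ ℓ _).comp (measurable_stateU N y)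
      exact Measurable.ite (measurableSet_le (hm 0) (hm 1)) measurable_const measurable_const

/-- The strategy which applies the action `ℓ` after every history of `k` batches and agrees with `σ`
otherwise. -/
noncomputable def Strategy.force (σ : Strategy M) (k : ℕ) (ℓ : Fin 2) : Strategy M where
  prob k' y x ℓ' := if k' = k then (if ℓ' = ℓ then 1 else 0) else σ.prob k' y x ℓ'
  prob_nonneg k' y x ℓ' := by
    split_ifs
    exacts [zero_le_one, le_rfl, σ.prob_nonneg k' y x ℓ']
  prob_sum k' y x := by
    split_ifs
    · simp
    · exact σ.prob_sum k' y x
  prob_measurable k' y ℓ' := by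
    split_ifs
    exacts [measurable_const, measurable_const, σ.prob_measurable k' y ℓ']

theorem stateT_onGrid (hM : 0 < M) (hK : (K : ℝ) * ((M : ℝ) / N) = 1) {y : Fin k → Fin 2}
    (hy : BothUsed y) (hk : k ≤ K) :
    OnGrid ((M : ℝ) / N) (stateT M N y 0) (stateT M N y 1) := by
  have hpos : ∀ ℓ, ∃ n : ℕ, 1 ≤ n ∧ stateT M N y ℓ = n * ((M : ℝ) / N) := by
    intro ℓ
    obtain ⟨i, hi⟩ := hy ℓ
    refine ⟨(Finset.univ.filter fun i => y i = ℓ).card,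
      Finset.card_pos.2 ⟨i, Finset.mem_filter.2 ⟨Finset.mem_univ i, hi⟩⟩, ?_⟩
    rw [stateT, count]
    push_cast
    ring
  refine ⟨hpos 0, hpos 1, ?_⟩
  rw [stateT_add, ← hK]
  exact mul_le_mul_of_nonneg_right (by exact_mod_cast hk) (by positivity)

theorem scaledValue_eq (hM : 0 < M) (hN : 0 < N) (hc : 0 < c) (hϱ : IsSymmDensity c ϱ)
    (hK : (K : ℝ) * ((M : ℝ) / N) = 1) (h : IsSolution ((M : ℝ) / N) c ϱ r rA)
    {y : Fin k → Fin 2} (hy : BothUsed y) (x : Fin k → Fin M → ℝ) {j : ℕ} (hj : j + k = K)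
    (ℓ : Fin 2) :
    scaledValue N rA y x ℓ =
      (actionStage ((M : ℝ) / N) (weightLaw c ϱ) j ℓ (stateU N y x) (stateT M N y)).toReal := by
  refine (h.eq_value hc hϱ (by positivity) j (stateU N y x) (stateT M N y)
    (stateT_onGrid hM hK hy (by omega)) ?_).2 ℓ
  rw [stateT_add, ← add_mul, ← hK, ← hj]
  push_cast
  ring

theorem scaledValue_le_iff (hM : 0 < M) (hN : 0 < N) (hc : 0 < c) (hϱ : IsSymmDensity c ϱ)
    (hK : (K : ℝ) * ((M : ℝ) / N) = 1) (h : IsSolution ((M : ℝ) / N) c ϱ r rA)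
    {y : Fin k → Fin 2} (hy : BothUsed y) (x : Fin k → Fin M → ℝ) {j : ℕ} (hj : j + k = K)
    (ℓ ℓ' : Fin 2) :
    scaledValue N rA y x ℓ ≤ scaledValue N rA y x ℓ' ↔
      actionStage ((M : ℝ) / N) (weightLaw c ϱ) j ℓ (stateU N y x) (stateT M N y) ≤
        actionStage ((M : ℝ) / N) (weightLaw c ϱ) j ℓ' (stateU N y x) (stateT M N y) := by
  rw [scaledValue_eq hM hN hc hϱ hK h hy x hj, scaledValue_eq hM hN hc hϱ hK h hy x hj]
  exact ENNReal.toReal_le_toReal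
    (actionStage_ne_top hc hϱ (by positivity) _ _ _ (stateT_nonneg N y))
    (actionStage_ne_top hc hϱ (by positivity) _ _ _ (stateT_nonneg N y))

theorem batch_le_of_lt (hNK : N = M * K) (hk : k * M < N) : k < K := by
  rw [hNK, mul_comm] at hk
  exact lt_of_mul_lt_mul_left hk (Nat.zero_le M)

theorem followsRecursion_greedyStrategy (hM : 0 < M) (hN : 0 < N) (hc : 0 < c)
    (hϱ : IsSymmDensity c ϱ) (hNK : N = M * K) (hK : (K : ℝ) * ((M : ℝ) / N) = 1)
    (h : IsSolution ((M : ℝ) / N) c ϱ r rA) :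
    FollowsRecursion N rA (greedyStrategy M N K c ϱ) := by
  refine ⟨fun y x => by simp [greedyStrategy], fun k y x hk hkN hy ℓ ℓ' hlt => ?_⟩
  have hkK : k < K := batch_le_of_lt hNK hkN
  have hlt' := mt (scaledValue_le_iff hM hN hc hϱ hK h hy x (Nat.sub_add_cancel hkK.le) ℓ ℓ').2
    (not_le.2 hlt)
  simp only [greedyStrategy, dif_neg (show ¬ k = 1 by omega)]
  split_ifs with h1 h2 h3
  · subst h2
    refine absurd ?_ hlt'
    fin_cases ℓ'
    exacts [le_rfl, h1]
  · rfl
  · subst h3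
    refine absurd ?_ hlt'
    fin_cases ℓ'
    exacts [(not_le.1 h1).le, le_rfl]
  · rfl

theorem FollowsRecursion.isGreedyFrom (hM : 0 < M) (hN : 0 < N) (hc : 0 < c)
    (hϱ : IsSymmDensity c ϱ) (hNK : N = M * K) (hK : (K : ℝ) * ((M : ℝ) / N) = 1)
    (h : IsSolution ((M : ℝ) / N) c ϱ r rA) {σ : Strategy M} (hσ : FollowsRecursion N rA σ) :
    IsGreedyFrom N K (weightLaw c ϱ) 2 σ := by
  intro j k y x hk hjk hy ℓ hp
  refine le_antisymm (le_iInf fun ℓ' => ?_) (value_succ_le _ _ _ _)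
  refine (scaledValue_le_iff hM hN hc hϱ hK h hy x hjk ℓ ℓ').1 ?_
  by_contra hlt
  refine hp (hσ.2 k y x hk ?_ hy ℓ ℓ' (not_le.1 hlt))
  rw [hNK, mul_comm k]
  exact Nat.mul_lt_mul_of_pos_left (by omega) hM

/-- The risk of an action under the posterior is proportional to the right-hand side of the
recursive equation. -/
theorem actionRisk_eq (hM : 0 < M) (hN : 0 < N) (hc : 0 < c) (hϱ : IsSymmDensity c ϱ)
    (hNK : N = M * K) (hK : (K : ℝ) * ((M : ℝ) / N) = 1) {y : Fin k → Fin 2} (hy : BothUsed y)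
    (x : Fin k → Fin M → ℝ) {j : ℕ} (hj : j + 1 + k = K) (ℓ : Fin 2) :
    actionRisk K (c / √N) (flatPrior (unscale N ϱ)) y x ℓ =
      (evidence x * (ENNReal.ofReal √N * actionStage ((M : ℝ) / N) (weightLaw c ϱ) (j + 1) ℓ
        (stateU N y x) (stateT M N y))).toReal /
        (posteriorMass N (weightLaw c ϱ) y x).toReal := by
  have hk := hy.pos
  have hZ := (posteriorMass_pos (N := N) hM hk hc hϱ y x).le
  set μ := weightLaw c ϱ with hμ
  have hstep : ∀ σ : Strategy M, σ.prob k y x ℓ = 1 → futureLoss N (volume.prod μ) σ (j + 1) k y x =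
      nextLoss N (volume.prod μ) y x ℓ + ∫⁻ z, futureLoss N (volume.prod μ) σ j (k + 1)
        (Fin.snoc (α := fun _ => Fin 2) y ℓ) (Fin.snoc (α := fun _ => Fin M → ℝ) x z) := by
    intro σ h1
    have hs := σ.prob_sum k y x
    have hsum : ∀ {A : Type} [AddCommMonoid A] (f : Fin 2 → A), ∑ ℓ', f ℓ' = f ℓ + f (1 - ℓ) :=
      fun f => by fin_cases ℓ <;> simp [add_comm]
    rw [hsum, h1] at hs
    rw [futureLoss_succ, hsum, h1, show σ.prob k y x (1 - ℓ) = 0 by linarith]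
    simp
  obtain ⟨r, rA, hsol⟩ : ∃ r rA, IsSolution ((M : ℝ) / N) c ϱ r rA :=
    ⟨_, _, isSolution_value hc hϱ (by positivity) hK⟩
  -- this strategy attains the infimum: it applies `ℓ` now and is greedy afterwards
  set τ := (greedyStrategy M N K c ϱ).force k ℓ with hτ
  have hτ1 : τ.prob k y x ℓ = 1 := by simp [hτ, Strategy.force]
  have hτg : IsGreedyFrom N K μ (k + 1) τ := by
    intro j' k' y' x' hk' hj' hy' ℓ' hp
    have hk2 : 2 ≤ k' := by omega
    refine (followsRecursion_greedyStrategy hM hN hc hϱ hNK hK hsol).isGreedyFrom hM hN hc hϱ hNK hK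
      hsol j' k' y' x' hk2 hj' hy' ℓ' ?_
    simpa [hτ, Strategy.force, show k' ≠ k by omega] using hp
  unfold actionRisk
  rw [show K - k = j + 1 by omega]
  refine le_antisymm ?_ ?_
  · refine (ciInf_le ⟨0, ?_⟩ ⟨τ, hτ1⟩).trans_eq ?_
    · rintro _ ⟨σ, rfl⟩
      beta_reduce
      rw [integral_posterior_eq hN hϱ]
      exact div_nonneg ENNReal.toReal_nonneg ENNReal.toReal_nonneg
    · rw [integral_posterior_eq hN hϱ, hstep τ hτ1, actionStage,
        ← nextLoss_add_lintegral_value hM hN hk]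
      congr 3
      exact lintegral_congr fun z =>
        futureLoss_eq_value hM hN hτg j _ _ le_rfl (by omega) (hy.snoc ℓ)
  · have : Nonempty {σ : Strategy M // σ.prob k y x ℓ = 1} := ⟨⟨τ, hτ1⟩⟩
    refine le_ciInf fun σ => ?_
    rw [integral_posterior_eq hN hϱ]
    refine div_le_div_of_nonneg_right (ENNReal.toReal_mono
      (futureLoss_flat_ne_top hM hk hc hϱ σ.1 (j + 1) y x) ?_) hZ
    rw [hstep σ.1 σ.2, actionStage, ← nextLoss_add_lintegral_value hM hN hk]
    exact add_le_add le_rfl (lintegral_mono fun z =>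
      value_le_futureLoss hM hN (Nat.succ_pos k) σ.1 j _ _)

theorem isCurrentlyOptimal_iff (hM : 0 < M) (hN : 0 < N) (hc : 0 < c) (hϱ : IsSymmDensity c ϱ)
    (hNK : N = M * K) (hK : (K : ℝ) * ((M : ℝ) / N) = 1)
    (h : IsSolution ((M : ℝ) / N) c ϱ r rA) {y : Fin k → Fin 2} (hy : BothUsed y)
    (x : Fin k → Fin M → ℝ) (hk : k * M < N) (ℓ : Fin 2) :
    IsCurrentlyOptimal K (c / √N) (flatPrior (unscale N ϱ)) y x ℓ ↔
      ∀ ℓ', scaledValue N rA y x ℓ ≤ scaledValue N rA y x ℓ' := by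
  obtain ⟨j, hj⟩ : ∃ j, j + 1 + k = K :=
    ⟨K - k - 1, by have := batch_le_of_lt hNK hk; omega⟩
  have hs : (0 : ℝ) < √N := Real.sqrt_pos.2 (by exact_mod_cast hN)
  refine forall_congr' fun ℓ' => ?_
  rw [actionRisk_eq hM hN hc hϱ hNK hK hy x hj, actionRisk_eq hM hN hc hϱ hNK hK hy x hj,
    div_le_div_iff_of_pos_right (posteriorMass_pos hM hy.pos hc hϱ y x),
    scaledValue_eq hM hN hc hϱ hK h hy x hj, scaledValue_eq hM hN hc hϱ hK h hy x hj]
  simp only [ENNReal.toReal_mul]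
  rw [mul_le_mul_iff_right₀ (ENNReal.toReal_pos (evidence_ne_zero hM hy.pos x)
    (evidence_ne_top hM hy.pos x)), mul_le_mul_iff_right₀ (by
      rw [ENNReal.toReal_ofReal hs.le]; exact hs)]

/-! ### The limiting risk -/

theorem totalValue_ne_top (hc : 0 < c) (hϱ : IsSymmDensity c ϱ) {ε : ℝ} (hε : 0 < ε) (j : ℕ) :
    totalValue ε (weightLaw c ϱ) j ≠ ∞ := by
  obtain ⟨B, hB, h⟩ := value_ne_top hc hϱ hε j
  refine ENNReal.add_ne_top.2 ⟨ENNReal.mul_ne_top ENNReal.ofReal_ne_top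
    (lintegral_weightLaw_ne_top hc hϱ (continuous_sideLoss 0) (sideLoss_nonneg 0)), ?_⟩
  exact ne_top_of_le_ne_top hB (h _ _ (stepT_nonneg hε.le (fun _ => le_rfl) 0))

theorem lintegral_sideLoss_weightLaw (hc : 0 < c) (hϱ : IsSymmDensity c ϱ) :
    ∫⁻ w, ENNReal.ofReal (sideLoss 0 w) ∂weightLaw c ϱ =
      ENNReal.ofReal (2 * ∫ w in (0 : ℝ)..c, w * ϱ w) := by
  rw [← stageLoss_onlyT (weightLaw_map_neg hϱ) 0 0 1, stageLoss_weightLaw hc hϱ, gFun,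
    ← intervalIntegral.integral_const_mul]
  simp [onlyT, stepT, mul_assoc]

/-- The normalized risk of the theorem is the limiting value. -/
theorem riskFormula_eq (hc : 0 < c) (hϱ : IsSymmDensity c ϱ) {ε : ℝ} (hε : 0 < ε) {j : ℕ}
    (hj : (j + 2 : ℕ) * ε = 1) (h : IsSolution ε c ϱ r rA) :
    (Integrable fun u => r u ε ε * gaussDensity (0.5 * ε) 0 u) ∧
      riskFormula ε c ϱ r = (totalValue ε (weightLaw c ϱ) (j + 1)).toReal := by
  have hj' : (j + 2) * ε = 1 := by rw [← hj]; push_cast; ring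
  have hjε : 0 ≤ j * ε := by positivity
  have hr : ∀ u, r u ε ε = (value ε (weightLaw c ϱ) j u fun _ => ε).toReal := fun u =>
    (h.eq_value hc hϱ hε j u (fun _ => ε)
      ⟨⟨1, le_rfl, by simp⟩, ⟨1, le_rfl, by simp⟩, by linarith⟩ (by linarith)).1
  obtain ⟨B, hB, hval⟩ := value_ne_top hc hϱ hε j
  obtain ⟨h1, h2⟩ := integrable_mul_gaussDensity
    (measurable_value (ε := ε) (μ := weightLaw c ϱ) j fun _ => ε) hB
    (fun u => hval u _ fun _ => hε.le) (D := 0.5 * ε) (by positivity)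
  have hI : 0 ≤ ∫ w in (0 : ℝ)..c, w * ϱ w :=
    intervalIntegral.integral_nonneg hc.le fun w hw => mul_nonneg hw.1 (hϱ.nonneg w)
  have hfin : ∫⁻ ξ, value ε (weightLaw c ϱ) j ξ (fun _ => ε)
      ∂gaussianReal 0 (0.5 * ε).toNNReal ≠ ∞ :=
    ne_top_of_le_ne_top hB ((lintegral_mono fun ξ => hval ξ _ fun _ => hε.le).trans (by simp))
  simp only [hr]
  refine ⟨h1, ?_⟩
  simp only [riskFormula, hr]
  rw [h2, totalValue, value_succ_onlyT_eq (weightLaw_map_neg hϱ) hε,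
    lintegral_sideLoss_weightLaw hc hϱ, ENNReal.toReal_add (by finiteness) (by finiteness),
    ENNReal.toReal_add (by finiteness) hfin, ENNReal.toReal_mul, ENNReal.toReal_ofReal hε.le,
    ENNReal.toReal_ofReal (by positivity)]
  ring

theorem tendsto_of_sub_le_of_le_add_div {f : ℝ → ℝ} {V E : ℝ}
    (h : ∀ a, 0 < a → V - E / (2 * a) ≤ f a ∧ f a ≤ V + E / (2 * a)) :
    Tendsto f atTop (𝓝 V) := by
  have h0 : Tendsto (fun a : ℝ => E / (2 * a)) atTop (𝓝 0) :=
    tendsto_const_nhds.div_atTop (tendsto_id.const_mul_atTop two_pos)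
  refine tendsto_of_tendsto_of_tendsto_of_le_of_le' (g := fun a => V - E / (2 * a))
    (h := fun a => V + E / (2 * a)) ?_ ?_ ?_ ?_
  · simpa using tendsto_const_nhds.sub h0
  · simpa using tendsto_const_nhds.add h0
  · filter_upwards [eventually_gt_atTop 0] with a ha using (h a ha).1
  · filter_upwards [eventually_gt_atTop 0] with a ha using (h a ha).2

/-- For every strategy, the average loss is at least the limiting value, up to `O(1 / a)`
uniformly in the strategy. -/
theorem le_averageLoss (hM : 0 < M) (hN : 0 < N) (hc : 0 < c) (hϱ : IsSymmDensity c ϱ) (j : ℕ)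
    {a : ℝ} (ha : 0 < a) (σ : Strategy M) :
    √N * (totalValue ((M : ℝ) / N) (weightLaw c ϱ) j).toReal -
        (edgeError M N (weightLaw c ϱ) j).toReal / (2 * a) ≤
      averageLoss (j + 1) (c / √N) (uniformPrior a (unscale N ϱ)) σ := by
  have hε : (0 : ℝ) < (M : ℝ) / N := by positivity
  have hL := futureLoss_windowPrior_ne_top (N := N) hc hϱ σ (j + 1) a Fin.elim0 Fin.elim0
  have hE := edgeError_ne_top (M := M) (N := N) hc hϱ j
  have h := ENNReal.toReal_mono (ENNReal.add_ne_top.2 ⟨hL, hE⟩) (totalValue_le_futureLoss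
    (weightLaw_map_neg hϱ) hM hN σ j a Fin.elim0 Fin.elim0)
  rw [ENNReal.toReal_add hL hE, ENNReal.toReal_mul, ENNReal.toReal_mul,
    ENNReal.toReal_ofReal (by positivity), ENNReal.toReal_ofReal (by positivity)] at h
  rw [averageLoss_eq hN hϱ, sub_le_iff_le_add, ← add_div, le_div_iff₀ (by positivity)]
  linarith

theorem FollowsRecursion.averageLoss_le (hM : 0 < M) (hN : 0 < N) (hc : 0 < c)
    (hϱ : IsSymmDensity c ϱ) (j : ℕ) (hNK : N = M * (j + 2))
    (hK : ((j + 2 : ℕ) : ℝ) * ((M : ℝ) / N) = 1) (h : IsSolution ((M : ℝ) / N) c ϱ r rA)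
    {σ : Strategy M} (hσ : FollowsRecursion N rA σ) {a : ℝ} (ha : 0 < a) :
    averageLoss (j + 2) (c / √N) (uniformPrior a (unscale N ϱ)) σ ≤
      √N * (totalValue ((M : ℝ) / N) (weightLaw c ϱ) (j + 1)).toReal +
        (edgeError M N (weightLaw c ϱ) (j + 1)).toReal / (2 * a) := by
  have hε : (0 : ℝ) < (M : ℝ) / N := by positivity
  have hE := edgeError_ne_top (M := M) (N := N) hc hϱ (j + 1)
  have hV := totalValue_ne_top hc hϱ hε (j + 1)
  have hle := futureLoss_le_totalValue (weightLaw_map_neg hϱ) hM hN j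
    (fun ℓ z => hσ.1 (oneAction ℓ) (oneBatch z)) (hσ.isGreedyFrom hM hN hc hϱ hNK hK h) a
    Fin.elim0 Fin.elim0
  have h := ENNReal.toReal_mono (by finiteness) hle
  rw [ENNReal.toReal_add (by finiteness) hE, ENNReal.toReal_mul, ENNReal.toReal_mul,
    ENNReal.toReal_ofReal (by positivity), ENNReal.toReal_ofReal (by positivity)] at h
  rw [averageLoss_eq hN hϱ, ← sub_le_iff_le_add, div_sub_div_same, div_le_iff₀ (by positivity)]
  linarith

end

end Bandit

theorem theorem2 (N M : ℕ) (hM : 0 < M) (hMN : M ∣ N) (hN : 2 * M ≤ N)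
    (c : ℝ) (hc : 0 < c) (ϱ : ℝ → ℝ) (hϱ : Bandit.IsSymmDensity c ϱ) :
    -- the recursive equation has a solution
    (∃ r rA, Bandit.IsSolution ((M : ℝ) / N) c ϱ r rA) ∧
    ∀ r rA, Bandit.IsSolution ((M : ℝ) / N) c ϱ r rA →
      -- the solution is determined by the equation
      (∀ r' rA', Bandit.IsSolution ((M : ℝ) / N) c ϱ r' rA' →
        ∀ u t₁ t₂, Bandit.OnGrid ((M : ℝ) / N) t₁ t₂ →
          r u t₁ t₂ = r' u t₁ t₂ ∧ ∀ ℓ, rA ℓ u t₁ t₂ = rA' ℓ u t₁ t₂) ∧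
      -- the normalized Bayesian risk
      (Integrable fun u => r u ((M : ℝ) / N) ((M : ℝ) / N) *
        Bandit.gaussDensity (0.5 * ((M : ℝ) / N)) 0 u) ∧
      Tendsto
        (fun a : ℝ => (√N)⁻¹ *
          Bandit.bayesRisk M (N / M) (c / √N) (Bandit.uniformPrior a (Bandit.unscale N ϱ)))
        atTop (𝓝 (Bandit.riskFormula ((M : ℝ) / N) c ϱ r)) ∧
      -- turn-by-turn control followed by the recursive equation attains this risk
      (∃ σ : Bandit.Strategy M, Bandit.FollowsRecursion N rA σ) ∧
      (∀ σ : Bandit.Strategy M, Bandit.FollowsRecursion N rA σ →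
        Tendsto
          (fun a : ℝ => (√N)⁻¹ *
            Bandit.averageLoss (N / M) (c / √N)
              (Bandit.uniformPrior a (Bandit.unscale N ϱ)) σ)
          atTop (𝓝 (Bandit.riskFormula ((M : ℝ) / N) c ϱ r))) ∧
      -- after the initial stage an action is currently optimal iff its value is the smaller one
      (∀ (k : ℕ) (y : Fin k → Fin 2) (x : Fin k → Fin M → ℝ), k * M < N → Bandit.BothUsed y →
        ∀ ℓ, Bandit.IsCurrentlyOptimal (N / M) (c / √N)
            (Bandit.flatPrior (Bandit.unscale N ϱ)) y x ℓ ↔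
          ∀ ℓ', Bandit.scaledValue N rA y x ℓ ≤ Bandit.scaledValue N rA y x ℓ') := by
  obtain ⟨j, hNK⟩ : ∃ j, N = M * (j + 2) := by
    obtain ⟨K, rfl⟩ := hMN
    rw [mul_comm 2] at hN
    obtain ⟨j, rfl⟩ := Nat.exists_eq_add_of_le (le_of_mul_le_mul_left hN hM)
    exact ⟨j, by ring⟩
  have hN0 : 0 < N := by omega
  have hdiv : N / M = j + 2 := by rw [hNK, Nat.mul_div_cancel_left _ hM]
  have hs : (0 : ℝ) < √N := Real.sqrt_pos.2 (by exact_mod_cast hN0)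
  have hM' : (0 : ℝ) < M := by exact_mod_cast hM
  have hN' : (0 : ℝ) < N := by exact_mod_cast hN0
  have hε : (0 : ℝ) < (M : ℝ) / N := by positivity
  have hK : ((j + 2 : ℕ) : ℝ) * ((M : ℝ) / N) = 1 := by
    rw [mul_div_assoc', div_eq_one_iff_eq hN'.ne', hNK]
    push_cast
    ring
  refine ⟨⟨_, _, Bandit.isSolution_value hc hϱ hε hK⟩, fun r rA h => ?_⟩
  obtain ⟨hint, hrisk⟩ := Bandit.riskFormula_eq hc hϱ hε hK h
  have hσ₀ := Bandit.followsRecursion_greedyStrategy hM hN0 hc hϱ hNK hK h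
  have hlim : ∀ f : ℝ → ℝ, Tendsto f atTop (𝓝 (√N * (Bandit.totalValue ((M : ℝ) / N)
      (Bandit.weightLaw c ϱ) (j + 1)).toReal)) →
      Tendsto (fun a => (√N)⁻¹ * f a) atTop (𝓝 (Bandit.riskFormula ((M : ℝ) / N) c ϱ r)) := by
    intro f hf
    have := hf.const_mul (√(N : ℝ))⁻¹
    rwa [inv_mul_cancel_left₀ hs.ne', ← hrisk] at this
  rw [hdiv]
  refine ⟨fun r' rA' h' u t₁ t₂ ht => ?_, hint, hlim _ ?_, ⟨_, hσ₀⟩, fun σ hσ => hlim _ ?_,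
    fun k y x hk hy ℓ => Bandit.isCurrentlyOptimal_iff hM hN0 hc hϱ hNK hK h hy x hk ℓ⟩
  · obtain ⟨i, hi⟩ := ht.exists_remaining hε hK
    have h1 := h.eq_value hc hϱ hε i u ![t₁, t₂] ht hi
    have h2 := h'.eq_value hc hϱ hε i u ![t₁, t₂] ht hi
    exact ⟨h1.1.trans h2.1.symm, fun ℓ => (h1.2 ℓ).trans (h2.2 ℓ).symm⟩
  · refine Bandit.tendsto_of_sub_le_of_le_add_div (E := (Bandit.edgeError M N
      (Bandit.weightLaw c ϱ) (j + 1)).toReal) fun a ha => ⟨?_, ?_⟩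
    · have : Nonempty (Bandit.Strategy M) :=
        ⟨Bandit.greedyStrategy M N (j + 2) c ϱ⟩
      exact le_ciInf fun σ => Bandit.le_averageLoss hM hN0 hc hϱ (j + 1) ha σ
    · refine (ciInf_le ⟨0, ?_⟩ _).trans (hσ₀.averageLoss_le hM hN0 hc hϱ j hNK hK h ha)
      rintro _ ⟨σ, rfl⟩
      beta_reduce
      rw [Bandit.averageLoss_eq hN0 hϱ]
      positivity
  · exact Bandit.tendsto_of_sub_le_of_le_add_div fun a ha =>
      ⟨Bandit.le_averageLoss hM hN0 hc hϱ (j + 1) ha σ,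
        hσ.averageLoss_le hM hN0 hc hϱ j hNK hK h ha⟩
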